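/- **The Brownian map is starry.** Let $W$ be a Wiener process, $B(t)=W(t)-tW(1)$ the Brownian bridge on $[0,1]$, $t_{\min}$ the (almost surely unique) point of $[0,1]$ at which $B$ attains its minimum, and let $\mathbf e$ be the Brownian excursion, $\mathbf e(t)=B(t+t_{\min})-B(t_{\min})$ for $0\le t\le 1-t_{\min}$ and $\mathbf e(t)=B(t-1+t_{\min})-B(t_{\min})$ for $1-t_{\min}<t\le 1$. Let $T_{\mathbf e}$ be the quotient of $[0,1]$ by $d_{\mathbf e}(s,t)=0$, where $d_{\mathbf e}(s,t)=\mathbf e(s)+\mathbf e(t)-2\min_{[s\wedge t,\,s\vee t]}\mathbf e$, with projection $\pi:[0,1]\to T_{\mathbf e}$. Let $Z=(Z(t))_{t\in[0,1]}$ be a process with continuous paths which, conditionally on $\mathbf e$, is a centred Gaussian process with $\mathbb E(Z(s)Z(t)\mid\mathbf e)=\min_{[s\wedge t,\,s\vee t]}\mathbf e$. Put $$D^\circ(s,t)=Z(s)+Z(t)-2\max\Big\{\min_{[s,t]}Z,\ \min_{[t,s]}Z\Big\}\quad(s,t\in[0,1]),$$ where $[s,t]$ means $[s,1]\cup[0,t]$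 if $t<s$; for $x,y\in T_{\mathbf e}$ put $D^\circ(x,y)=\min\{D^\circ(s,t):\pi(s)=x,\ \pi(t)=y\}$; and put $$D(s,t)=\inf\Big\{\sum_{i=0}^{n-1}D^\circ(u_i,u_{i+1})\ :\ n\ge 0,\ u_0,\dots,u_n\in T_{\mathbf e},\ u_0=\pi(s),\ u_n=\pi(t)\Big\}.$$ The Brownian map $(\mathcal M,D)$ is the quotient of $[0,1]$ by $D(s,t)=0$, with the metric induced by $D$. For $A>1$ and $0<\eta<1$ with $\eta<(A-1)/2$, a metric space $(X,d)$ contains an $(A,\eta)$-approximate $n$-star if there are $\varrho>0$ and points $x_0,\dots,x_n\in X$ such that $(A-\eta)\varrho\le d(x_i,x_j)\le A\varrho$ for all distinct $i,j\in\{1,\dots,n\}$ and $\varrho\le d(x_0,x_i)\le(1+\eta)\varrho$ for all $i\in\{1,\dots,n\}$. The space is starry if there are $A>1$ and $0<\eta<(A-1)/2$ such that for every $n$ it contains an $(A_n,\eta)$-approximate $n$-star for some $A_n\ge A$. It is doubling if there is a constant $K$ such that, for every $r>0$, every closed ball of radius $r$ is covered by at most $K$ closed balls of radius $r/2$. Then,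 almost surely, $(\mathcal M,D)$ is starry and, for all $\alpha\in(0,1]$, all increasing functions $\Psi:(0,\infty)\to(0,\infty)$ and all doubling metric spaces $(X,d)$, no homeomorphism $\varphi:\mathcal M\to X$, and more generally no topological embedding $\varphi:\mathcal M\to X$, satisfies $$\frac{d(\varphi(x),\varphi(y))}{d(\varphi(x),\varphi(z))}\le\Psi\left(\frac{D(x,y)^\alpha}{D(x,z)^\alpha}\right)\qquad\text{for all distinct }x,y,z\in\mathcal M.$$ -/

import Mathlib

open MeasureTheory ProbabilityTheory Set Topology
open scoped NNReal unitInterval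

namespace BrownianMap

noncomputable section

/-! ### Metric notions: approximate stars, doubling spaces, power-quasisymmetric maps -/

/-- `X` contains an `(A, η)`-approximate `n`-star: there are a scale `ρ > 0`, a centre `x 0` and
points `x 1, …, x n` at distance between `ρ` and `(1 + η) ρ` from the centre whose mutual distances
lie between `(A - η) ρ` and `A ρ`. -/
def HasApproxStar (X : Type*) [MetricSpace X] (A η : ℝ) (n : ℕ) : Prop :=
  1 < A ∧ 0 < η ∧ η < 1 ∧ η < (A - 1) / 2 ∧
    ∃ ρ : ℝ, 0 < ρ ∧ ∃ x : Fin (n + 1) → X,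
      (∀ i j, i ≠ 0 → j ≠ 0 → i ≠ j →
        (A - η) * ρ ≤ dist (x i) (x j) ∧ dist (x i) (x j) ≤ A * ρ) ∧
      ∀ i, i ≠ 0 → ρ ≤ dist (x 0) (x i) ∧ dist (x 0) (x i) ≤ (1 + η) * ρ

/-- A metric space is starry if there are uniform `A > 1` and `0 < η < (A - 1) / 2` such that, for
every `n`, it contains an `(Aₙ, η)`-approximate `n`-star for some `Aₙ ≥ A`. -/
def IsStarry (X : Type*) [MetricSpace X] : Prop :=
  ∃ A η : ℝ, 1 < A ∧ 0 < η ∧ η < (A - 1) / 2 ∧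
    ∀ n : ℕ, ∃ A' : ℝ, A ≤ A' ∧ HasApproxStar X A' η n

/-- A metric space is doubling if for some `K` every closed ball of radius `r` is covered by at
most `K` closed balls of radius `r / 2`. -/
def IsDoublingSpace (X : Type*) [MetricSpace X] : Prop :=
  ∃ K : ℕ, ∀ (x : X) (r : ℝ), 0 < r →
    ∃ S : Finset X, S.card ≤ K ∧ Metric.closedBall x r ⊆ ⋃ y ∈ S, Metric.closedBall y (r / 2)

/-- `Ψ` restricts to an increasing (not necessarily strictly) function `(0, ∞) → (0, ∞)`. -/
def IsDistortionFunction (Ψ : ℝ → ℝ) : Prop :=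
  MapsTo Ψ (Ioi 0) (Ioi 0) ∧ MonotoneOn Ψ (Ioi 0)

/-- The quasisymmetry inequality with distortion function `Ψ` for the snowflaked metric `d ^ α` on
the source, for all triples of distinct points. -/
def SatisfiesSnowflakeQuasisymmetry {X Y : Type*} [MetricSpace X] [MetricSpace Y]
    (α : ℝ) (Ψ : ℝ → ℝ) (φ : X → Y) : Prop :=
  ∀ x y z : X, x ≠ y → x ≠ z → y ≠ z →
    dist (φ x) (φ y) / dist (φ x) (φ z) ≤ Ψ (dist x y ^ α / dist x z ^ α)

/-! ### The continuum tree coded by a continuous function -/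

/-- The minimum of `f` over the interval between `s` and `t`. -/
def minBetween (f : C(I, ℝ)) (s t : I) : ℝ :=
  sInf (f '' uIcc s t)

theorem bddBelow_image (f : C(I, ℝ)) (S : Set I) : BddBelow (f '' S) :=
  ((isCompact_range f.continuous).bddBelow).mono (image_subset_range _ _)

theorem minBetween_le (f : C(I, ℝ)) {s t u : I} (hu : u ∈ uIcc s t) : minBetween f s t ≤ f u :=
  csInf_le (bddBelow_image f _) (mem_image_of_mem _ hu)

/-- The tree distance `f s + f t - 2 min_{[s ∧ t, s ∨ t]} f`. -/
def treeDist (f : C(I, ℝ)) (s t : I) : ℝ :=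
  f s + f t - 2 * minBetween f s t

theorem treeDist_self (f : C(I, ℝ)) (s : I) : treeDist f s s = 0 := by
  simp [treeDist, minBetween]; ring

theorem treeDist_comm (f : C(I, ℝ)) (s t : I) : treeDist f s t = treeDist f t s := by
  simp only [treeDist, minBetween, uIcc_comm s t]; ring

theorem treeDist_triangle (f : C(I, ℝ)) (s t u : I) :
    treeDist f s u ≤ treeDist f s t + treeDist f t u := by
  have h1 : minBetween f s t ≤ f t := minBetween_le f right_mem_uIcc
  have h2 : minBetween f t u ≤ f t := minBetween_le f left_mem_uIcc
  have h3 : min (minBetween f s t) (minBetween f t u) ≤ minBetween f s u := by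
    refine le_csInf (nonempty_uIcc.image _) ?_
    rintro _ ⟨v, hv, rfl⟩
    rcases uIcc_subset_uIcc_union_uIcc (b := t) hv with h | h
    · exact (min_le_left _ _).trans (minBetween_le f h)
    · exact (min_le_right _ _).trans (minBetween_le f h)
  simp only [treeDist]
  rcases min_choice (minBetween f s t) (minBetween f t u) with h | h <;> rw [h] at h3 <;> linarith

/-- The unit interval, to be equipped with the pseudometric `treeDist f`. -/
def PreTree (_f : C(I, ℝ)) : Type := I

instance (f : C(I, ℝ)) : PseudoMetricSpace (PreTree f) where
  dist := treeDist f
  dist_self := treeDist_self f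
  dist_comm := treeDist_comm f
  dist_triangle := treeDist_triangle f

/-- The continuum tree `T_f`: the quotient of `[0, 1]` by `treeDist f s t = 0`. -/
abbrev ContinuumTree (f : C(I, ℝ)) : Type := SeparationQuotient (PreTree f)

/-- The canonical projection `[0, 1] → T_f`. -/
def treeProj (f : C(I, ℝ)) (s : I) : ContinuumTree f :=
  SeparationQuotient.mk (X := PreTree f) s

theorem treeProj_eq_iff (f : C(I, ℝ)) (s t : I) :
    treeProj f s = treeProj f t ↔ treeDist f s t = 0 :=
  (SeparationQuotient.mk_eq_mk (X := PreTree f)).trans Metric.inseparable_iff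

theorem dist_treeProj (f : C(I, ℝ)) (s t : I) :
    dist (treeProj f s) (treeProj f t) = treeDist f s t := rfl

/-! ### The Brownian map of a tree-coding function `f` and a label function `z` -/

/-- The interval `[s, t]` of the cyclically ordered `[0, 1]`: it is `[s, 1] ∪ [0, t]` if `t < s`. -/
def cyclicIcc (s t : I) : Set I :=
  if s ≤ t then Icc s t else Ici s ∪ Iic t

/-- The function `D°(s, t) = z s + z t - 2 max (min_{[s,t]} z) (min_{[t,s]} z)` on `[0, 1]`. -/
def labelDist (z : C(I, ℝ)) (s t : I) : ℝ :=
  z s + z t - 2 * max (sInf (z '' cyclicIcc s t)) (sInf (z '' cyclicIcc t s))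

theorem left_mem_cyclicIcc (s t : I) : s ∈ cyclicIcc s t := by
  unfold cyclicIcc; split_ifs with h <;> simp [h]

theorem right_mem_cyclicIcc (s t : I) : t ∈ cyclicIcc s t := by
  unfold cyclicIcc; split_ifs with h <;> simp [h]

theorem labelDist_nonneg (z : C(I, ℝ)) (s t : I) : 0 ≤ labelDist z s t := by
  have h (S : Set I) (u : I) (hu : u ∈ S) : sInf (z '' S) ≤ z u :=
    csInf_le (bddBelow_image z _) (mem_image_of_mem _ hu)
  have h1 := max_le (h _ _ (left_mem_cyclicIcc s t)) (h _ _ (right_mem_cyclicIcc t s))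
  have h2 := max_le (h _ _ (right_mem_cyclicIcc s t)) (h _ _ (left_mem_cyclicIcc t s))
  simp only [labelDist]; linarith

theorem labelDist_comm (z : C(I, ℝ)) (s t : I) : labelDist z s t = labelDist z t s := by
  simp only [labelDist, max_comm (sInf (z '' cyclicIcc s t))]; ring

/-- The function `D°` on the tree: the minimum of `D°(s, t)` over all representatives. -/
def treeLabelDist (f z : C(I, ℝ)) (x y : ContinuumTree f) : ℝ :=
  sInf {r : ℝ | ∃ s t : I, treeProj f s = x ∧ treeProj f t = y ∧ labelDist z s t = r}

theorem treeLabelDist_nonneg (f z : C(I, ℝ)) (x y : ContinuumTree f) :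
    0 ≤ treeLabelDist f z x y := by
  refine Real.sInf_nonneg ?_
  rintro _ ⟨s, t, -, -, rfl⟩
  exact labelDist_nonneg z s t

theorem treeLabelDist_comm (f z : C(I, ℝ)) (x y : ContinuumTree f) :
    treeLabelDist f z x y = treeLabelDist f z y x := by
  have h (x y : ContinuumTree f) :
      {r : ℝ | ∃ s t : I, treeProj f s = x ∧ treeProj f t = y ∧ labelDist z s t = r} ⊆
      {r : ℝ | ∃ s t : I, treeProj f s = y ∧ treeProj f t = x ∧ labelDist z s t = r} := by
    rintro _ ⟨s, t, hs, ht, rfl⟩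
    exact ⟨t, s, ht, hs, labelDist_comm z t s⟩
  exact congrArg sInf ((h x y).antisymm (h y x))

/-- The lengths `∑_{i < n} D°(u i, u (i + 1))` of all finite chains in `T_f` from `x` to `y`. -/
def chainLengths (f z : C(I, ℝ)) (x y : ContinuumTree f) : Set ℝ :=
  {r : ℝ | ∃ (n : ℕ) (u : ℕ → ContinuumTree f), u 0 = x ∧ u n = y ∧
    ∑ i ∈ Finset.range n, treeLabelDist f z (u i) (u (i + 1)) = r}

/-- The pseudometric `D` on `[0, 1]`. -/
def mapDist (f z : C(I, ℝ)) (s t : I) : ℝ :=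
  sInf (chainLengths f z (treeProj f s) (treeProj f t))

theorem chainLengths_nonneg {f z : C(I, ℝ)} {x y : ContinuumTree f} {r : ℝ}
    (hr : r ∈ chainLengths f z x y) : 0 ≤ r := by
  obtain ⟨n, u, -, -, rfl⟩ := hr
  exact Finset.sum_nonneg fun i _ => treeLabelDist_nonneg f z _ _

theorem chainLengths_nonempty (f z : C(I, ℝ)) (x y : ContinuumTree f) :
    (chainLengths f z x y).Nonempty :=
  ⟨_, 1, fun i => if i = 0 then x else y, by simp, by simp, rfl⟩

theorem chainLengths_bddBelow (f z : C(I, ℝ)) (x y : ContinuumTree f) :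
    BddBelow (chainLengths f z x y) :=
  ⟨0, fun _ hr => chainLengths_nonneg hr⟩

theorem chainLengths_symm {f z : C(I, ℝ)} {x y : ContinuumTree f} {r : ℝ}
    (hr : r ∈ chainLengths f z x y) : r ∈ chainLengths f z y x := by
  obtain ⟨n, u, h0, hn, rfl⟩ := hr
  refine ⟨n, fun i => u (n - i), by simpa using hn, by simpa using h0, ?_⟩
  rw [← Finset.sum_range_reflect (fun i => treeLabelDist f z (u i) (u (i + 1)))]
  refine Finset.sum_congr rfl fun i hi => ?_
  have hi' := Finset.mem_range.1 hi
  change treeLabelDist f z (u (n - i)) (u (n - (i + 1))) = _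
  rw [treeLabelDist_comm, show n - (i + 1) = n - 1 - i by omega,
    show n - i = n - 1 - i + 1 by omega]

theorem chainLengths_trans {f z : C(I, ℝ)} {x y w : ContinuumTree f} {r r' : ℝ}
    (hr : r ∈ chainLengths f z x y) (hr' : r' ∈ chainLengths f z y w) :
    r + r' ∈ chainLengths f z x w := by
  obtain ⟨n, u, h0, hn, rfl⟩ := hr
  obtain ⟨m, v, h0', hm, rfl⟩ := hr'
  refine ⟨n + m, fun i => if i ≤ n then u i else v (i - n), by simpa using h0, ?_, ?_⟩
  · rcases Nat.eq_zero_or_pos m with rfl | h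
    · simp [hn, ← hm, h0']
    · simp [hm, h.ne']
  · rw [Finset.sum_range_add]
    congr 1
    · refine Finset.sum_congr rfl fun i hi => ?_
      have hi' := Finset.mem_range.1 hi
      simp [hi'.le, Nat.succ_le_of_lt hi']
    · refine Finset.sum_congr rfl fun i _ => ?_
      rcases Nat.eq_zero_or_pos i with rfl | h
      · simp [hn, h0']
      · simp [h.ne', add_assoc]

theorem mapDist_self (f z : C(I, ℝ)) (s : I) : mapDist f z s s = 0 :=
  le_antisymm
    (csInf_le (chainLengths_bddBelow _ _ _ _) ⟨0, fun _ => treeProj f s, rfl, rfl, by simp⟩)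
    (Real.sInf_nonneg fun _ hr => chainLengths_nonneg hr)

theorem mapDist_comm (f z : C(I, ℝ)) (s t : I) : mapDist f z s t = mapDist f z t s :=
  congrArg sInf (Subset.antisymm (fun _ h => chainLengths_symm h) fun _ h => chainLengths_symm h)

theorem mapDist_triangle (f z : C(I, ℝ)) (s t u : I) :
    mapDist f z s u ≤ mapDist f z s t + mapDist f z t u := by
  rw [← sub_le_iff_le_add]
  refine le_csInf (chainLengths_nonempty _ _ _ _) fun r hr => ?_
  rw [sub_le_comm]
  refine le_csInf (chainLengths_nonempty _ _ _ _) fun r' hr' => ?_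
  rw [sub_le_iff_le_add']
  exact csInf_le (chainLengths_bddBelow _ _ _ _) (chainLengths_trans hr hr')

/-- The unit interval, to be equipped with the pseudometric `mapDist f z`. -/
def PreMap (_f _z : C(I, ℝ)) : Type := I

instance (f z : C(I, ℝ)) : PseudoMetricSpace (PreMap f z) where
  dist := mapDist f z
  dist_self := mapDist_self f z
  dist_comm := mapDist_comm f z
  dist_triangle := mapDist_triangle f z

/-- The metric space `(M, D)`: the quotient of `[0, 1]` by `D(s, t) = 0`, with the metric induced
by `D`. -/
abbrev MapSpace (f z : C(I, ℝ)) : Type := SeparationQuotient (PreMap f z)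

/-- The canonical projection `[0, 1] → M`. -/
def mapProj (f z : C(I, ℝ)) (s : I) : MapSpace f z :=
  SeparationQuotient.mk (X := PreMap f z) s

theorem dist_mapProj (f z : C(I, ℝ)) (s t : I) :
    dist (mapProj f z s) (mapProj f z t) = mapDist f z s t := rfl

/-! ### The Brownian excursion and its Gaussian labels -/

/-- The Brownian bridge `B t = W t - t W 1` made from a path `w` of a Wiener process. -/
def bridge (w : ℝ≥0 → ℝ) (t : ℝ) : ℝ :=
  w t.toNNReal - t * w 1

/-- The (first) time in `[0, 1]` at which `b` attains its minimum over `[0, 1]`. -/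
def argminTime (b : ℝ → ℝ) : ℝ :=
  sInf {t ∈ Icc (0 : ℝ) 1 | IsMinOn b (Icc 0 1) t}

/-- The path obtained from `b` by cutting at its minimum, exchanging the two pieces and
translating. -/
def cutAtMin (b : ℝ → ℝ) (t : ℝ) : ℝ :=
  if t ≤ 1 - argminTime b then b (t + argminTime b) - b (argminTime b)
  else b (t - 1 + argminTime b) - b (argminTime b)

instance : MeasurableSpace C(I, ℝ) := borel _

instance : BorelSpace C(I, ℝ) := ⟨rfl⟩

variable {Ω : Type*} [MeasurableSpace Ω]

/-- The random continuous function `e` is a (normalised) Brownian excursion: it is the bridge of a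
Wiener process, cut at its minimum. -/
def IsBrownianExcursion (e : Ω → C(I, ℝ)) (P : Measure Ω) : Prop :=
  AEMeasurable e P ∧ ∃ W : ℝ≥0 → Ω → ℝ, IsBrownianReal W P ∧
    ∀ᵐ ω ∂P, ∀ t : I, e ω t = cutAtMin (bridge fun s => W s ω) t

/-- Conditionally on `e`, the random continuous function `Z` is a centred Gaussian process with
covariance `E(Z s Z t | e) = min_{[s ∧ t, s ∨ t]} e`: the conditional law of `Z` given `e` is a
Markov kernel `κ` such that `κ f` is Gaussian, centred, with covariance `minBetween f`. -/
def IsGaussianLabelling (Z e : Ω → C(I, ℝ)) (P : Measure Ω) : Prop :=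
  ∃ κ : Kernel C(I, ℝ) C(I, ℝ), IsMarkovKernel κ ∧ HasCondDistrib Z e κ P ∧
    ∀ᵐ f ∂(P.map e),
      IsGaussianProcess (fun (t : I) (z : C(I, ℝ)) => z t) (κ f) ∧
      (∀ t : I, ∫ z : C(I, ℝ), z t ∂(κ f) = 0) ∧
      ∀ s t : I, ∫ z : C(I, ℝ), z s * z t ∂(κ f) = minBetween f s t

end

end BrownianMap

namespace BrownianMap

/-! ### Starry spaces do not embed into doubling spaces -/

/-! Two independent facts are combined.

Deterministic: a starry space has no power-quasisymmetric injection into a doubling space. Under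
such a map the leaves of a star stay comparable to one another in distance from the centre and stay
separated at that same scale, with a constant depending only on `Ψ (2 ^ α)`; a doubling space has
room for boundedly many such points (`IsStarry.not_satisfiesSnowflakeQuasisymmetry`).

Random: the Brownian map contains an `n`-star for every `n`. Distances in the map are controlled by
labels. From below there are the label difference and, for two leaves, `cactus_bound`: a path has to
descend to the lowest label forced by the tree path between them. From above there is `D°`. Hence it
suffices to find a base time followed by `n` times with labels about `100 r` higher, such that
labels in between do not fall noticeably below the base label and the branch points between the `n`
times have labels close to or below it (`HasLabelStar.hasApproxStar`).

Such label patterns come from combs, stretches where the excursion makes `n` zigzags of size `δ`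
with a modulus of continuity of the same order. Brownian motion behaves independently on the
intervals `[4⁻ᵏ, 2 · 4⁻ᵏ]` and makes a comb there with probability bounded below, so infinitely many
disjoint combs occur. Near one of its times the excursion is a translate of the bridge near `0`, so
it inherits them (`excursion_hasCombs`).

Given the excursion, the label increments along the teeth of all combs are independent Gaussians of
variance of order `δ`, and within each comb they are independent of the residual labels obtained by
regression on them. With probability bounded below all `n` increments of a comb lie in a narrow
window at a large multiple of `√δ`; given this, the residual is small with probability at least `1 -
ε`. A second moment argument over infinitely many combs produces a star with probability at least `1
- 2 ε`, for every `ε` (`IsLabelLaw.ae_hasLabelStar`). Joint measurability then carries the statement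
from fixed trees to the random one. -/

theorem IsDoublingSpace.exists_cover_pow {X : Type*} [MetricSpace X] {K : ℕ}
    (hK : ∀ (x : X) (r : ℝ), 0 < r → ∃ S : Finset X, S.card ≤ K ∧
      Metric.closedBall x r ⊆ ⋃ y ∈ S, Metric.closedBall y (r / 2))
    (m : ℕ) (x : X) (r : ℝ) (hr : 0 < r) :
    ∃ S : Finset X, S.card ≤ K ^ m ∧
      Metric.closedBall x r ⊆ ⋃ y ∈ S, Metric.closedBall y (r / 2 ^ m) := by
  classical
  induction m with
  | zero => exact ⟨{x}, by simp, by simp⟩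
  | succ m ih =>
    obtain ⟨S, hS, hcov⟩ := ih
    choose T hT hTcov using fun y : X => hK y (r / 2 ^ m) (by positivity)
    refine ⟨S.biUnion T, ?_, ?_⟩
    · calc (S.biUnion T).card ≤ S.card * K := Finset.card_biUnion_le_card_mul _ _ _ fun y _ => hT y
        _ ≤ K ^ m * K := Nat.mul_le_mul_right _ hS
        _ = K ^ (m + 1) := (pow_succ _ _).symm
    · intro p hp
      obtain ⟨y, hy, hpy⟩ := mem_iUnion₂.1 (hcov hp)
      obtain ⟨w, hw, hpw⟩ := mem_iUnion₂.1 (hTcov y hpy)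
      refine mem_iUnion₂.2 ⟨w, Finset.mem_biUnion.2 ⟨y, hy, hw⟩, ?_⟩
      rwa [pow_succ, ← div_div]

/-- Pigeonhole: the images of the leaves lie in a ball of radius `C r` covered by `K ^ m` balls of
radius `C r / 2 ^ m`, so two of the leaves have close images. Their distance dominates `r / C ^ 2`,
which is impossible once `2 ^ m > 2 C ^ 3`. Injectivity is all that is needed of the map. -/
theorem IsStarry.not_satisfiesSnowflakeQuasisymmetry {M X : Type*} [MetricSpace M] [MetricSpace X]
    (hM : IsStarry M) (hX : IsDoublingSpace X) {α : ℝ} (hα : 0 < α) {Ψ : ℝ → ℝ}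
    (hΨ : IsDistortionFunction Ψ) {φ : M → X} (hφ : Function.Injective φ) :
    ¬ SatisfiesSnowflakeQuasisymmetry α Ψ φ := by
  intro hqs
  obtain ⟨K, hK⟩ := hX
  obtain ⟨A, η, -, -, -, hstar⟩ := hM
  set C := max 1 (Ψ (2 ^ α)) with hC
  have hC1 : 1 ≤ C := le_max_left _ _
  have hC0 : 0 < C := one_pos.trans_le hC1
  obtain ⟨m, hm⟩ := pow_unbounded_of_one_lt (2 * C ^ 3) (one_lt_two)
  obtain ⟨A', -, hA', hη0, hη1, hηA, ρ, hρ, x, hx, hx0⟩ := hstar (K ^ m + 2)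
  have hpos {a b : M} (h : a ≠ b) : 0 < dist (φ a) (φ b) := dist_pos.2 (hφ.ne h)
  have h0 (i) (hi : i ≠ 0) : x 0 ≠ x i := dist_pos.1 (hρ.trans_le (hx0 i hi).1)
  have hne (i j) (hi : i ≠ 0) (hj : j ≠ 0) (hij : i ≠ j) : x i ≠ x j :=
    dist_pos.1 ((mul_pos (by linarith) hρ).trans_le (hx i j hi hj hij).1)
  have hΨle {t : ℝ} (ht0 : 0 < t) (ht : t ≤ 2) : Ψ (t ^ α) ≤ C :=
    (hΨ.2 (Real.rpow_pos_of_pos ht0 _) (mem_Ioi.2 (by positivity))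
      (Real.rpow_le_rpow ht0.le ht hα.le)).trans (le_max_right _ _)
  -- The ratio `2` covers both uses below: `η < 1` gives `(1 + η) ρ ≤ 2 ρ`, and `η < (A' - 1) / 2`
  -- gives `1 + η < A' - η`.
  have key {a b c : M} (hab : a ≠ b) (hac : a ≠ c) (hbc : b ≠ c) (h : dist a b ≤ 2 * dist a c) :
      dist (φ a) (φ b) ≤ C * dist (φ a) (φ c) := by
    have h1 := hqs a b c hab hac hbc
    rw [← Real.div_rpow dist_nonneg dist_nonneg] at h1
    have h2 : 0 < dist a b / dist a c := div_pos (dist_pos.2 hab) (dist_pos.2 hac)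
    have h3 := h1.trans (hΨle h2 ((div_le_iff₀ (dist_pos.2 hac)).2 h))
    exact (div_le_iff₀ (hpos hac)).1 h3
  have hcen (i j) (hi : i ≠ 0) (hj : j ≠ 0) :
      dist (φ (x 0)) (φ (x i)) ≤ C * dist (φ (x 0)) (φ (x j)) := by
    rcases eq_or_ne i j with rfl | hij
    · exact le_mul_of_one_le_left dist_nonneg hC1
    · refine key (h0 i hi) (h0 j hj) (hne i j hi hj hij) ?_
      nlinarith [(hx0 i hi).2, (hx0 j hj).1]
  have hmut (i j) (hi : i ≠ 0) (hj : j ≠ 0) (hij : i ≠ j) :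
      dist (φ (x 0)) (φ (x i)) ≤ C * dist (φ (x i)) (φ (x j)) := by
    rw [dist_comm]
    refine key (h0 i hi).symm (hne i j hi hj hij) (h0 j hj) ?_
    rw [dist_comm]
    nlinarith [(hx0 i hi).2, (hx i j hi hj hij).1]
  set r := dist (φ (x 0)) (φ (x 1)) with hr
  have h10 : (1 : Fin (K ^ m + 2 + 1)) ≠ 0 := by simp
  have hr0 : 0 < r := hpos (h0 1 h10)
  obtain ⟨S, hS, hcov⟩ := IsDoublingSpace.exists_cover_pow hK m (φ (x 0)) (C * r) (by positivity)
  have hmem (i : Fin (K ^ m + 2)) : ∃ y ∈ S, φ (x i.succ) ∈ Metric.closedBall y (C * r / 2 ^ m) := by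
    have : φ (x i.succ) ∈ Metric.closedBall (φ (x 0)) (C * r) := by
      rw [Metric.mem_closedBall, dist_comm]
      exact hcen _ _ (Fin.succ_ne_zero i) h10
    simpa using hcov this
  choose y hyS hy using hmem
  obtain ⟨i, -, j, -, hij, hyij⟩ := Finset.exists_ne_map_eq_of_card_lt_of_maps_to
    (s := Finset.univ) (t := S) (f := y) (by simp; omega) (fun i _ => hyS i)
  have hij' : i.succ ≠ j.succ := fun h => hij (Fin.succ_injective _ h)
  have hd : dist (φ (x i.succ)) (φ (x j.succ)) ≤ 2 * (C * r / 2 ^ m) := by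
    have h1 := hy i
    have h2 := hy j
    rw [← hyij] at h2
    rw [Metric.mem_closedBall] at h1 h2
    linarith [dist_triangle_right (φ (x i.succ)) (φ (x j.succ)) (y i)]
  have h1 := hmut _ _ (Fin.succ_ne_zero i) (Fin.succ_ne_zero j) hij'
  have h2 := hcen 1 _ h10 (Fin.succ_ne_zero i)
  have h3 : r ≤ C * (C * (2 * (C * r / 2 ^ m))) :=
    h2.trans (mul_le_mul_of_nonneg_left (h1.trans (mul_le_mul_of_nonneg_left hd hC0.le)) hC0.le)
  have h4 : C * (C * (2 * (C * r / 2 ^ m))) = 2 * C ^ 3 / 2 ^ m * r := by ring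
  have h5 : 2 * C ^ 3 / 2 ^ m < 1 := (div_lt_one (by positivity)).2 hm
  nlinarith

/-! ### The cactus bound -/

theorem exists_eq_minBetween (f : C(I, ℝ)) (s t : I) : ∃ m ∈ uIcc s t, f m = minBetween f s t := by
  obtain ⟨m, hm, h⟩ := (isCompact_uIcc.image f.continuous).sInf_mem (nonempty_uIcc.image _)
  exact ⟨m, hm, h⟩

theorem le_minBetween {f : C(I, ℝ)} {s t : I} {c : ℝ} (h : ∀ u ∈ uIcc s t, c ≤ f u) :
    c ≤ minBetween f s t := by
  obtain ⟨m, hm, hfm⟩ := exists_eq_minBetween f s t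
  exact hfm ▸ h m hm

theorem minBetween_comm (f : C(I, ℝ)) (s t : I) : minBetween f s t = minBetween f t s := by
  simp only [minBetween, uIcc_comm s t]

theorem minBetween_self (f : C(I, ℝ)) (s : I) : minBetween f s s = f s := by
  simp [minBetween]

theorem treeDist_nonneg (f : C(I, ℝ)) (s t : I) : 0 ≤ treeDist f s t := by
  have h1 : minBetween f s t ≤ f s := minBetween_le f left_mem_uIcc
  have h2 : minBetween f s t ≤ f t := minBetween_le f right_mem_uIcc
  simp only [treeDist]; linarith

/-- The labels `z` are constant on the classes of times coding the same point of the tree. -/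
def LabelsFactor (f z : C(I, ℝ)) : Prop :=
  ∀ s t : I, treeDist f s t = 0 → z s = z t

theorem treeDist_eq_zero {f : C(I, ℝ)} {s t : I} (hst : f s = f t)
    (h : ∀ u ∈ uIcc s t, f s ≤ f u) : treeDist f s t = 0 := by
  have h1 := le_minBetween h
  have h2 : minBetween f s t ≤ f s := minBetween_le f left_mem_uIcc
  simp only [treeDist]; linarith

theorem le_of_treeDist_eq_zero {f : C(I, ℝ)} {s t : I} (h : treeDist f s t = 0) :
    f s = f t ∧ ∀ u ∈ uIcc s t, f s ≤ f u := by
  have h1 : minBetween f s t ≤ f s := minBetween_le f left_mem_uIcc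
  have h2 : minBetween f s t ≤ f t := minBetween_le f right_mem_uIcc
  simp only [treeDist] at h
  refine ⟨by linarith, fun u hu => ?_⟩
  have := minBetween_le f hu
  linarith

theorem labelDist_ge_abs (z : C(I, ℝ)) (s t : I) : |z s - z t| ≤ labelDist z s t := by
  have h (S : Set I) (u : I) (hu : u ∈ S) : sInf (z '' S) ≤ z u :=
    csInf_le (bddBelow_image z _) (mem_image_of_mem _ hu)
  have h1 := max_le (h _ _ (left_mem_cyclicIcc s t)) (h _ _ (right_mem_cyclicIcc t s))
  have h2 := max_le (h _ _ (right_mem_cyclicIcc s t)) (h _ _ (left_mem_cyclicIcc t s))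
  simp only [labelDist]
  rw [abs_le]; constructor <;> linarith

theorem labelDist_ge_of_mem {z : C(I, ℝ)} {s t u v : I} {c : ℝ} (hu : u ∈ cyclicIcc s t)
    (hv : v ∈ cyclicIcc t s) (hzu : z u = c) (hzv : z v = c) :
    z s + z t - 2 * c ≤ labelDist z s t := by
  have h (S : Set I) (u : I) (hu : u ∈ S) : sInf (z '' S) ≤ z u :=
    csInf_le (bddBelow_image z _) (mem_image_of_mem _ hu)
  have h1 := max_le ((h _ _ hu).trans hzu.le) ((h _ _ hv).trans hzv.le)
  simp only [labelDist]; linarith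

theorem labelDist_le_of_le {z : C(I, ℝ)} {s t : I} {c : ℝ} (hst : s ≤ t)
    (h : ∀ u ∈ Icc s t, c ≤ z u) : labelDist z s t ≤ z s + z t - 2 * c := by
  have h1 : c ≤ sInf (z '' cyclicIcc s t) := by
    refine le_csInf ⟨_, mem_image_of_mem _ (left_mem_cyclicIcc s t)⟩ ?_
    rintro _ ⟨u, hu, rfl⟩
    rw [cyclicIcc, if_pos hst] at hu
    exact h u hu
  have := h1.trans (le_max_left _ (sInf (z '' cyclicIcc t s)))
  simp only [labelDist]; linarith

theorem mapDist_le_labelDist (f z : C(I, ℝ)) (s t : I) : mapDist f z s t ≤ labelDist z s t := by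
  have h1 : mapDist f z s t ≤ treeLabelDist f z (treeProj f s) (treeProj f t) :=
    csInf_le (chainLengths_bddBelow _ _ _ _)
      ⟨1, fun i => if i = 0 then treeProj f s else treeProj f t, by simp, by simp, by simp⟩
  refine h1.trans (csInf_le ⟨0, ?_⟩ ⟨s, t, rfl, rfl, rfl⟩)
  rintro _ ⟨s, t, -, -, rfl⟩
  exact labelDist_nonneg z s t

theorem le_treeLabelDist {f z : C(I, ℝ)} {x y : ContinuumTree f} {c : ℝ}
    (h : ∀ s t, treeProj f s = x → treeProj f t = y → c ≤ labelDist z s t) :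
    c ≤ treeLabelDist f z x y := by
  have hne (x : ContinuumTree f) : ∃ s, treeProj f s = x :=
    SeparationQuotient.surjective_mk (X := PreTree f) x
  obtain ⟨s, rfl⟩ := hne x
  obtain ⟨t, rfl⟩ := hne y
  refine le_csInf ⟨_, s, t, rfl, rfl, rfl⟩ ?_
  rintro _ ⟨s, t, hs, ht, rfl⟩
  exact h s t hs ht

/-- Telescoping before and after the distinguished step: one step of a chain that pays for a descent
to level `c` suffices for the whole chain to pay for it. -/
theorem sum_range_ge_of_step {n : ℕ} {d ζ : ℕ → ℝ} {c : ℝ} (h : ∀ i, |ζ i - ζ (i + 1)| ≤ d i)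
    {i : ℕ} (hi : i < n) (hstep : ζ i + ζ (i + 1) - 2 * c ≤ d i) :
    ζ 0 + ζ n - 2 * c ≤ ∑ j ∈ Finset.range n, d j := by
  have hdown (k : ℕ) : ζ 0 - ζ k ≤ ∑ j ∈ Finset.range k, d j := by
    rw [← Finset.sum_range_sub' ζ k]
    exact Finset.sum_le_sum fun j _ => (le_abs_self _).trans (h j)
  have hup (k : ℕ) (hk : i + 1 ≤ k) :
      ζ 0 + ζ k - 2 * c ≤ ∑ j ∈ Finset.range k, d j := by
    induction k, hk using Nat.le_induction with
    | base => rw [Finset.sum_range_succ]; linarith [hdown i]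
    | succ k _ ih =>
      rw [Finset.sum_range_succ]
      linarith [(neg_le_abs _).trans (h k)]
  exact hup n hi

/-- A time before `p` coding the ancestor at height `f m` of the point coded by `p`. -/
theorem exists_left_ancestor {f : C(I, ℝ)} {m p : I} (h0 : f 0 ≤ f m) (hp : f m ≤ f p) :
    ∃ ℓ ≤ p, f ℓ = f m ∧ ∀ u ∈ Icc ℓ p, f m ≤ f u := by
  set S := {r : I | r ≤ p ∧ f r ≤ f m} with hS
  have hSc : IsClosed S :=
    (isClosed_le continuous_id continuous_const).inter (isClosed_le f.continuous continuous_const)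
  have hℓ : sSup S ∈ S := hSc.isCompact.sSup_mem ⟨0, unitInterval.nonneg p, h0⟩
  set ℓ := sSup S
  have hgt (u : I) (hu : u ∈ Ioc ℓ p) : f m < f u := by
    by_contra h
    exact absurd (le_csSup (OrderTop.bddAbove S) ⟨hu.2, not_lt.1 h⟩) (not_le.2 hu.1)
  have hℓm : f m ≤ f ℓ := by
    rcases hℓ.1.eq_or_lt with h | h
    · rwa [h]
    · have hcl : ℓ ∈ closure (Ioc ℓ p) := by
        rw [closure_Ioc h.ne]; exact left_mem_Icc.2 h.le
      have hcl' : IsClosed {u : I | f m ≤ f u} := isClosed_le continuous_const f.continuous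
      exact closure_minimal (fun u hu => (hgt u hu).le) hcl' hcl
  refine ⟨ℓ, hℓ.1, le_antisymm hℓ.2 hℓm, fun u hu => ?_⟩
  rcases hu.1.eq_or_lt with h | h
  · rwa [← h]
  · exact (hgt u ⟨h, hu.2⟩).le

/-- Each step of a chain costs at least its label difference. Steps can be chained in the tree
because labels do not depend on the representative. -/
theorem abs_sub_le_mapDist {f z : C(I, ℝ)} (hz : LabelsFactor f z) (s t : I) :
    |z s - z t| ≤ mapDist f z s t := by
  have hne (x : ContinuumTree f) : ∃ s, treeProj f s = x :=
    SeparationQuotient.surjective_mk (X := PreTree f) x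
  choose rep hrep using hne
  have hzrep (p : I) : z (rep (treeProj f p)) = z p :=
    hz _ _ ((treeProj_eq_iff f _ _).1 (hrep _))
  refine le_csInf (chainLengths_nonempty _ _ _ _) ?_
  rintro _ ⟨n, u, hu0, hun, rfl⟩
  have h1 := Finset.sum_le_sum (s := Finset.range n)
    (f := fun i => |z (rep (u i)) - z (rep (u (i + 1)))|)
    (g := fun i => treeLabelDist f z (u i) (u (i + 1))) fun i _ => ?_
  · refine le_trans ?_ h1
    rw [← hzrep s, ← hzrep t, ← hu0, ← hun, ← Finset.sum_range_sub' (fun i => z (rep (u i))) n]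
    exact Finset.abs_sum_le_sum_abs _ _
  · refine le_treeLabelDist fun p q hp hq => ?_
    rw [← hp, ← hq, hzrep, hzrep]
    exact labelDist_ge_abs z p q

/-- The cactus bound: a path from `s` to `t` in the map has to go at least as low as the labels on
the tree path from `s` to `t`. -/
theorem cactus_bound {f z : C(I, ℝ)} (hz : LabelsFactor f z) (h0 : ∀ u, f 0 ≤ f u) {s t m : I}
    (hm : m ∈ Icc s t) (hmin : ∀ u ∈ Icc s t, f m ≤ f u) :
    z s + z t - 2 * z m ≤ mapDist f z s t := by
  have hne (x : ContinuumTree f) : ∃ s, treeProj f s = x :=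
    SeparationQuotient.surjective_mk (X := PreTree f) x
  choose rep hrep using hne
  have hzrep (p : I) : z (rep (treeProj f p)) = z p :=
    hz _ _ ((treeProj_eq_iff f _ _).1 (hrep _))
  -- Times up to `m` coding descendants of the tree point of `m`, the branch point of `s` and `t`. A
  -- chain from `s` to `t` has to leave this set.
  set V : Set I := {p | p ≤ m ∧ ∀ u ∈ Icc p m, f m ≤ f u} with hV
  have hsV : s ∈ V := ⟨hm.1, fun u hu => hmin u ⟨hu.1, hu.2.trans hm.2⟩⟩
  -- times of `V` coding `m`
  have hVm (p : I) (hp : p ∈ V) (hfp : f p = f m) : z p = z m := by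
    refine hz _ _ (treeDist_eq_zero hfp fun u hu => ?_)
    rw [uIcc_of_le hp.1] at hu
    exact hfp.le.trans (hp.2 u hu)
  -- `V` is saturated, but for times coding `m`
  have hsat (p q : I) (hp : p ∈ V) (hpq : treeDist f p q = 0) : q ∈ V ∨ z p = z m := by
    obtain ⟨he, hle⟩ := le_of_treeDist_eq_zero hpq
    have hpm : f m ≤ f p := hp.2 p ⟨le_rfl, hp.1⟩
    rcases le_total q m with hq | hq
    · refine .inl ⟨hq, fun u hu => ?_⟩
      rcases le_total p u with hpu | hpu
      · exact hp.2 u ⟨hpu, hu.2⟩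
      · exact hpm.trans (hle u (by rw [uIcc_comm]; exact Icc_subset_uIcc ⟨hu.1, hpu⟩))
    · exact .inr (hVm p hp (le_antisymm (hle m (Icc_subset_uIcc ⟨hp.1, hq⟩)) hpm))
  -- Both cyclic intervals between `p` and `q` contain a time coding the tree point of `m`: one
  -- contains `m` itself, the other the left ancestor `ℓ` of `p` at height `f m`. So neither way
  -- round avoids the label `z m`.
  have hcross (p q : I) (hp : p ∈ V) (hq : q ∉ V) : z p + z q - 2 * z m ≤ labelDist z p q := by
    have hpm : f m ≤ f p := hp.2 p ⟨le_rfl, hp.1⟩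
    obtain ⟨ℓ, hℓp, hℓ, hℓV⟩ := exists_left_ancestor (h0 m) hpm
    have hconv (u : I) (hu : u ∈ Icc ℓ m) : f m ≤ f u := by
      rcases le_total u p with h | h
      · exact hℓV u ⟨hu.1, h⟩
      · exact hp.2 u ⟨h, hu.2⟩
    have hℓm : z ℓ = z m :=
      hVm ℓ ⟨hℓp.trans hp.1, hconv⟩ hℓ
    rcases le_or_gt q m with hqm | hqm
    · have hqℓ : q < ℓ := by
        by_contra h
        exact hq ⟨hqm, fun u hu => hconv u ⟨(not_lt.1 h).trans hu.1, hu.2⟩⟩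
      refine labelDist_ge_of_mem (u := m) (v := ℓ) ?_ ?_ rfl hℓm
      · rw [cyclicIcc, if_neg (not_le.2 (hqℓ.trans_le hℓp))]
        exact .inl hp.1
      · rw [cyclicIcc, if_pos (hqℓ.le.trans hℓp)]
        exact ⟨hqℓ.le, hℓp⟩
    · refine labelDist_ge_of_mem (u := m) (v := ℓ) ?_ ?_ rfl hℓm
      · rw [cyclicIcc, if_pos (hp.1.trans hqm.le)]
        exact ⟨hp.1, hqm.le⟩
      · rw [cyclicIcc, if_neg (not_le.2 (hp.1.trans_lt hqm))]
        exact .inr hℓp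
  -- If an endpoint has the label of `m`, the claim reduces to the bound by label differences. This
  -- disposes of the times coding `m`, the only ones for which `V` may fail to be saturated.
  by_cases htm : z t = z m
  · have := (le_abs_self _).trans (abs_sub_le_mapDist hz s t)
    linarith
  by_cases hsm : z s = z m
  · have := (neg_le_abs _).trans (abs_sub_le_mapDist hz s t)
    linarith
  refine le_csInf (chainLengths_nonempty _ _ _ _) ?_
  rintro _ ⟨n, u, hu0, hun, rfl⟩
  have hstep (i : ℕ) : |z (rep (u i)) - z (rep (u (i + 1)))| ≤ treeLabelDist f z (u i) (u (i + 1)) := by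
    refine le_treeLabelDist fun p q hp hq => ?_
    rw [← hp, ← hq, hzrep, hzrep]
    exact labelDist_ge_abs z p q
  suffices H : ∃ i < n, z (rep (u i)) + z (rep (u (i + 1))) - 2 * z m ≤
      treeLabelDist f z (u i) (u (i + 1)) by
    obtain ⟨i, hi, h⟩ := H
    have := sum_range_ge_of_step (ζ := fun i => z (rep (u i))) hstep hi h
    simpa only [hu0, hun, hzrep] using this
  -- the chain leaves `V` at some step
  have h0V : rep (u 0) ∈ V := by
    refine (hsat s _ hsV ?_).resolve_right hsm
    rw [← treeProj_eq_iff, hrep, hu0]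
  have hnV : rep (u n) ∉ V := by
    intro h
    have ht0 : treeDist f (rep (u n)) t = 0 := by rw [← treeProj_eq_iff, hrep, hun]
    rcases hsat _ t h ht0 with h1 | h1
    · obtain rfl : t = m := le_antisymm h1.1 hm.2
      exact htm rfl
    · exact htm ((hz _ _ ht0).symm.trans h1)
  obtain ⟨i, hin, hiV, hiV'⟩ : ∃ i < n, rep (u i) ∈ V ∧ rep (u (i + 1)) ∉ V := by
    by_contra! hcon
    have : ∀ i ≤ n, rep (u i) ∈ V := by
      intro i
      induction i with
      | zero => exact fun _ => h0V
      | succ i ih => exact fun hi => hcon i hi (ih (Nat.le_of_succ_le hi))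
    exact hnV (this n le_rfl)
  refine ⟨i, hin, ?_⟩
  by_cases him : z (rep (u i)) = z m
  · have := (neg_le_abs _).trans (hstep i)
    linarith
  by_cases him' : z (rep (u (i + 1))) = z m
  · have := (le_abs_self _).trans (hstep i)
    linarith
  refine le_treeLabelDist fun p q hp hq => ?_
  rw [← hp, ← hq, hzrep, hzrep]
  refine hcross p q ?_ fun hqV => hiV' ?_
  · exact (hsat _ p hiV (by rw [← treeProj_eq_iff, hrep, hp])).resolve_right him
  · refine (hsat q _ hqV (by rw [← treeProj_eq_iff, hrep, hq])).resolve_right fun h => him' ?_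
    rw [← h, ← hq, hzrep]

/-! ### Stars in the map from a comb of labels -/

/-- A base time `a`, followed by times `u i` whose labels are about `100 r` above that of `a`, while
no label in between is below `z a - r`, and the labels on the tree path between two of the `u i`
go down to `z a + r`. -/
def HasLabelStar (n : ℕ) (f z : C(I, ℝ)) : Prop :=
  ∃ r : ℝ, 0 < r ∧ ∃ (a : I) (u : Fin n → I),
    (∀ i, a ≤ u i) ∧
    (∀ i, ∀ t ∈ Icc a (u i), z a - r < z t) ∧
    (∀ i, z a + 100 * r < z (u i) ∧ z (u i) < z a + 103 * r) ∧
    ∀ i j, i ≠ j → ∀ m ∈ uIcc (u i) (u j), (∃ t ∈ uIcc (u i) (u j), f t < f m) ∨ z m < z a + r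

/-- With `ρ = 100 r`: centre to leaf lies between `100 r` (label difference) and `105 r` (`D°` with
minimum above `z a - r`). Leaf to leaf lies between `2 · 100 r - 2 r = 198 r` (cactus bound) and
`210 r` (triangle inequality through the centre). The values `2.1` and `0.15` leave room, uniformly
in `n`. -/
theorem HasLabelStar.hasApproxStar {n : ℕ} {f z : C(I, ℝ)} (hz : LabelsFactor f z)
    (h0 : ∀ u, f 0 ≤ f u) (h : HasLabelStar n f z) :
    HasApproxStar (MapSpace f z) (2.1 : ℝ) (0.15 : ℝ) n := by
  obtain ⟨r, hr, a, u, hau, hmin, hu, hsep⟩ := h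
  have hcen (i) : 100 * r ≤ mapDist f z a (u i) ∧ mapDist f z a (u i) ≤ 105 * r := by
    constructor
    · have := (neg_le_abs _).trans (abs_sub_le_mapDist hz a (u i))
      linarith [(hu i).1]
    · have := (mapDist_le_labelDist f z a (u i)).trans
        (labelDist_le_of_le (hau i) fun t ht => (hmin i t ht).le)
      linarith [(hu i).2]
  have hlow (i j) (hij : i ≠ j) : 198 * r ≤ mapDist f z (u i) (u j) := by
    wlog hle : u i ≤ u j generalizing i j
    · rw [mapDist_comm]; exact this j i hij.symm (le_of_not_ge hle)
    obtain ⟨m, hm, hfm⟩ := exists_eq_minBetween f (u i) (u j)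
    have hmle : ∀ t ∈ uIcc (u i) (u j), f m ≤ f t := fun t ht => hfm ▸ minBetween_le f ht
    have hzm : z m < z a + r := (hsep i j hij m hm).resolve_left fun ⟨t, ht, hlt⟩ =>
      absurd (hmle t ht) (not_le.2 hlt)
    rw [uIcc_of_le hle] at hm hmle
    have := cactus_bound hz h0 hm hmle
    linarith [(hu i).1, (hu j).1]
  have hupp (i j) : mapDist f z (u i) (u j) ≤ 210 * r := by
    have := mapDist_triangle f z (u i) a (u j)
    rw [mapDist_comm f z (u i) a] at this
    linarith [(hcen i).2, (hcen j).2]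
  refine ⟨by norm_num, by norm_num, by norm_num, by norm_num, 100 * r, by positivity,
    Fin.cons (mapProj f z a) fun i => mapProj f z (u i), fun i j hi hj hij => ?_, fun i hi => ?_⟩
  · obtain ⟨i, rfl⟩ := Fin.exists_succ_eq.2 hi
    obtain ⟨j, rfl⟩ := Fin.exists_succ_eq.2 hj
    have hij' : i ≠ j := fun h => hij (congrArg _ h)
    simp only [Fin.cons_succ, dist_mapProj]
    constructor <;> linarith [hlow i j hij', hupp i j]
  · obtain ⟨i, rfl⟩ := Fin.exists_succ_eq.2 hi
    simp only [Fin.cons_succ, Fin.cons_zero, dist_mapProj]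
    constructor <;> linarith [(hcen i).1, (hcen i).2]

theorem isStarry_mapSpace {f z : C(I, ℝ)} (hz : LabelsFactor f z) (h0 : ∀ u, f 0 ≤ f u)
    (h : ∀ n, HasLabelStar n f z) : IsStarry (MapSpace f z) :=
  ⟨2.1, 0.15, by norm_num, by norm_num, by norm_num, fun n =>
    ⟨2.1, le_rfl, (h n).hasApproxStar hz h0⟩⟩

/-! ### Gaussian estimates -/

section Gaussian

variable {Ω : Type*} {mΩ : MeasurableSpace Ω} {P : Measure Ω}

theorem hasSubgaussianMGF_of_hasLaw {X : Ω → ℝ} {v V : ℝ≥0}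
    (hX : HasLaw X (gaussianReal 0 v) P) (hV : v ≤ V) : HasSubgaussianMGF X V P where
  integrable_exp_mul t := by
    have h := integrable_exp_mul_gaussianReal (μ := 0) (v := v) t
    rw [← hX.map_eq] at h
    exact h.comp_aemeasurable hX.aemeasurable
  mgf_le t := by
    rw [mgf_gaussianReal hX.map_eq]
    refine Real.exp_le_exp.2 ?_
    have : (v : ℝ) ≤ V := hV
    nlinarith [sq_nonneg t]

/-- The exponential tail is weakened to an inverse power `q`, which turns the union bounds over
dyadic levels into geometric series. -/
theorem gaussian_tail [IsProbabilityMeasure P] {X : Ω → ℝ} {v : ℝ≥0} (hX : HasLaw X (gaussianReal 0 v) P) {V x : ℝ}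
    (hV : v ≤ V) (hV0 : 0 < V) (hx : 0 < x) (q : ℕ) :
    P.real {ω | x ≤ |X ω|} ≤ 2 * q.factorial * (2 * V / x ^ 2) ^ q := by
  lift V to ℝ≥0 using hV0.le
  have hsub := hasSubgaussianMGF_of_hasLaw hX (V := V) (by exact_mod_cast hV)
  have h1 := hsub.measure_ge_le hx.le
  have h2 := hsub.neg.measure_ge_le hx.le
  have hsplit : {ω | x ≤ |X ω|} ⊆ {ω | x ≤ X ω} ∪ {ω | x ≤ (-X) ω} := by
    intro ω hω
    rcases abs_choice (X ω) with h | h <;> simp only [mem_ofPred_eq, h] at hω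
    · exact .inl hω
    · exact .inr hω
  have h3 := (measureReal_mono hsplit (by finiteness)).trans (measureReal_union_le (μ := P) _ _)
  have hy : 0 < x ^ 2 / (2 * V) := by positivity
  have h4 : Real.exp (-x ^ 2 / (2 * V)) ≤ q.factorial * (2 * V / x ^ 2) ^ q := by
    have h5 := Real.pow_div_factorial_le_exp _ hy.le q
    rw [neg_div, Real.exp_neg, ← inv_div (x ^ 2), inv_pow,
      inv_le_iff_one_le_mul₀ (Real.exp_pos _)]
    have h6 : (x ^ 2 / (2 * V)) ^ q ≤ q.factorial * Real.exp (x ^ 2 / (2 * V)) :=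
      (div_le_iff₀' (by positivity)).1 h5
    rw [mul_right_comm, ← div_eq_mul_inv, one_le_div (pow_pos hy q)]
    exact h6
  linarith

/-- The density on the window is at least its value at the far end. The bound does not involve `δ`:
it is uniform over all variances comparable to `δ ^ 2`. -/
theorem gaussian_window {X : Ω → ℝ} {v : ℝ≥0} (hX : HasLaw X (gaussianReal 0 v) P)
    {δ c c' a b : ℝ} (hδ : 0 < δ) (hc : 0 < c) (hv : c * δ ^ 2 ≤ v) (hv' : v ≤ c' * δ ^ 2)
    (ha : 0 ≤ a) (hab : a ≤ b) :
    (b - a) * ((√(2 * Real.pi * c'))⁻¹ * Real.exp (-b ^ 2 / (2 * c))) ≤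
      P.real {ω | X ω ∈ Icc (a * δ) (b * δ)} := by
  have hv0 : (0 : ℝ) < v := (by positivity : 0 < c * δ ^ 2).trans_le hv
  have hvne : v ≠ 0 := fun h => by simp [h] at hv0
  have hc' : 0 < c' := by
    by_contra h
    nlinarith [sq_nonneg δ]
  have hmap : P.real {ω | X ω ∈ Icc (a * δ) (b * δ)} =
      ∫ x in Icc (a * δ) (b * δ), gaussianPDFReal 0 v x := by
    have : P {ω | X ω ∈ Icc (a * δ) (b * δ)} = gaussianReal 0 v (Icc (a * δ) (b * δ)) := by
      rw [← hX.map_eq, Measure.map_apply_of_aemeasurable hX.aemeasurable measurableSet_Icc]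
      rfl
    rw [measureReal_def, this, gaussianReal_apply_eq_integral _ hvne, ENNReal.toReal_ofReal]
    exact integral_nonneg fun x => gaussianPDFReal_nonneg _ _ _
  rw [hmap]
  have hlow : ∀ x ∈ Icc (a * δ) (b * δ),
      δ⁻¹ * ((√(2 * Real.pi * c'))⁻¹ * Real.exp (-b ^ 2 / (2 * c))) ≤ gaussianPDFReal 0 v x := by
    intro x hx
    rw [gaussianPDFReal, ← mul_assoc, sub_zero]
    have h1 : δ⁻¹ * (√(2 * Real.pi * c'))⁻¹ ≤ (√(2 * Real.pi * v))⁻¹ := by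
      rw [← mul_inv]
      refine inv_anti₀ (by positivity) ?_
      rw [← Real.sqrt_sq hδ.le, ← Real.sqrt_mul (by positivity)]
      refine Real.sqrt_le_sqrt ?_
      nlinarith [Real.pi_pos]
    have h2 : Real.exp (-b ^ 2 / (2 * c)) ≤ Real.exp (-x ^ 2 / (2 * v)) := by
      refine Real.exp_le_exp.2 ?_
      rw [neg_div, neg_div, neg_le_neg_iff, div_le_div_iff₀ (by positivity) (by positivity)]
      have hx0 : 0 ≤ x := (by positivity : 0 ≤ a * δ).trans hx.1
      have h3 : x ^ 2 ≤ (b * δ) ^ 2 := pow_le_pow_left₀ hx0 hx.2 2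
      nlinarith [sq_nonneg b]
    exact mul_le_mul h1 h2 (Real.exp_nonneg _) (by positivity)
  have hint := setIntegral_ge_of_const_le_real (μ := volume) measurableSet_Icc
    (by simp) hlow (integrable_gaussianPDFReal 0 v).integrableOn
  refine le_trans (le_of_eq ?_) hint
  rw [Real.volume_real_Icc_of_le (by nlinarith)]
  field_simp

/-- A union bound over all dyadic increments. -/
theorem dyadic_increments_bound [IsProbabilityMeasure P] {Y : ℕ → ℕ → Ω → ℝ} {s R x y : ℝ} {q : ℕ} (hs : 0 < s) (hR : 0 < R)
    (hx : 0 < x) (hy : 0 < y) (hxy : 4 * x ^ q = (y ^ 2) ^ q)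
    (hY : ∀ m, ∀ j < 2 ^ m, ∃ v : ℝ≥0, HasLaw (Y m j) (gaussianReal 0 v) P ∧ v ≤ s ^ 2 * x ^ m) :
    P.real {ω | ∃ m, ∃ j < 2 ^ m, R * s * y ^ m ≤ |Y m j ω|} ≤
      4 * q.factorial * (2 / R ^ 2) ^ q := by
  set C : ℝ := 2 * q.factorial * (2 / R ^ 2) ^ q with hC
  have hC0 : 0 ≤ C := by positivity
  -- The relation `4 * x ^ q = (y ^ 2) ^ q` is tuned so that an increment of level `m` is too large
  -- with probability at most `C / 4 ^ m`; the `2 ^ m` increments of the level then contribute `C /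
  -- 2 ^ m`, and all levels `2 C`.
  have hone (m j : ℕ) (hj : j < 2 ^ m) :
      P.real {ω | R * s * y ^ m ≤ |Y m j ω|} ≤ C * (1 / 4) ^ m := by
    obtain ⟨v, hv, hvle⟩ := hY m j hj
    refine (gaussian_tail hv hvle (by positivity) (by positivity) q).trans (le_of_eq ?_)
    have h1 : 2 * (s ^ 2 * x ^ m) / (R * s * y ^ m) ^ 2 = 2 / R ^ 2 * (x ^ m / (y ^ 2) ^ m) := by
      rw [mul_pow, mul_pow, ← pow_mul, ← pow_mul, mul_comm 2 m]; field_simp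
    have h2 : (x ^ m / (y ^ 2) ^ m) ^ q = (1 / 4) ^ m := by
      rw [← div_pow, ← pow_mul, mul_comm m q, pow_mul, div_pow, ← hxy]
      congr 1
      field_simp
    rw [h1, mul_pow, h2, hC]; ring
  have hlevel (m : ℕ) :
      P {ω | ∃ j < 2 ^ m, R * s * y ^ m ≤ |Y m j ω|} ≤ ENNReal.ofReal (C * (1 / 2) ^ m) := by
    have : {ω | ∃ j < 2 ^ m, R * s * y ^ m ≤ |Y m j ω|} =
        ⋃ j ∈ Finset.range (2 ^ m), {ω | R * s * y ^ m ≤ |Y m j ω|} := by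
      ext ω; simp
    rw [this]
    refine (measure_biUnion_finset_le _ _).trans ?_
    calc ∑ j ∈ Finset.range (2 ^ m), P {ω | R * s * y ^ m ≤ |Y m j ω|}
        ≤ ∑ j ∈ Finset.range (2 ^ m), ENNReal.ofReal (C * (1 / 4) ^ m) := by
          refine Finset.sum_le_sum fun j hj => ?_
          rw [← ofReal_measureReal]
          exact ENNReal.ofReal_le_ofReal (hone m j (Finset.mem_range.1 hj))
      _ = ENNReal.ofReal (C * (1 / 2) ^ m) := by
          rw [Finset.sum_const, Finset.card_range, nsmul_eq_mul, ← ENNReal.ofReal_natCast,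
            ← ENNReal.ofReal_mul (by positivity)]
          congr 1
          push_cast
          rw [mul_left_comm, ← mul_pow]
          norm_num
  have htot : P {ω | ∃ m, ∃ j < 2 ^ m, R * s * y ^ m ≤ |Y m j ω|} ≤ ENNReal.ofReal (C * 2) := by
    rw [ofPred_exists]
    refine (measure_iUnion_le _).trans ((ENNReal.tsum_le_tsum hlevel).trans (le_of_eq ?_))
    rw [← ENNReal.ofReal_tsum_of_nonneg (fun m => by positivity)
      (summable_geometric_two.mul_left C), tsum_mul_left, tsum_geometric_two]
  have := ENNReal.toReal_mono (by finiteness) htot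
  rw [ENNReal.toReal_ofReal (by positivity)] at this
  refine this.trans (le_of_eq ?_)
  rw [hC]; ring

end Gaussian

/-! ### A second moment bound -/

/-- Second moment method. No independence between the `G i` is needed: intersections are bounded by
those of the pairwise independent `E i`. With `G i = univ` and `ε = 0` this is a form of the second
Borel–Cantelli lemma. -/
theorem one_sub_le_measureReal_iUnion {Ω : Type*} {mΩ : MeasurableSpace Ω} {P : Measure Ω}
    [IsProbabilityMeasure P] {E G : ℕ → Set Ω} {p ε : ℝ} (hp : 0 < p)
    (hE : ∀ i, NullMeasurableSet (E i) P) (hG : ∀ i, NullMeasurableSet (G i) P)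
    (hpE : ∀ i, p ≤ P.real (E i))
    (hind : ∀ i j, i ≠ j → P.real (E i ∩ E j) = P.real (E i) * P.real (E j))
    (hGE : ∀ i, P.real (E i \ G i) ≤ ε * P.real (E i)) :
    1 - 2 * ε ≤ P.real (⋃ i, E i ∩ G i) := by
  set A : ℕ → Set Ω := fun i => E i ∩ G i with hA
  have hAm (i : ℕ) : NullMeasurableSet (A i) P := (hE i).inter (hG i)
  have hint (S : Set Ω) (hS : NullMeasurableSet S P) :
      Integrable (S.indicator (fun _ => (1 : ℝ))) P := (integrable_const _).indicator₀ hS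
  have hval (S : Set Ω) (hS : NullMeasurableSet S P) :
      ∫ ω, S.indicator (fun _ => (1 : ℝ)) ω ∂P = P.real S := by
    rw [integral_indicator₀ hS]; simp
  have hU : NullMeasurableSet (⋃ i, A i) P := .iUnion hAm
  have main (K : ℕ) (hK : 0 < K) : 1 - 2 * ε - 1 / (K * p) ≤ P.real (⋃ i, A i) := by
    set S := ∑ i ∈ Finset.range K, P.real (E i) with hS
    have hSK : K * p ≤ S := by
      have := Finset.card_nsmul_le_sum (Finset.range K) (fun i => P.real (E i)) p
        fun i _ => hpE i
      simpa using this
    have hKp : 0 < K * p := by positivity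
    have hS0 : 0 < S := hKp.trans_le hSK
    have hfirst : (1 - ε) * S ≤ ∑ i ∈ Finset.range K, P.real (A i) := by
      rw [hS, Finset.mul_sum]
      refine Finset.sum_le_sum fun i _ => ?_
      have := measureReal_inter_add_sdiff₀ (μ := P) (s := E i) (hG i)
      linarith [hGE i]
    have hsecond : ∑ i ∈ Finset.range K, ∑ j ∈ Finset.range K, P.real (A i ∩ A j) ≤ S ^ 2 + S := by
      calc _ ≤ ∑ i ∈ Finset.range K, ∑ j ∈ Finset.range K,
            (P.real (E i) * P.real (E j) + if i = j then P.real (E i) else 0) := by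
            refine Finset.sum_le_sum fun i _ => Finset.sum_le_sum fun j _ => ?_
            have h1 : P.real (A i ∩ A j) ≤ P.real (E i ∩ E j) :=
              measureReal_mono (inter_subset_inter inter_subset_left inter_subset_left)
            split_ifs with hij
            · subst hij
              rw [inter_self, inter_self] at h1
              rw [inter_self]
              nlinarith [measureReal_nonneg (μ := P) (s := E i)]
            · rw [add_zero, ← hind i j hij]; exact h1
        _ = S ^ 2 + S := by
            simp only [Finset.sum_add_distrib]
            rw [← Finset.sum_mul_sum, sq]
            congr 1
            exact Finset.sum_congr rfl fun i hi => by rw [Finset.sum_ite_eq, if_pos hi]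
    -- With `X` the number of `A i`, `i < K`, that occur, this is `1 - (1 - X / S) ^ 2 ≤ 1` when `X`
    -- may be positive and `0 ≤ 0` when none occurs. Integration gives `2 (1 - ε) - (1 + 1 / S)`,
    -- and `S ≥ K p` tends to infinity.
    have hpt (ω : Ω) : 2 * S⁻¹ * ∑ i ∈ Finset.range K, (A i).indicator (fun _ => (1 : ℝ)) ω -
        S⁻¹ ^ 2 * ∑ i ∈ Finset.range K, ∑ j ∈ Finset.range K,
          (A i ∩ A j).indicator (fun _ => (1 : ℝ)) ω ≤ (⋃ i, A i).indicator (fun _ => (1 : ℝ)) ω := by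
      have hprod (i j : ℕ) : (A i ∩ A j).indicator (fun _ => (1 : ℝ)) ω =
          (A i).indicator (fun _ => (1 : ℝ)) ω * (A j).indicator (fun _ => (1 : ℝ)) ω := by
        by_cases hi : ω ∈ A i <;> by_cases hj : ω ∈ A j <;> simp [hi, hj]
      simp only [hprod]
      rw [← Finset.sum_mul_sum]
      set X := ∑ i ∈ Finset.range K, (A i).indicator (fun _ => (1 : ℝ)) ω with hX
      by_cases hω : ω ∈ ⋃ i, A i
      · rw [indicator_of_mem hω]
        nlinarith [sq_nonneg (1 - S⁻¹ * X)]
      · have : X = 0 := Finset.sum_eq_zero fun i _ =>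
          indicator_of_notMem (fun h => hω (mem_iUnion.2 ⟨i, h⟩)) _
        rw [this, indicator_of_notMem hω]; simp
    have hi1 : Integrable (fun ω => ∑ i ∈ Finset.range K,
        (A i).indicator (fun _ => (1 : ℝ)) ω) P :=
      integrable_finsetSum _ fun i _ => hint _ (hAm i)
    have hi2 : Integrable (fun ω => ∑ i ∈ Finset.range K, ∑ j ∈ Finset.range K,
        (A i ∩ A j).indicator (fun _ => (1 : ℝ)) ω) P :=
      integrable_finsetSum _ fun i _ => integrable_finsetSum _ fun j _ =>
        hint _ ((hAm i).inter (hAm j))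
    have hle := integral_mono ((hi1.const_mul (2 * S⁻¹)).sub (hi2.const_mul (S⁻¹ ^ 2)))
      (hint _ hU) hpt
    rw [hval _ hU] at hle
    simp only [Pi.sub_apply] at hle
    rw [integral_sub (hi1.const_mul (2 * S⁻¹)) (hi2.const_mul (S⁻¹ ^ 2)), integral_const_mul,
      integral_const_mul, integral_finsetSum _ fun i _ => hint _ (hAm i),
      integral_finsetSum _ fun i _ => integrable_finsetSum _ fun j _ =>
        hint _ ((hAm i).inter (hAm j))] at hle
    have e1 : ∑ i ∈ Finset.range K, ∫ ω, (A i).indicator (fun _ => (1 : ℝ)) ω ∂P =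
        ∑ i ∈ Finset.range K, P.real (A i) := Finset.sum_congr rfl fun i _ => hval _ (hAm i)
    have e2 : ∑ i ∈ Finset.range K, ∫ ω, ∑ j ∈ Finset.range K,
        (A i ∩ A j).indicator (fun _ => (1 : ℝ)) ω ∂P =
        ∑ i ∈ Finset.range K, ∑ j ∈ Finset.range K, P.real (A i ∩ A j) := by
      refine Finset.sum_congr rfl fun i _ => ?_
      rw [integral_finsetSum _ fun j _ => hint _ ((hAm i).inter (hAm j))]
      exact Finset.sum_congr rfl fun j _ => hval _ ((hAm i).inter (hAm j))
    rw [e1, e2] at hle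
    refine le_trans ?_ hle
    have h1 : 2 * S⁻¹ * ((1 - ε) * S) ≤ 2 * S⁻¹ * ∑ i ∈ Finset.range K, P.real (A i) :=
      mul_le_mul_of_nonneg_left hfirst (by positivity)
    have h2 : S⁻¹ ^ 2 * ∑ i ∈ Finset.range K, ∑ j ∈ Finset.range K, P.real (A i ∩ A j) ≤
        S⁻¹ ^ 2 * (S ^ 2 + S) := mul_le_mul_of_nonneg_left hsecond (by positivity)
    have h3 : 2 * S⁻¹ * ((1 - ε) * S) = 2 * (1 - ε) := by field_simp
    have h4 : S⁻¹ ^ 2 * (S ^ 2 + S) = 1 + 1 / S := by field_simp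
    have h5 : 1 / S ≤ 1 / (K * p) := one_div_le_one_div_of_le hKp hSK
    linarith
  have hlim : Filter.Tendsto (fun K : ℕ => 1 - 2 * ε - 1 / (K * p)) Filter.atTop
      (𝓝 (1 - 2 * ε - 0)) := by
    refine tendsto_const_nhds.sub ?_
    simp only [one_div, mul_inv]
    simpa using (tendsto_inv_atTop_nhds_zero_nat (𝕜 := ℝ)).mul_const p⁻¹
  rw [sub_zero] at hlim
  exact le_of_tendsto hlim (Filter.eventually_atTop.2 ⟨1, fun K hK => main K hK⟩)

/-! ### Dyadic chaining -/

/-- Kolmogorov's chaining. The dyadic approximations of a point from below move by at most one cell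
per level, so the error beyond level `m` is a geometric series. In the constant, `1` pays for the
step between the approximations of `s` and `t` at level `m`, and `2 / (1 - θ)` for the two tails. -/
theorem abs_sub_le_of_dyadic {g : ℝ → ℝ} (hg : ContinuousOn g (Icc 0 1)) {C θ : ℝ} (hC : 0 ≤ C)
    (hθ0 : 0 < θ) (hθ1 : θ < 1)
    (h : ∀ m, ∀ j < 2 ^ m, |g ((j + 1 : ℕ) / 2 ^ m) - g ((j : ℕ) / 2 ^ m)| ≤ C * θ ^ m)
    {s t : ℝ} (hs : s ∈ Icc (0 : ℝ) 1) (ht : t ∈ Icc (0 : ℝ) 1) {m : ℕ}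
    (hst : |s - t| ≤ 1 / 2 ^ m) : |g s - g t| ≤ C * (1 + 2 / (1 - θ)) * θ ^ m := by
  have hθ : 0 < 1 - θ := by linarith
  -- distance to the dyadic approximation from below
  have happ (s : ℝ) (hs : s ∈ Icc (0 : ℝ) 1) :
      |g s - g (⌊s * 2 ^ m⌋₊ / 2 ^ m)| ≤ C * (1 / (1 - θ)) * θ ^ m := by
    set a : ℕ → ℝ := fun k => (⌊s * 2 ^ k⌋₊ : ℝ) / 2 ^ k with ha
    have hfl (k : ℕ) : (⌊s * 2 ^ k⌋₊ : ℝ) ≤ s * 2 ^ k :=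
      Nat.floor_le (mul_nonneg hs.1 (by positivity))
    have hfl' (k : ℕ) : s * 2 ^ k < ⌊s * 2 ^ k⌋₊ + 1 := Nat.lt_floor_add_one _
    have hstep (k : ℕ) : |g (a (k + 1)) - g (a k)| ≤ C * θ ^ (k + 1) := by
      have hak : a k = ((2 * ⌊s * 2 ^ k⌋₊ : ℕ) : ℝ) / 2 ^ (k + 1) := by
        simp only [ha, pow_succ]; push_cast; field_simp
      have hlo : 2 * ⌊s * 2 ^ k⌋₊ ≤ ⌊s * 2 ^ (k + 1)⌋₊ := by
        refine Nat.le_floor ?_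
        push_cast
        rw [pow_succ]; linarith [hfl k]
      have hhi : ⌊s * 2 ^ (k + 1)⌋₊ < 2 * ⌊s * 2 ^ k⌋₊ + 2 := by
        rw [Nat.floor_lt (mul_nonneg hs.1 (by positivity))]
        push_cast
        rw [pow_succ]; linarith [hfl' k]
      rw [hak]
      rcases (by omega : ⌊s * 2 ^ (k + 1)⌋₊ = 2 * ⌊s * 2 ^ k⌋₊ ∨
        ⌊s * 2 ^ (k + 1)⌋₊ = 2 * ⌊s * 2 ^ k⌋₊ + 1) with he | he
      · simp only [ha, he, sub_self, abs_zero]; positivity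
      · simp only [ha, he]
        refine h (k + 1) _ ?_
        have h1 : (⌊s * 2 ^ (k + 1)⌋₊ : ℝ) ≤ 2 ^ (k + 1) :=
          (hfl (k + 1)).trans (mul_le_of_le_one_left (by positivity) hs.2)
        have h2 : ⌊s * 2 ^ (k + 1)⌋₊ ≤ 2 ^ (k + 1) := by exact_mod_cast h1
        omega
    have hsum (k : ℕ) : |g (a (m + k)) - g (a m)| ≤ C * (1 / (1 - θ)) * θ ^ m := by
      have h1 : |g (a (m + k)) - g (a m)| ≤ ∑ i ∈ Finset.range k, C * θ ^ m * θ ^ i := by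
        induction k with
        | zero => simp
        | succ k ih =>
          rw [Finset.sum_range_succ]
          have h2 := hstep (m + k)
          have h3 : C * θ ^ (m + k + 1) ≤ C * θ ^ m * θ ^ k := by
            rw [pow_succ, pow_add, ← mul_assoc, ← mul_assoc]
            exact mul_le_of_le_one_right (by positivity) hθ1.le
          have h4 := abs_sub_le (g (a (m + (k + 1)))) (g (a (m + k))) (g (a m))
          rw [← add_assoc] at h4 ⊢
          linarith
      refine h1.trans ?_
      rw [← Finset.mul_sum]
      have h2 : ∑ i ∈ Finset.range k, θ ^ i ≤ 1 / (1 - θ) := by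
        rw [one_div, ← tsum_geometric_of_lt_one hθ0.le hθ1]
        exact (summable_geometric_of_lt_one hθ0.le hθ1).sum_le_tsum _ fun i _ => by positivity
      calc _ ≤ C * θ ^ m * (1 / (1 - θ)) := mul_le_mul_of_nonneg_left h2 (by positivity)
        _ = _ := by ring
    have hmem (k : ℕ) : a k ∈ Icc (0 : ℝ) 1 := by
      refine ⟨by positivity, ?_⟩
      rw [ha, div_le_one (by positivity)]
      exact (hfl k).trans (mul_le_of_le_one_left (by positivity) hs.2)
    have hlim : Filter.Tendsto a Filter.atTop (𝓝 s) := by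
      refine tendsto_of_tendsto_of_tendsto_of_le_of_le (g := fun k => s - (1 / 2) ^ k) (h := fun _ => s)
        ?_ tendsto_const_nhds (fun k => ?_) fun k => ?_
      · simpa using tendsto_const_nhds.sub
          (tendsto_pow_atTop_nhds_zero_of_lt_one (r := (1 / 2 : ℝ)) (by norm_num) (by norm_num))
      · simp only [ha]
        rw [le_div_iff₀ (by positivity), sub_mul, ← mul_pow]
        norm_num
        linarith [hfl' k]
      · simp only [ha]
        rw [div_le_iff₀ (by positivity)]
        exact hfl k
    have hlim' : Filter.Tendsto (fun k => g (a (m + k))) Filter.atTop (𝓝 (g s)) := by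
      have h1 : Filter.Tendsto a Filter.atTop (𝓝[Icc 0 1] s) :=
        tendsto_nhdsWithin_iff.2 ⟨hlim, .of_forall hmem⟩
      have h2 := (hg s hs).tendsto.comp h1
      exact h2.comp (Filter.tendsto_atTop_mono (fun k => Nat.le_add_left k m) Filter.tendsto_id)
    exact le_of_tendsto ((hlim'.sub_const _).abs) (.of_forall hsum)
  wlog hle : s ≤ t generalizing s t
  · rw [abs_sub_comm]
    exact this ht hs (by rwa [abs_sub_comm]) (le_of_not_ge hle)
  have h1 := happ s hs
  have h2 := happ t ht
  have h2m : (0 : ℝ) < 2 ^ m := by positivity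
  have hmid : |g (⌊t * 2 ^ m⌋₊ / 2 ^ m) - g (⌊s * 2 ^ m⌋₊ / 2 ^ m)| ≤ C * θ ^ m := by
    have hlo : ⌊s * 2 ^ m⌋₊ ≤ ⌊t * 2 ^ m⌋₊ :=
      Nat.floor_le_floor (mul_le_mul_of_nonneg_right hle h2m.le)
    have hhi : ⌊t * 2 ^ m⌋₊ < ⌊s * 2 ^ m⌋₊ + 2 := by
      rw [Nat.floor_lt (mul_nonneg ht.1 h2m.le)]
      push_cast
      have h3 := Nat.lt_floor_add_one (s * 2 ^ m)
      rw [abs_sub_comm, abs_of_nonneg (by linarith), le_div_iff₀ h2m] at hst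
      linarith
    rcases (by omega : ⌊t * 2 ^ m⌋₊ = ⌊s * 2 ^ m⌋₊ ∨ ⌊t * 2 ^ m⌋₊ = ⌊s * 2 ^ m⌋₊ + 1) with he | he
    · rw [he, sub_self, abs_zero]; positivity
    · rw [he]
      refine h m _ ?_
      have h1 : (⌊t * 2 ^ m⌋₊ : ℝ) ≤ 2 ^ m :=
        (Nat.floor_le (mul_nonneg ht.1 h2m.le)).trans (mul_le_of_le_one_left h2m.le ht.2)
      have h2 : ⌊t * 2 ^ m⌋₊ ≤ 2 ^ m := by exact_mod_cast h1
      omega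
  rw [abs_sub_comm] at h2 hmid
  have h3 := abs_sub_le (g s) (g (⌊s * 2 ^ m⌋₊ / 2 ^ m)) (g t)
  have h4 := abs_sub_le (g (⌊s * 2 ^ m⌋₊ / 2 ^ m)) (g (⌊t * 2 ^ m⌋₊ / 2 ^ m)) (g t)
  have h5 : C * (1 + 2 / (1 - θ)) * θ ^ m =
      C * θ ^ m + C * (1 / (1 - θ)) * θ ^ m + C * (1 / (1 - θ)) * θ ^ m := by ring
  linarith

/-! ### Moduli of continuity and combs -/

/-- `2 ^ (-1/16)`; its fourth power is the rate of the moduli of continuity used below. -/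
noncomputable def chainingRate : ℝ := (1 / 2 : ℝ) ^ (1 / 16 : ℝ)

theorem chainingRate_pos : 0 < chainingRate := Real.rpow_pos_of_pos (by norm_num) _

theorem chainingRate_lt_one : chainingRate < 1 :=
  Real.rpow_lt_one (by norm_num) (by norm_num) (by norm_num)

/-- The exponent `16` serves both union bounds, with the relation `4 x ^ q = (y ^ 2) ^ q`. For
Brownian motion `x = 1 / 2`, `y = chainingRate ^ 4` and `q = 4`. For the labels, whose variances
decay like the modulus of the tree, `x = chainingRate ^ 4`, `y = chainingRate` and `q = 16`. -/
theorem chainingRate_pow : chainingRate ^ 16 = 1 / 2 := by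
  rw [chainingRate, ← Real.rpow_natCast, ← Real.rpow_mul (by norm_num)]
  norm_num

theorem chainingRate_four_pos : 0 < chainingRate ^ 4 := pow_pos chainingRate_pos 4

theorem chainingRate_four_lt_one : chainingRate ^ 4 < 1 :=
  pow_lt_one₀ chainingRate_pos.le chainingRate_lt_one (by norm_num)

theorem tendsto_tail_bound {q : ℕ} (hq : q ≠ 0) :
    Filter.Tendsto (fun R : ℝ => 4 * q.factorial * (2 / R ^ 2) ^ q) Filter.atTop (𝓝 0) := by
  have h1 : Filter.Tendsto (fun R : ℝ => 2 / R ^ 2) Filter.atTop (𝓝 0) :=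
    Filter.Tendsto.const_div_atTop (Filter.tendsto_pow_atTop two_ne_zero) 2
  simpa [hq] using (h1.pow q).const_mul (4 * (q.factorial : ℝ))

theorem half_pow_le (m : ℕ) : (1 / 2 : ℝ) ^ m ≤ (chainingRate ^ 4) ^ m := by
  refine pow_le_pow_left₀ (by norm_num) ?_ m
  rw [← chainingRate_pow]
  exact pow_le_pow_of_le_one chainingRate_pos.le chainingRate_lt_one.le (by norm_num)

/-- On `[a, b]`, the function `f` has a dyadic modulus of continuity with constant `C`. -/
def HasModulusOn (f : C(I, ℝ)) (C : ℝ) (a b : I) : Prop :=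
  ∀ m : ℕ, ∀ s ∈ Icc a b, ∀ t ∈ Icc a b, |(s : ℝ) - t| ≤ (b - a) / 2 ^ m →
    |f s - f t| ≤ C * (chainingRate ^ 4) ^ m

/-- On `[a, b]`, the function `f` zigzags `n` times with an amplitude of order `δ`. -/
structure IsComb (n : ℕ) (C δ : ℝ) (f : C(I, ℝ)) (a b : I) (t : ℕ → I) : Prop where
  lt : a < b
  pos : 0 < δ
  modulus : HasModulusOn f (C * δ) a b
  mono : Monotone t
  mem : ∀ i, t i ∈ Icc a b
  left : ∀ i < n, f (t (2 * i)) + δ ≤ f (t (2 * i + 1))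
  right : ∀ i < n, f (t (2 * i + 2)) + δ ≤ f (t (2 * i + 1))

/-! ### Brownian motion on a sequence of disjoint intervals -/

/-- The points of `[l, 2 l]`, `l = 4 ^ (-k-1)`. -/
noncomputable def scaleTime (k : ℕ) (x : ℝ≥0) : ℝ≥0 := (1 / 4) ^ (k + 1) * (1 + x)

/-- The rational `i / j`, cut off at `1`. -/
noncomputable def unitFrac (p : ℕ × ℕ) : ℝ≥0 := min 1 (p.1 / p.2)

theorem unitFrac_eq {i j : ℕ} (h : i ≤ j) : unitFrac (i, j) = i / j :=
  min_eq_right (div_le_one_of_le₀ (by exact_mod_cast h) (by positivity))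

theorem scaleTime_le {k l : ℕ} (h : l < k) (x y : ℝ≥0) (hx : x ≤ 1) :
    scaleTime k x ≤ scaleTime l y := by
  have h1 : ((1 / 4 : ℝ≥0)) ^ (k + 1) ≤ (1 / 4) ^ (l + 1 + 1) :=
    pow_le_pow_of_le_one (by simp) (by rw [one_div]; exact inv_le_one_of_one_le₀ (by norm_num))
      (by omega)
  calc scaleTime k x ≤ (1 / 4) ^ (l + 1 + 1) * (1 + 1) := by unfold scaleTime; gcongr
    _ ≤ (1 / 4) ^ (l + 1) * 1 := by
        rw [pow_succ (1 / 4 : ℝ≥0) (l + 1), mul_assoc]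
        gcongr
        rw [← NNReal.coe_le_coe]; push_cast; norm_num
    _ ≤ scaleTime l y := by unfold scaleTime; gcongr; simp

theorem scaleTime_mono (k : ℕ) : Monotone (scaleTime k) := fun x y h => by
  unfold scaleTime; gcongr

section Brownian

variable {Ω : Type*} {mΩ : MeasurableSpace Ω} {P : Measure Ω} {W : ℝ≥0 → Ω → ℝ}

theorem hasLaw_sub_of_le (hW : IsPreBrownianReal W P) {s t : ℝ≥0} (h : s ≤ t) :
    HasLaw (fun ω => W t ω - W s ω) (gaussianReal 0 (t - s)) P := by
  have h1 := hW.hasLaw_sub t s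
  have h2 : nndist t.1 s.1 = t - s := by
    ext
    rw [coe_nndist, Real.dist_eq, NNReal.coe_sub h]
    exact abs_of_nonneg (sub_nonneg.2 h)
  rwa [h2] at h1

theorem hasLaw_scaleTime_sub (hW : IsPreBrownianReal W P) (k : ℕ) {i j : ℕ} (h : i < j) :
    ∃ v : ℝ≥0, HasLaw (fun ω => W (scaleTime k (unitFrac (i + 1, j))) ω -
      W (scaleTime k (unitFrac (i, j))) ω) (gaussianReal 0 v) P ∧
      (v : ℝ) = (1 / j) * ((1 / 2) ^ (k + 1)) ^ 2 := by
  have hle : unitFrac (i, j) ≤ unitFrac (i + 1, j) := by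
    rw [unitFrac_eq h.le, unitFrac_eq h]; gcongr; simp
  refine ⟨_, hasLaw_sub_of_le hW (scaleTime_mono k hle), ?_⟩
  rw [NNReal.coe_sub (scaleTime_mono k hle), unitFrac_eq h.le, unitFrac_eq h]
  have hj : (j : ℝ) ≠ 0 := by exact_mod_cast (Nat.zero_lt_of_lt h).ne'
  simp only [scaleTime]
  push_cast
  rw [← pow_mul, mul_comm (k + 1) 2, pow_mul]
  field_simp
  norm_num

/-- The increments of a path over the `k`-th interval. -/
noncomputable def scaleIncr (W : ℝ≥0 → Ω → ℝ) (k : ℕ) (p : ℕ × ℕ) (ω : Ω) : ℝ :=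
  W (scaleTime k (unitFrac p)) ω - W (scaleTime k 0) ω

theorem aemeasurable_scaleIncr (hW : IsPreBrownianReal W P) (k : ℕ) (p : ℕ × ℕ) :
    AEMeasurable (scaleIncr W k p) P :=
  (hW.aemeasurable _).sub (hW.aemeasurable _)

/-- Jointly Gaussian increments over intervals with disjoint interiors are uncorrelated, hence
independent. The cut-off in `unitFrac` keeps every index pair inside its interval, so no side
condition on indices arises. -/
theorem iIndepFun_scaleIncr (hW : IsPreBrownianReal W P) :
    iIndepFun (fun k ω p => scaleIncr W k p ω) P := by
  classical
  have hP := hW.isGaussianProcess.isProbabilityMeasure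
  have hL (t : ℝ≥0) : MemLp (W t) 2 P := (hW.isGaussianProcess.hasGaussianLaw_eval t).memLp_two
  refine IsGaussianProcess.iIndepFun_of_covariance_eq_zero ?_
    (fun k p => aemeasurable_scaleIncr hW k p) fun k l hkl p q => ?_
  · refine hW.isGaussianProcess.of_isGaussianProcess fun ⟨k, p⟩ => ?_
    refine ⟨{scaleTime k (unitFrac p), scaleTime k 0},
      { toFun := fun x => x ⟨scaleTime k (unitFrac p), by simp⟩ - x ⟨scaleTime k 0, by simp⟩
        map_add' := fun x y => by simp; abel
        map_smul' := fun c x => by simp; ring }, fun ω => rfl⟩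
  · change cov[fun ω => W (scaleTime k (unitFrac p)) ω - W (scaleTime k 0) ω,
      fun ω => W (scaleTime l (unitFrac q)) ω - W (scaleTime l 0) ω; P] = 0
    rw [covariance_fun_sub_fun_sub (hL _) (hL _) (hL _) (hL _)]
    simp only [hW.covariance_fun_eval]
    have h1 (p) : unitFrac p ≤ 1 := min_le_left _ _
    rcases lt_or_gt_of_ne hkl with h | h
    · rw [min_eq_right (scaleTime_le h _ _ (h1 q)), min_eq_right (scaleTime_le h _ _ zero_le_one),
        min_eq_right (scaleTime_le h _ _ (h1 q)), min_eq_right (scaleTime_le h _ _ zero_le_one)]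
      ring
    · rw [min_eq_left (scaleTime_le h _ _ (h1 p)), min_eq_left (scaleTime_le h _ _ (h1 p)),
        min_eq_left (scaleTime_le h _ _ zero_le_one), min_eq_left (scaleTime_le h _ _ zero_le_one)]
      ring

/-- The increments with `n` zigzags of amplitude `2 δ`. -/
def zigzagSet (n : ℕ) (δ : ℝ) : Set (ℕ × ℕ → ℝ) :=
  {y | ∀ i < n, 2 * δ ≤ y (2 * i + 1, 2 * n) - y (2 * i, 2 * n) ∧
    2 * δ ≤ y (2 * i + 1, 2 * n) - y (2 * i + 2, 2 * n)}

/-- The increments whose dyadic increments are bounded by `R * δ * chainingRate ^ (4 * m)`. -/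
noncomputable def dyadicSet (R δ : ℝ) : Set (ℕ × ℕ → ℝ) :=
  {y | ∀ m, ∀ j < 2 ^ m, |y (j + 1, 2 ^ m) - y (j, 2 ^ m)| ≤ R * δ * (chainingRate ^ 4) ^ m}

theorem measurableSet_zigzagSet (n : ℕ) (δ : ℝ) : MeasurableSet (zigzagSet n δ) := by
  unfold zigzagSet
  measurability

theorem measurableSet_dyadicSet (R δ : ℝ) : MeasurableSet (dyadicSet R δ) := by
  unfold dyadicSet
  have h (m j : ℕ) : MeasurableSet {y : ℕ × ℕ → ℝ |
      |y (j + 1, 2 ^ m) - y (j, 2 ^ m)| ≤ R * δ * (chainingRate ^ 4) ^ m} :=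
    measurableSet_le (by fun_prop) (by fun_prop)
  simp only [ofPred_forall]
  exact .iInter fun m => .iInter fun j => .iInter fun _ => h m j

/-- The lower bound for the probability of a zigzag. -/
noncomputable def zigzagProb (n : ℕ) : ℝ :=
  (1 * ((√(2 * Real.pi * (1 / (2 * n))))⁻¹ * Real.exp (-3 ^ 2 / (2 * (1 / (2 * n)))))) ^ (2 * n)

theorem zigzagProb_pos {n : ℕ} (hn : 0 < n) : 0 < zigzagProb n := by
  unfold zigzagProb; positivity

/-- The `2 n` consecutive increments are independent, each with variance `δ ^ 2 / (2 n)`. They are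
asked to lie alternately in `[2 δ, 3 δ]` and `[-3 δ, -2 δ]`; by scaling, the probability bound is
independent of `k`. -/
theorem zigzagProb_le (hW : IsPreBrownianReal W P) {n : ℕ} (hn : 0 < n) (k : ℕ) :
    zigzagProb n ≤ P.real {ω | (fun p => scaleIncr W k p ω) ∈ zigzagSet n ((1 / 2) ^ (k + 1))} := by
  have hP := hW.isGaussianProcess.isProbabilityMeasure
  set δ : ℝ := (1 / 2) ^ (k + 1) with hδ
  have hδ0 : 0 < δ := by positivity
  set t : Fin (2 * n + 1) → ℝ≥0 := fun i => scaleTime k (unitFrac (i, 2 * n)) with ht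
  have hmono : Monotone t := fun i j hij => scaleTime_mono k <| by
    rw [unitFrac_eq (by omega), unitFrac_eq (by omega)]
    gcongr
    exact hij
  have hind := hW.hasIndepIncrements (2 * n) t hmono
  set S : Fin (2 * n) → Set ℝ := fun i =>
    if (i : ℕ) % 2 = 0 then Icc (2 * δ) (3 * δ) else Icc (-(3 * δ)) (-(2 * δ)) with hS
  have hSm (i) : MeasurableSet (S i) := by
    simp only [hS]; split_ifs <;> exact measurableSet_Icc
  have hprod := hind.measure_inter_preimage_eq_mul Finset.univ (sets := S) fun i _ => hSm i
  have hone (i : Fin (2 * n)) :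
      1 * ((√(2 * Real.pi * (1 / (2 * n))))⁻¹ * Real.exp (-3 ^ 2 / (2 * (1 / (2 * n))))) ≤
      P.real ((W (t i.succ) - W (t i.castSucc)) ⁻¹' S i) := by
    obtain ⟨v, hv, hveq⟩ := hasLaw_scaleTime_sub hW k (i := i) (j := 2 * n) i.2
    push_cast at hveq
    have hn' : (0 : ℝ) < 1 / (2 * n) := by positivity
    by_cases hi : (i : ℕ) % 2 = 0
    · have h1 := gaussian_window hv hδ0 hn' hveq.ge hveq.le (a := 2) (b := 3) (by norm_num)
        (by norm_num)
      refine le_trans (le_of_eq ?_) (h1.trans (le_of_eq ?_))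
      · norm_num
      · simp only [hS, if_pos hi]; rfl
    · have hv' : HasLaw (fun ω => -(W (scaleTime k (unitFrac (i + 1, 2 * n))) ω -
          W (scaleTime k (unitFrac (i, 2 * n))) ω)) (gaussianReal 0 v) P := by
        simpa [Pi.neg_def] using gaussianReal_neg hv
      have h1 := gaussian_window hv' hδ0 hn' hveq.ge hveq.le (a := 2) (b := 3) (by norm_num)
        (by norm_num)
      refine le_trans (le_of_eq ?_) (h1.trans (le_of_eq ?_))
      · norm_num
      · simp only [hS, if_neg hi]
        congr 1
        ext ω
        simp only [mem_ofPred_eq, mem_preimage, mem_Icc, Pi.sub_apply, ht, Fin.val_succ,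
          Fin.val_castSucc]
        constructor <;> rintro ⟨h1, h2⟩ <;> constructor <;> linarith
  have hlow : zigzagProb n ≤
      P.real (⋂ i ∈ Finset.univ, (W (t i.succ) - W (t i.castSucc)) ⁻¹' S i) := by
    have : P.real (⋂ i ∈ Finset.univ, (W (t i.succ) - W (t i.castSucc)) ⁻¹' S i) =
        ∏ i, P.real ((W (t i.succ) - W (t i.castSucc)) ⁻¹' S i) := by
      simp only [measureReal_def]
      rw [← ENNReal.toReal_prod]
      exact congrArg ENNReal.toReal hprod
    rw [this, zigzagProb]
    refine le_trans (le_of_eq ?_) (Finset.prod_le_prod (fun i _ => ?_) fun i _ => hone i)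
    · simp
    · positivity
  refine hlow.trans (measureReal_mono fun ω hω => ?_)
  simp only [Finset.mem_univ, iInter_true, mem_iInter, mem_preimage, Pi.sub_apply] at hω
  intro i hi
  have h1 := hω ⟨2 * i, by omega⟩
  have h2 := hω ⟨2 * i + 1, by omega⟩
  simp only [hS, ht, Fin.val_succ, Fin.val_castSucc] at h1 h2
  rw [if_pos (by omega)] at h1
  rw [if_neg (by omega)] at h2
  simp only [scaleIncr]
  constructor
  · linarith [h1.1]
  · linarith [h2.2]

/-- For `R` large, the modulus bound fails with probability at most half that of a zigzag, so both
hold together with probability at least `p / 2` at every scale. The scales are independent. -/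
theorem ae_frequently_scaleIncr_mem (hW : IsPreBrownianReal W P) {n : ℕ} (hn : 0 < n) :
    ∃ R : ℝ, 0 < R ∧ ∀ᵐ ω ∂P, ∀ k₀, ∃ k ≥ k₀, (fun p => scaleIncr W k p ω) ∈
      zigzagSet n ((1 / 2) ^ (k + 1)) ∩ dyadicSet R ((1 / 2) ^ (k + 1)) := by
  have hP := hW.isGaussianProcess.isProbabilityMeasure
  set p := zigzagProb n with hp
  have hp0 : 0 < p := zigzagProb_pos hn
  obtain ⟨R, hR0, hR⟩ : ∃ R : ℝ, 0 < R ∧ 4 * (4).factorial * (2 / R ^ 2) ^ 4 ≤ p / 2 := by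
    have := tendsto_tail_bound (q := 4) (by norm_num)
    obtain ⟨R, h1, h2⟩ := ((this.eventually (ge_mem_nhds (half_pos hp0))).and
      (Filter.eventually_gt_atTop 0)).exists
    exact ⟨R, h2, h1⟩
  refine ⟨R, hR0, ?_⟩
  set S : ℕ → Set (ℕ × ℕ → ℝ) := fun k =>
    zigzagSet n ((1 / 2) ^ (k + 1)) ∩ dyadicSet R ((1 / 2) ^ (k + 1)) with hS
  have hSm (k) : MeasurableSet (S k) :=
    (measurableSet_zigzagSet _ _).inter (measurableSet_dyadicSet _ _)
  have hXm (k) : AEMeasurable (fun ω p => scaleIncr W k p ω) P :=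
    aemeasurable_pi_lambda _ fun p => aemeasurable_scaleIncr hW k p
  set E : ℕ → Set Ω := fun k => (fun ω p => scaleIncr W k p ω) ⁻¹' S k with hE
  have hEm (k) : NullMeasurableSet (E k) P := (hXm k).nullMeasurableSet_preimage (hSm k)
  have hEp (k) : p / 2 ≤ P.real (E k) := by
    have h1 := zigzagProb_le hW hn k
    set δ : ℝ := (1 / 2) ^ (k + 1) with hδ
    have h2 := dyadic_increments_bound (P := P)
      (Y := fun m j ω => scaleIncr W k (j + 1, 2 ^ m) ω - scaleIncr W k (j, 2 ^ m) ω)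
      (s := δ) (R := R) (x := 1 / 2) (y := chainingRate ^ 4) (q := 4) (by positivity) hR0
      (by norm_num) chainingRate_four_pos ?_ ?_
    · have h3 : {ω | (fun p => scaleIncr W k p ω) ∈ zigzagSet n δ} ⊆ E k ∪
          {ω | ∃ m, ∃ j < 2 ^ m, R * δ * (chainingRate ^ 4) ^ m ≤
            |scaleIncr W k (j + 1, 2 ^ m) ω - scaleIncr W k (j, 2 ^ m) ω|} := by
        intro ω hω
        by_cases h : (fun p => scaleIncr W k p ω) ∈ dyadicSet R δ
        · exact .inl ⟨hω, h⟩
        · right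
          simp only [dyadicSet, mem_ofPred_eq, not_forall, not_le] at h
          obtain ⟨m, j, hj, h⟩ := h
          exact ⟨m, j, hj, h.le⟩
      have h4 := (measureReal_mono h3 (by finiteness)).trans (measureReal_union_le (μ := P) _ _)
      linarith
    · rw [← pow_mul, ← pow_mul, show 4 * (2 * 4) = 16 * 2 by norm_num, pow_mul, chainingRate_pow]
      norm_num
    · intro m j hj
      obtain ⟨v, hv, hveq⟩ := hasLaw_scaleTime_sub hW k hj
      refine ⟨v, ?_, ?_⟩
      · simpa only [scaleIncr, sub_sub_sub_cancel_right] using hv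
      · rw [hveq, ← hδ]; push_cast; rw [one_div_pow, mul_comm]
  have hall (k₀ : ℕ) : ∀ᵐ ω ∂P, ∃ k ≥ k₀, ω ∈ E k := by
    have h1 := one_sub_le_measureReal_iUnion (P := P) (E := fun i => E (k₀ + i))
      (G := fun _ => univ) (p := p / 2) (ε := 0) (by positivity) (fun i => hEm _)
      (fun i => MeasurableSet.univ.nullMeasurableSet) (fun i => hEp _) (fun i j hij => ?_)
      (fun i => by simp)
    · have h2 : P.real (⋃ i, E (k₀ + i)) = 1 := by
        refine le_antisymm measureReal_le_one ?_
        simpa using h1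
      have h3 : ∀ᵐ ω ∂P, ω ∈ ⋃ i, E (k₀ + i) := by
        have := (prob_compl_eq_zero_iff₀ (NullMeasurableSet.iUnion fun i => hEm (k₀ + i))).2
          ((ENNReal.toReal_eq_one_iff _).1 h2)
        exact this
      filter_upwards [h3] with ω hω
      obtain ⟨i, hi⟩ := mem_iUnion.1 hω
      exact ⟨k₀ + i, by omega, hi⟩
    · have hI := (iIndepFun_scaleIncr hW).indepFun (i := k₀ + i) (j := k₀ + j) (by omega)
      have := hI.measure_inter_preimage_eq_mul _ _ (hSm (k₀ + i)) (hSm (k₀ + j))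
      simp only [measureReal_def]
      rw [← ENNReal.toReal_mul]
      exact congrArg _ this
  exact ae_all_iff.2 hall

/-- Lévy's modulus of continuity, in a weak dyadic form. -/
theorem ae_exists_dyadic_bound (hW : IsPreBrownianReal W P) :
    ∀ᵐ ω ∂P, ∃ R : ℝ, 0 < R ∧ ∀ m, ∀ j < 2 ^ m,
      |W (unitFrac (j + 1, 2 ^ m)) ω - W (unitFrac (j, 2 ^ m)) ω| ≤ R * (chainingRate ^ 4) ^ m := by
  have hP := hW.isGaussianProcess.isProbabilityMeasure
  have hbound (N : ℕ) : P.real {ω | ∃ m, ∃ j < 2 ^ m, ((N + 1 : ℕ) : ℝ) * 1 * (chainingRate ^ 4) ^ m ≤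
      |W (unitFrac (j + 1, 2 ^ m)) ω - W (unitFrac (j, 2 ^ m)) ω|} ≤
      4 * (4).factorial * (2 / ((N + 1 : ℕ) : ℝ) ^ 2) ^ 4 := by
    refine dyadic_increments_bound (P := P)
      (Y := fun m j ω => W (unitFrac (j + 1, 2 ^ m)) ω - W (unitFrac (j, 2 ^ m)) ω)
      (x := 1 / 2) one_pos (by positivity) (by norm_num) chainingRate_four_pos ?_ ?_
    · rw [← pow_mul, ← pow_mul, show 4 * (2 * 4) = 16 * 2 by norm_num, pow_mul, chainingRate_pow]
      norm_num
    · intro m j hj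
      have hle : unitFrac (j, 2 ^ m) ≤ unitFrac (j + 1, 2 ^ m) := by
        rw [unitFrac_eq hj.le, unitFrac_eq hj]; gcongr; simp
      refine ⟨_, hasLaw_sub_of_le hW hle, le_of_eq ?_⟩
      rw [NNReal.coe_sub hle, unitFrac_eq hj.le, unitFrac_eq hj]
      push_cast
      rw [one_div_pow]
      field_simp
      ring
  have hlim := (tendsto_tail_bound (q := 4) (by norm_num)).comp
    (tendsto_natCast_atTop_atTop.comp (Filter.tendsto_add_atTop_nat 1))
  set F := {ω | ∀ N : ℕ, ∃ m, ∃ j < 2 ^ m, ((N + 1 : ℕ) : ℝ) * 1 * (chainingRate ^ 4) ^ m ≤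
      |W (unitFrac (j + 1, 2 ^ m)) ω - W (unitFrac (j, 2 ^ m)) ω|} with hF
  have hF0 : P.real F = 0 := by
    refine le_antisymm (ge_of_tendsto' hlim fun N => ?_) measureReal_nonneg
    exact (measureReal_mono fun ω (hω : ω ∈ F) => hω N).trans (hbound N)
  have hF1 : ∀ᵐ ω ∂P, ω ∉ F := by
    rw [measureReal_eq_zero_iff] at hF0
    exact measure_eq_zero_iff_ae_notMem.1 hF0
  filter_upwards [hF1] with ω hω
  simp only [hF, mem_ofPred_eq, not_forall, not_exists, not_and, not_le] at hω
  obtain ⟨N, hN⟩ := hω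
  refine ⟨((N + 1 : ℕ) : ℝ), by positivity, fun m j hj => ?_⟩
  have := (hN m j hj).le
  rwa [mul_one] at this

end Brownian

/-! ### Path properties of the excursion -/

/-- `f` has infinitely many disjoint combs with `n` teeth and comparable moduli of continuity. -/
def HasCombs (n : ℕ) (f : C(I, ℝ)) : Prop :=
  ∃ C : ℝ, 0 < C ∧ ∃ (a b : ℕ → I) (δ : ℕ → ℝ) (t : ℕ → ℕ → I),
    (∀ k, IsComb n C (δ k) f (a k) (b k) (t k)) ∧ ∀ k l, k ≠ l → b k ≤ a l ∨ b l ≤ a k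

section Excursion

variable {w : ℝ≥0 → ℝ} {f : C(I, ℝ)}

theorem continuous_bridge (hw : Continuous w) : Continuous (bridge w) := by
  unfold bridge; fun_prop

theorem bridge_zero (hw0 : w 0 = 0) : bridge w 0 = 0 := by simp [bridge, hw0]

theorem bridge_one : bridge w 1 = 0 := by simp [bridge]

theorem argminTime_mem {b : ℝ → ℝ} (hb : Continuous b) :
    argminTime b ∈ Icc (0 : ℝ) 1 ∧ ∀ x ∈ Icc (0 : ℝ) 1, b (argminTime b) ≤ b x := by
  set S := {t ∈ Icc (0 : ℝ) 1 | IsMinOn b (Icc 0 1) t} with hS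
  have hcl : IsClosed S := by
    have : S = Icc (0 : ℝ) 1 ∩ ⋂ x ∈ Icc (0 : ℝ) 1, {t | b t ≤ b x} := by
      ext t; simp [hS, isMinOn_iff]
    rw [this]
    exact isClosed_Icc.inter
      (isClosed_biInter fun x _ => isClosed_le hb continuous_const)
  have hcomp : IsCompact S := isCompact_Icc.of_isClosed_subset hcl fun t ht => ht.1
  obtain ⟨t, ht, hmin⟩ := isCompact_Icc.exists_isMinOn (nonempty_Icc.2 zero_le_one) hb.continuousOn
  have := hcomp.sInf_mem ⟨t, ht, hmin⟩
  exact ⟨this.1, isMinOn_iff.1 this.2⟩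

theorem excursion_ge (hw : Continuous w) (hf : ∀ t : I, f t = cutAtMin (bridge w) t) (u : I) :
    f 0 ≤ f u := by
  obtain ⟨hτ, hmin⟩ := argminTime_mem (continuous_bridge hw)
  rw [hf, hf, cutAtMin, cutAtMin, show ((0 : I) : ℝ) = 0 from rfl, zero_add, sub_self,
    if_pos (by linarith [hτ.2])]
  split_ifs with h
  · exact sub_nonneg.2 (hmin _ ⟨by linarith [u.2.1, hτ.1], by linarith⟩)
  · exact sub_nonneg.2 (hmin _ ⟨by linarith, by linarith [u.2.2, hτ.2]⟩)

/-- The bridge is Brownian motion minus a linear drift, and the drift is absorbed by `half_pow_le`.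
Cutting at the minimum at most doubles the constant. -/
theorem excursion_hasModulusOn (hw : Continuous w) (hw0 : w 0 = 0)
    (hf : ∀ t : I, f t = cutAtMin (bridge w) t) {R : ℝ} (hR : 0 < R)
    (hdy : ∀ m, ∀ j < 2 ^ m,
      |w (unitFrac (j + 1, 2 ^ m)) - w (unitFrac (j, 2 ^ m))| ≤ R * (chainingRate ^ 4) ^ m) :
    ∃ H : ℝ, 0 < H ∧ HasModulusOn f H 0 1 := by
  obtain ⟨hτ, -⟩ := argminTime_mem (continuous_bridge hw)
  set τ := argminTime (bridge w) with hτdef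
  set θ := chainingRate ^ 4 with hθ
  have hθ0 : 0 < 1 - θ := sub_pos.2 chainingRate_four_lt_one
  set H := R * (1 + 2 / (1 - θ)) + |w 1| with hH
  have hH0 : 0 < H := by positivity
  have hb (m : ℕ) (x y : ℝ) (hx : x ∈ Icc (0 : ℝ) 1) (hy : y ∈ Icc (0 : ℝ) 1)
      (hxy : |x - y| ≤ 1 / 2 ^ m) : |bridge w x - bridge w y| ≤ H * θ ^ m := by
    have h1 := abs_sub_le_of_dyadic (g := fun x => w x.toNNReal) (by fun_prop) hR.le
      chainingRate_four_pos chainingRate_four_lt_one (fun m j hj => ?_) hx hy hxy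
    · have h2 : |(x - y) * w 1| ≤ θ ^ m * |w 1| := by
        rw [abs_mul]
        refine mul_le_mul_of_nonneg_right (hxy.trans ?_) (abs_nonneg _)
        rw [← one_div_pow]
        exact half_pow_le m
      have h3 : bridge w x - bridge w y = (w x.toNNReal - w y.toNNReal) - (x - y) * w 1 := by
        simp only [bridge]; ring
      rw [h3]
      refine (abs_sub _ _).trans ?_
      simp only [hH, add_mul]
      linarith
    · convert hdy m j hj using 4
      · rw [unitFrac_eq (by omega)]
        ext; rw [Real.coe_toNNReal _ (by positivity)]; push_cast; rfl
      · rw [unitFrac_eq hj.le]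
        ext; rw [Real.coe_toNNReal _ (by positivity)]; push_cast; rfl
  refine ⟨2 * H, by positivity, fun m s _ t _ hst => ?_⟩
  have hθm : 0 < θ ^ m := pow_pos chainingRate_four_pos m
  wlog hle : s ≤ t generalizing s t
  · rw [abs_sub_comm]
    exact this t ‹_› s ‹_› (by rwa [abs_sub_comm]) (le_of_not_ge hle)
  have hle' : (s : ℝ) ≤ t := hle
  have hst' : |(s : ℝ) - t| ≤ 1 / 2 ^ m := by simpa using hst
  have hs := s.2
  have ht := t.2
  rw [hf, hf, cutAtMin, cutAtMin, ← hτdef]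
  split_ifs with h1 h2 h2
  · have := hb m (s + τ) (t + τ) ⟨by linarith [hs.1, hτ.1], by linarith⟩
      ⟨by linarith [ht.1, hτ.1], by linarith⟩ (by rwa [add_sub_add_right_eq_sub])
    rw [sub_sub_sub_cancel_right]
    nlinarith
  -- The two times straddle the junction `1 - τ`. The bridge vanishes at both `0` and `1`, so the
  -- difference splits through the value `0`.
  · rw [abs_sub_comm, abs_of_nonneg (sub_nonneg.2 hle')] at hst'
    have e1 := hb m (s + τ) 1 ⟨by linarith [hs.1, hτ.1], by linarith⟩
      ⟨zero_le_one, le_rfl⟩ (by rw [abs_sub_comm, abs_of_nonneg (by linarith)]; linarith)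
    have e2 := hb m 0 (t - 1 + τ) ⟨le_rfl, zero_le_one⟩
      ⟨by linarith, by linarith [ht.2, hτ.2]⟩
      (by rw [abs_sub_comm, abs_of_nonneg (by linarith)]; linarith)
    rw [bridge_one] at e1
    rw [bridge_zero hw0] at e2
    rw [sub_sub_sub_cancel_right]
    have := abs_sub_le (bridge w (s + τ)) 0 (bridge w (t - 1 + τ))
    linarith
  · exact absurd (hle'.trans h2) h1
  · have := hb m (s - 1 + τ) (t - 1 + τ) ⟨by linarith, by linarith [hs.2, hτ.2]⟩
      ⟨by linarith, by linarith [ht.2, hτ.2]⟩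
      (by rwa [add_sub_add_right_eq_sub, sub_sub_sub_cancel_right])
    rw [sub_sub_sub_cancel_right]
    nlinarith

/-- Near some time the excursion is a translate of the bridge near `0`. -/
theorem excursion_eq_bridge (hw : Continuous w) (hf : ∀ t : I, f t = cutAtMin (bridge w) t) :
    ∃ s ε c : ℝ, 0 ≤ s ∧ 0 < ε ∧ s + ε ≤ 1 ∧
      ∀ u : I, s < u → u < s + ε → f u = bridge w (u - s) - c := by
  obtain ⟨hτ, -⟩ := argminTime_mem (continuous_bridge hw)
  set τ := argminTime (bridge w) with hτdef
  -- If the minimum is at `0`, the excursion is the bridge itself; otherwise it restarts the bridge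
  -- from time `0` at the junction `1 - τ` and follows it for time `τ`.
  rcases hτ.1.eq_or_lt with h | h
  · refine ⟨0, 1, bridge w τ, le_rfl, one_pos, by norm_num, fun u _ _ => ?_⟩
    rw [hf, cutAtMin, ← hτdef, if_pos (by linarith [u.2.2]), ← h]
    simp
  · refine ⟨1 - τ, τ, bridge w τ, by linarith [hτ.2], h, by linarith, fun u hu _ => ?_⟩
    rw [hf, cutAtMin, ← hτdef, if_neg (not_le.2 hu)]
    congr 2; ring

theorem toNNReal_eq_scaleTime (k : ℕ) (x : ℝ≥0) :
    Real.toNNReal (((1 / 2) ^ (k + 1)) ^ 2 * (1 + x)) = scaleTime k x := by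
  ext
  rw [Real.coe_toNNReal _ (by positivity)]
  simp only [scaleTime]
  push_cast
  rw [← pow_mul, mul_comm (k + 1) 2, pow_mul]
  norm_num

/-- On a time interval of length `δ ^ 2` the drift changes by at most `δ`. This is why zigzags of
amplitude `2 δ` are requested for Brownian motion, and it is the final `+ 1` in the constant of the
modulus. -/
theorem excursion_exists_isComb (hw : Continuous w) {n : ℕ} {R : ℝ} (hR : 0 < R) {s ε c : ℝ}
    (hs : 0 ≤ s) (hsε : s + ε ≤ 1)
    (hf : ∀ u : I, s < u → u < s + ε → f u = bridge w (u - s) - c) {k : ℕ}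
    (hk : 2 * ((1 / 2 : ℝ) ^ (k + 1)) ^ 2 < ε) (hk1 : (1 / 2 : ℝ) ^ (k + 1) * |w 1| ≤ 1)
    (hzig : (fun p => w (scaleTime k (unitFrac p)) - w (scaleTime k 0)) ∈
      zigzagSet n ((1 / 2) ^ (k + 1)) ∩ dyadicSet R ((1 / 2) ^ (k + 1))) :
    ∃ (a b : I) (t : ℕ → I), (a : ℝ) = s + ((1 / 2 : ℝ) ^ (k + 1)) ^ 2 ∧
      (b : ℝ) = s + 2 * ((1 / 2 : ℝ) ^ (k + 1)) ^ 2 ∧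
      IsComb n (R * (1 + 2 / (1 - chainingRate ^ 4)) + 1) ((1 / 2) ^ (k + 1)) f a b t := by
  set δ : ℝ := (1 / 2) ^ (k + 1) with hδ
  have hδ0 : 0 < δ := by positivity
  set θ := chainingRate ^ 4 with hθ
  have hθ0 : 0 < 1 - θ := sub_pos.2 chainingRate_four_lt_one
  have hx1 (x : ℝ≥0) (hx : x ≤ 1) : δ ^ 2 * (1 + (x : ℝ)) ≤ 2 * δ ^ 2 := by
    have : (x : ℝ) ≤ 1 := hx
    nlinarith [sq_nonneg δ]
  have hpt (x : ℝ≥0) (hx : x ≤ 1) : s + δ ^ 2 * (1 + x) ∈ I :=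
    ⟨by positivity, by linarith [hx1 x hx]⟩
  have hfpt (x : ℝ≥0) (hx : x ≤ 1) : f ⟨_, hpt x hx⟩ =
      w (scaleTime k x) - δ ^ 2 * (1 + x) * w 1 - c := by
    rw [hf _ (lt_add_of_pos_right _ (by positivity)) (by simp only; linarith [hx1 x hx])]
    simp only [add_sub_cancel_left, bridge]
    rw [toNNReal_eq_scaleTime]
  have hu1 (p) : unitFrac p ≤ 1 := min_le_left _ _
  have hδw : δ ^ 2 * |w 1| ≤ δ := by nlinarith
  have hzz (x y : ℝ≥0) (hx : x ≤ 1) (hy : y ≤ 1)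
      (h : 2 * δ ≤ w (scaleTime k x) - w (scaleTime k y)) :
      f ⟨_, hpt y hy⟩ + δ ≤ f ⟨_, hpt x hx⟩ := by
    rw [hfpt x hx, hfpt y hy]
    have hxy : |(x : ℝ) - y| ≤ 1 := by
      have h1 : (x : ℝ) ≤ 1 := hx
      have h2 : (y : ℝ) ≤ 1 := hy
      rw [abs_le]; constructor <;> linarith [x.2, y.2]
    have h3 : |δ ^ 2 * (x - y) * w 1| ≤ δ := by
      rw [abs_mul, abs_mul, abs_of_nonneg (sq_nonneg δ)]
      calc δ ^ 2 * |(x : ℝ) - y| * |w 1| ≤ δ ^ 2 * 1 * |w 1| := by gcongr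
        _ ≤ δ := by linarith
    have h4 := (abs_le.1 h3).2
    nlinarith
  refine ⟨⟨_, hpt 0 zero_le_one⟩, ⟨_, hpt 1 le_rfl⟩, fun i => ⟨_, hpt (unitFrac (i, 2 * n)) (hu1 _)⟩,
    by simp, by simp; ring, ?_, hδ0, ?_, ?_, fun i => ⟨?_, ?_⟩, fun i hi => ?_, fun i hi => ?_⟩
  · rw [Subtype.mk_lt_mk]
    push_cast
    nlinarith [sq_pos_of_pos hδ0]
  · intro m u hu v hv huv
    have hu' : s + δ ^ 2 ≤ u ∧ u ≤ s + δ ^ 2 * 2 := by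
      have := hu.1; have := hu.2
      rw [← Subtype.coe_le_coe] at *
      norm_num at *
      constructor <;> linarith
    have hv' : s + δ ^ 2 ≤ v ∧ v ≤ s + δ ^ 2 * 2 := by
      have := hv.1; have := hv.2
      rw [← Subtype.coe_le_coe] at *
      norm_num at *
      constructor <;> linarith
    have hlen : |(u : ℝ) - v| ≤ δ ^ 2 / 2 ^ m := by
      refine huv.trans (le_of_eq ?_)
      push_cast; ring
    have hmem (u : I) (hu' : s + δ ^ 2 ≤ u ∧ u ≤ s + δ ^ 2 * 2) :
        ((u : ℝ) - s) / δ ^ 2 - 1 ∈ Icc (0 : ℝ) 1 := by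
      constructor
      · rw [sub_nonneg, le_div_iff₀ (by positivity)]; linarith [hu'.1]
      · rw [sub_le_iff_le_add, div_le_iff₀ (by positivity)]; linarith [hu'.2]
    have hval (u : I) (hu' : s + δ ^ 2 ≤ u ∧ u ≤ s + δ ^ 2 * 2) : f u =
        w (Real.toNNReal (δ ^ 2 * (1 + (((u : ℝ) - s) / δ ^ 2 - 1)))) - (u - s) * w 1 - c := by
      rw [hf u (by nlinarith [sq_pos_of_pos hδ0]) (by linarith [hu'.2])]
      simp only [bridge]
      congr 4
      field_simp
      ring
    have h1 := abs_sub_le_of_dyadic (g := fun x => w (Real.toNNReal (δ ^ 2 * (1 + x))))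
      (C := R * δ) (by fun_prop) (by positivity)
      chainingRate_four_pos chainingRate_four_lt_one (fun m j hj => ?_) (hmem u hu') (hmem v hv')
      (m := m) ?_
    · rw [hval u hu', hval v hv']
      have h2 : |((u : ℝ) - v) * w 1| ≤ δ * θ ^ m := by
        rw [abs_mul]
        calc |(u : ℝ) - v| * |w 1| ≤ δ ^ 2 / 2 ^ m * |w 1| := by gcongr
          _ = δ ^ 2 * |w 1| * (1 / 2) ^ m := by rw [one_div_pow]; ring
          _ ≤ δ * θ ^ m := mul_le_mul hδw (half_pow_le m) (by positivity) hδ0.le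
      have h3 (p q x y : ℝ) : p - x * w 1 - c - (q - y * w 1 - c) =
          (p - q) - (x - y) * w 1 := by ring
      rw [h3]
      refine (abs_sub _ _).trans ?_
      rw [sub_sub_sub_cancel_right]
      have h4 : (R * (1 + 2 / (1 - θ)) + 1) * δ * θ ^ m =
        R * δ * (1 + 2 / (1 - θ)) * θ ^ m + δ * θ ^ m := by ring
      rw [h4]
      exact add_le_add h1 h2
    · have h2 := hzig.2 m j hj
      simp only [sub_sub_sub_cancel_right] at h2
      rw [unitFrac_eq hj.le, unitFrac_eq hj] at h2
      convert h2 using 4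
      · rw [← toNNReal_eq_scaleTime]; push_cast; rfl
      · rw [← toNNReal_eq_scaleTime]; push_cast; rfl
    · rw [sub_sub_sub_cancel_right, ← sub_div, sub_sub_sub_cancel_right, abs_div,
        abs_of_nonneg (sq_nonneg δ), div_le_iff₀ (by positivity)]
      refine hlen.trans (le_of_eq ?_)
      ring
  · intro i j hij
    rw [Subtype.mk_le_mk]
    have : unitFrac (i, 2 * n) ≤ unitFrac (j, 2 * n) := by
      unfold unitFrac
      gcongr
    have : ((unitFrac (i, 2 * n) : ℝ≥0) : ℝ) ≤ unitFrac (j, 2 * n) := this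
    gcongr
  · rw [Subtype.mk_le_mk]
    gcongr
    exact zero_le
  · rw [Subtype.mk_le_mk]
    gcongr
    exact hu1 _
  · refine hzz _ _ (hu1 _) (hu1 _) ?_
    have := (hzig.1 i hi).1
    simpa only [sub_sub_sub_cancel_right] using this
  · refine hzz _ _ (hu1 _) (hu1 _) ?_
    have := (hzig.1 i hi).2
    simpa only [sub_sub_sub_cancel_right] using this

theorem excursion_hasCombs (hw : Continuous w) (hf : ∀ t : I, f t = cutAtMin (bridge w) t)
    {n : ℕ} {R : ℝ} (hR : 0 < R)
    (hfreq : ∀ k₀, ∃ k ≥ k₀, (fun p => w (scaleTime k (unitFrac p)) - w (scaleTime k 0)) ∈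
      zigzagSet n ((1 / 2) ^ (k + 1)) ∩ dyadicSet R ((1 / 2) ^ (k + 1))) :
    HasCombs n f := by
  obtain ⟨s, ε, c, hs, hε, hsε, hfs⟩ := excursion_eq_bridge hw hf
  have hpow : Filter.Tendsto (fun k : ℕ => (1 / 2 : ℝ) ^ (k + 1)) Filter.atTop (𝓝 0) :=
    (tendsto_pow_atTop_nhds_zero_of_lt_one (by norm_num) (by norm_num)).comp
      (Filter.tendsto_add_atTop_nat 1)
  have ev1 : ∀ᶠ k : ℕ in Filter.atTop, 2 * ((1 / 2 : ℝ) ^ (k + 1)) ^ 2 < ε := by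
    have := (hpow.pow 2).const_mul 2
    norm_num at this
    exact (this.eventually (gt_mem_nhds hε)).mono fun k hk => by simpa using hk
  have ev2 : ∀ᶠ k : ℕ in Filter.atTop, (1 / 2 : ℝ) ^ (k + 1) * |w 1| ≤ 1 := by
    have := hpow.mul_const |w 1|
    rw [zero_mul] at this
    exact this.eventually (ge_mem_nhds one_pos)
  obtain ⟨φ, hφ, hφk⟩ := Filter.extraction_of_frequently_atTop
    ((Filter.frequently_atTop.2 hfreq).and_eventually (ev1.and ev2))
  choose a b t ha hb hcomb using fun k =>
    excursion_exists_isComb hw hR hs hsε hfs (hφk k).2.1 (hφk k).2.2 (hφk k).1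
  have hθ0 : 0 < 1 - chainingRate ^ 4 := sub_pos.2 chainingRate_four_lt_one
  refine ⟨_, by positivity, a, b, _, t, hcomb, ?_⟩
  have hlt (k l : ℕ) (h : k < l) : b l ≤ a k := by
    rw [← Subtype.coe_le_coe, ha, hb]
    have h1 : (1 / 2 : ℝ) ^ (φ l + 1) ≤ (1 / 2) ^ (φ k + 1 + 1) :=
      pow_le_pow_of_le_one (by norm_num) (by norm_num) (by have := hφ h; omega)
    have h2 : ((1 / 2 : ℝ) ^ (φ l + 1)) ^ 2 ≤ ((1 / 2) ^ (φ k + 1 + 1)) ^ 2 := by gcongr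
    rw [pow_succ (1 / 2 : ℝ) (φ k + 1), mul_pow] at h2
    linarith [sq_nonneg ((1 / 2 : ℝ) ^ (φ k + 1))]
  intro k l hkl
  rcases lt_or_gt_of_ne hkl with h | h
  · exact .inr (hlt k l h)
  · exact .inl (hlt l k h)

end Excursion

/-! ### Measurability -/

/-- The tube lemma: projection along the compact interval is a closed map. -/
theorem isOpen_forall_mem {X : Type*} [TopologicalSpace X] {K : Set I} (hK : IsClosed K)
    {U : Set (I × X)} (hU : IsOpen U) : IsOpen {x | ∀ t ∈ K, (t, x) ∈ U} := by
  have hcl : IsClosed (Prod.snd '' ((K ×ˢ (univ : Set X)) ∩ Uᶜ)) :=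
    isClosedMap_snd_of_compactSpace _ ((hK.prod isClosed_univ).inter hU.isClosed_compl)
  convert hcl.isOpen_compl using 1
  ext x
  simp only [mem_ofPred_eq, mem_compl_iff, mem_image, not_exists, not_and]
  constructor
  · rintro h ⟨t, y⟩ ⟨⟨ht, -⟩, hy⟩ rfl
    exact hy (h t ht)
  · intro h t ht
    by_contra hx
    exact h (t, x) ⟨⟨ht, mem_univ _⟩, hx⟩ rfl

/-- All conditions are strict inequalities over compact sets of times. The condition at branch
points is stated as "not a minimum of `f`, or low label", which makes it open as well. -/
theorem isOpen_hasLabelStar (n : ℕ) :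
    IsOpen {p : C(I, ℝ) × C(I, ℝ) | HasLabelStar n p.1 p.2} := by
  have heq : {p : C(I, ℝ) × C(I, ℝ) | HasLabelStar n p.1 p.2} =
      ⋃ (r : ℝ) (_ : 0 < r) (a : I) (u : Fin n → I) (_ : ∀ i, a ≤ u i),
        {p | ∀ i, ∀ t ∈ Icc a (u i), p.2 a - r < p.2 t} ∩
        ({p | ∀ i, p.2 a + 100 * r < p.2 (u i) ∧ p.2 (u i) < p.2 a + 103 * r} ∩
        {p | ∀ i j, i ≠ j → ∀ m ∈ uIcc (u i) (u j),
          (∃ t ∈ uIcc (u i) (u j), p.1 t < p.1 m) ∨ p.2 m < p.2 a + r}) := by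
    ext p
    simp only [HasLabelStar, mem_ofPred_eq, mem_iUnion, mem_inter_iff, exists_prop]
  rw [heq]
  refine isOpen_iUnion fun r => isOpen_iUnion fun _ => isOpen_iUnion fun a =>
    isOpen_iUnion fun u => isOpen_iUnion fun _ => (?_ : IsOpen _).inter ((?_ : IsOpen _).inter ?_)
  · rw [ofPred_forall]
    refine isOpen_iInter_of_finite fun i => isOpen_forall_mem isClosed_Icc
      (U := {q : I × (C(I, ℝ) × C(I, ℝ)) | q.2.2 a - r < q.2.2 q.1}) ?_
    exact isOpen_lt (by fun_prop) (by fun_prop)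
  · simp only [ofPred_forall, ofPred_and]
    exact isOpen_iInter_of_finite fun i =>
      (isOpen_lt (by fun_prop) (by fun_prop)).inter (isOpen_lt (by fun_prop) (by fun_prop))
  · simp only [ofPred_forall]
    refine isOpen_iInter_of_finite fun i => isOpen_iInter_of_finite fun j =>
      isOpen_iInter_of_finite fun _ => ?_
    have h := isOpen_forall_mem (X := C(I, ℝ) × C(I, ℝ)) (K := uIcc (u i) (u j))
      isCompact_uIcc.isClosed
      (U := (⋃ t ∈ uIcc (u i) (u j), {q | q.2.1 t < q.2.1 q.1}) ∪ {q | q.2.2 q.1 < q.2.2 a + r})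
      ((isOpen_biUnion fun t _ => isOpen_lt (by fun_prop) (by fun_prop)).union
        (isOpen_lt (by fun_prop) (by fun_prop)))
    convert h using 1
    ext p
    simp

/-- The violations of size at least `1 / (N + 1)` form a closed set, as the projection along the
compact square of a closed condition on `(s, t)`. Clamping `u` between `s ⊓ t` and `s ⊔ t` lets `u`
run over a set not depending on `(s, t)`. -/
theorem measurableSet_labelsFactor :
    MeasurableSet {p : C(I, ℝ) × C(I, ℝ) | LabelsFactor p.1 p.2} := by
  have hcl (N : ℕ) : IsClosed (Prod.snd '' {q : (I × I) × (C(I, ℝ) × C(I, ℝ)) |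
      (q.2.1 q.1.1 = q.2.1 q.1.2 ∧
        ∀ u, q.2.1 q.1.1 ≤ q.2.1 ((u ⊔ (q.1.1 ⊓ q.1.2)) ⊓ (q.1.1 ⊔ q.1.2))) ∧
      1 / ((N : ℝ) + 1) ≤ |q.2.2 q.1.1 - q.2.2 q.1.2|}) := by
    refine isClosedMap_snd_of_compactSpace _ ?_
    simp only [ofPred_and]
    refine (IsClosed.inter ?_ ?_).inter ?_
    · exact isClosed_eq (by fun_prop) (by fun_prop)
    · rw [ofPred_forall]
      exact isClosed_iInter fun u => isClosed_le (by fun_prop) (by fun_prop)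
    · exact isClosed_le (by fun_prop) (by fun_prop)
  have heq : {p : C(I, ℝ) × C(I, ℝ) | LabelsFactor p.1 p.2} = (⋃ N : ℕ, Prod.snd ''
      {q : (I × I) × (C(I, ℝ) × C(I, ℝ)) | (q.2.1 q.1.1 = q.2.1 q.1.2 ∧
        ∀ u, q.2.1 q.1.1 ≤ q.2.1 ((u ⊔ (q.1.1 ⊓ q.1.2)) ⊓ (q.1.1 ⊔ q.1.2))) ∧
      1 / ((N : ℝ) + 1) ≤ |q.2.2 q.1.1 - q.2.2 q.1.2|})ᶜ := by
    ext p
    simp only [mem_compl_iff, mem_iUnion, not_exists, mem_ofPred_eq, mem_image, not_and]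
    constructor
    · rintro h N ⟨⟨s, t⟩, q⟩ ⟨⟨h1, h2⟩, h3⟩ rfl
      have hst := h s t (treeDist_eq_zero h1 fun u hu => ?_)
      · have hpos : 0 < 1 / ((N : ℝ) + 1) := by positivity
        simp only [hst, sub_self, abs_zero] at h3
        linarith
      · have := h2 u
        rwa [sup_eq_left.2 hu.1, inf_eq_left.2 hu.2] at this
    · intro h s t hst
      by_contra hne
      obtain ⟨N, hN⟩ := exists_nat_one_div_lt (abs_pos.2 (sub_ne_zero.2 hne))
      obtain ⟨h1, h2⟩ := le_of_treeDist_eq_zero hst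
      refine h N ((s, t), p) ⟨⟨h1, fun u => h2 _ ⟨?_, inf_le_right⟩⟩, hN.le⟩ rfl
      exact le_inf le_sup_right inf_le_sup
  rw [heq]
  exact (MeasurableSet.iUnion fun N => (hcl N).measurableSet).compl

/-- The joint law of `e` and `Z` is the composition product of the law of `e` with `κ`, so a jointly
measurable property may be proved for fixed `e`. -/
theorem ae_of_hasCondDistrib {Ω E F : Type*} {mΩ : MeasurableSpace Ω} {mE : MeasurableSpace E}
    {mF : MeasurableSpace F} {P : Measure Ω} [IsProbabilityMeasure P] {e : Ω → E} {Z : Ω → F}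
    {κ : Kernel E F} [IsMarkovKernel κ] (h : HasCondDistrib Z e κ P) {Q : E → F → Prop}
    (hQ : MeasurableSet {p : E × F | Q p.1 p.2}) (hae : ∀ᵐ ω ∂P, ∀ᵐ z ∂κ (e ω), Q (e ω) z) :
    ∀ᵐ ω ∂P, Q (e ω) (Z ω) := by
  have he := h.aemeasurable_fst
  have hm : MeasurableSet {f : E | ∀ᵐ z ∂κ f, Q f z} := by
    have := Kernel.measurable_kernel_prodMk_left (κ := κ) hQ.compl
    exact this (measurableSet_singleton 0)
  have h1 : ∀ᵐ f ∂P.map e, ∀ᵐ z ∂κ f, Q f z := (ae_map_iff he hm).2 hae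
  have h2 : ∀ᵐ p ∂(P.map e ⊗ₘ κ), Q p.1 p.2 := Measure.ae_compProd_of_ae_ae hQ h1
  rw [← h.map_eq] at h2
  exact ae_of_ae_map h.aemeasurable h2

/-! ### Teeth of a comb and the associated bumps -/

theorem min_minBetween_le (f : C(I, ℝ)) (s t u : I) :
    min (minBetween f s t) (minBetween f t u) ≤ minBetween f s u := by
  refine le_minBetween fun v hv => ?_
  rcases uIcc_subset_uIcc_union_uIcc (b := t) hv with h | h
  · exact (min_le_left _ _).trans (minBetween_le f h)
  · exact (min_le_right _ _).trans (minBetween_le f h)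

theorem minBetween_anti (f : C(I, ℝ)) {s t s' t' : I} (h : uIcc s t ⊆ uIcc s' t') :
    minBetween f s' t' ≤ minBetween f s t :=
  le_minBetween fun _ hv => minBetween_le f (h hv)

/-- On `[l, r]` the function `f` climbs to `f u` from the two sides; `β` codes the point of the tree
at which the branch leading to `u` leaves the rest of the tree. -/
structure IsTooth (f : C(I, ℝ)) (l r u β : I) : Prop where
  left_le : l ≤ u
  le_right : u ≤ r
  foot_mem : β ∈ Icc l r
  minBetween_foot : minBetween f β u = f β
  outside : ∀ s, s ∉ Ioo l r → minBetween f s u = minBetween f s β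
  exists_left : ∃ p ∈ Icc l u, f p ≤ f β
  exists_right : ∃ q ∈ Icc u r, f q ≤ f β
  foot_eq : f β = max (minBetween f l u) (minBetween f u r)

/-- The foot is a minimum point of `f` on whichever side of `u` has the higher minimum. From outside
`(l, r)`, reaching `u` or `β` meets the same minimum: entering over the foot's side passes `β`
anyway, and entering over the other side passes a value no higher than the foot. -/
theorem exists_isTooth (f : C(I, ℝ)) {l u r : I} (hlu : l ≤ u) (hur : u ≤ r) :
    ∃ β, IsTooth f l r u β := by
  obtain ⟨p, hp, hfp⟩ := exists_eq_minBetween f l u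
  obtain ⟨q, hq, hfq⟩ := exists_eq_minBetween f u r
  have hpmin : ∀ w ∈ Icc l u, f p ≤ f w := fun w hw =>
    hfp ▸ minBetween_le f (Icc_subset_uIcc hw)
  have hqmin : ∀ w ∈ Icc u r, f q ≤ f w := fun w hw =>
    hfq ▸ minBetween_le f (Icc_subset_uIcc hw)
  rw [uIcc_of_le hlu] at hp
  rw [uIcc_of_le hur] at hq
  have hsplit {s : I} (hs : s ∉ Ioo l r) : s ≤ l ∨ r ≤ s := by
    by_contra! h
    exact hs h
  rcases le_total (f q) (f p) with h | h
  · refine ⟨p, hlu, hur, ⟨hp.1, hp.2.trans hur⟩, ?_, fun s hs => ?_, ⟨p, hp, le_rfl⟩, ⟨q, hq, h⟩, ?_⟩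
    · refine le_antisymm (minBetween_le f left_mem_uIcc) (le_minBetween fun w hw => ?_)
      rw [uIcc_of_le hp.2] at hw
      exact hpmin w ⟨hp.1.trans hw.1, hw.2⟩
    · rcases hsplit hs with hs | hs
      · have hsp := hs.trans hp.1
        refine le_antisymm (minBetween_anti f ?_) (le_minBetween fun w hw => ?_)
        · rw [uIcc_of_le hsp, uIcc_of_le (hs.trans hlu)]
          exact Icc_subset_Icc_right hp.2
        · rw [uIcc_of_le (hs.trans hlu)] at hw
          rcases le_total w p with hwp | hwp
          · exact minBetween_le f (Icc_subset_uIcc ⟨hw.1, hwp⟩)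
          · exact (minBetween_le f right_mem_uIcc).trans (hpmin w ⟨hp.1.trans hwp, hw.2⟩)
      · have hus := hur.trans hs
        refine le_antisymm (le_minBetween fun w hw => ?_) (minBetween_anti f ?_)
        · rw [uIcc_of_ge (hp.2.trans hus)] at hw
          rcases le_total u w with hwu | hwu
          · exact minBetween_le f (by rw [uIcc_of_ge hus]; exact ⟨hwu, hw.2⟩)
          · have h1 : minBetween f s u ≤ f q :=
              minBetween_le f (by rw [uIcc_of_ge hus]; exact ⟨hq.1, hq.2.trans hs⟩)
            exact h1.trans (h.trans (hpmin w ⟨hp.1.trans hw.1, hwu⟩))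
        · rw [uIcc_of_ge hus, uIcc_of_ge (hp.2.trans hus)]
          exact Icc_subset_Icc_left hp.2
    · rw [← hfp, ← hfq, max_eq_left h]
  · refine ⟨q, hlu, hur, ⟨hlu.trans hq.1, hq.2⟩, ?_, fun s hs => ?_, ⟨p, hp, h⟩, ⟨q, hq, le_rfl⟩, ?_⟩
    · refine le_antisymm (minBetween_le f left_mem_uIcc) (le_minBetween fun w hw => ?_)
      rw [uIcc_of_ge hq.1] at hw
      exact hqmin w ⟨hw.1, hw.2.trans hq.2⟩
    · rcases hsplit hs with hs | hs
      · have hsu := hs.trans hlu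
        refine le_antisymm (le_minBetween fun w hw => ?_) (minBetween_anti f ?_)
        · rw [uIcc_of_le (hsu.trans hq.1)] at hw
          rcases le_total w u with hwu | hwu
          · exact minBetween_le f (Icc_subset_uIcc ⟨hw.1, hwu⟩)
          · have h1 : minBetween f s u ≤ f p :=
              minBetween_le f (Icc_subset_uIcc ⟨hs.trans hp.1, hp.2⟩)
            exact h1.trans (h.trans (hqmin w ⟨hwu, hw.2.trans hq.2⟩))
        · rw [uIcc_of_le hsu, uIcc_of_le (hsu.trans hq.1)]
          exact Icc_subset_Icc_right hq.1
      · have hqs := hq.2.trans hs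
        have hus := hur.trans hs
        refine le_antisymm (minBetween_anti f ?_) (le_minBetween fun w hw => ?_)
        · rw [uIcc_of_ge hqs, uIcc_of_ge hus]
          exact Icc_subset_Icc_left hq.1
        · rw [uIcc_of_ge hus] at hw
          rcases le_total q w with hwq | hwq
          · exact minBetween_le f (by rw [uIcc_of_ge hqs]; exact ⟨hwq, hw.2⟩)
          · exact (minBetween_le f right_mem_uIcc).trans (hqmin w ⟨hw.1, hwq.trans hq.2⟩)
    · rw [← hfp, ← hfq, max_eq_right h]

/-- The length of the part of the branch from `β` to `u` that is ancestral to `s`. -/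
noncomputable def bump (f : C(I, ℝ)) (u β s : I) : ℝ := minBetween f s u - minBetween f s β

namespace IsTooth

variable {f : C(I, ℝ)} {l r u β : I}

theorem foot_le (h : IsTooth f l r u β) : f β ≤ f u :=
  h.minBetween_foot ▸ minBetween_le f right_mem_uIcc

theorem bump_nonneg (h : IsTooth f l r u β) (s : I) : 0 ≤ bump f u β s := by
  have h1 := min_minBetween_le f s β u
  rw [h.minBetween_foot, min_eq_left (minBetween_le f right_mem_uIcc)] at h1
  exact sub_nonneg.2 h1

theorem bump_le (h : IsTooth f l r u β) (s : I) : bump f u β s ≤ f u - f β := by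
  have h1 := min_minBetween_le f s u β
  rw [minBetween_comm f u β, h.minBetween_foot] at h1
  have h2 : minBetween f s u ≤ f u := minBetween_le f right_mem_uIcc
  have h3 := h.foot_le
  simp only [bump]
  rcases min_choice (minBetween f s u) (f β) with h' | h' <;> rw [h'] at h1 <;> linarith

theorem bump_eq_zero (h : IsTooth f l r u β) {s : I} (hs : f s ≤ f β) : bump f u β s = 0 := by
  refine le_antisymm ?_ (h.bump_nonneg s)
  have h1 := min_minBetween_le f s u β
  have h2 : minBetween f s u ≤ f s := minBetween_le f left_mem_uIcc
  rw [minBetween_comm f u β, h.minBetween_foot, min_eq_left (h2.trans hs)] at h1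
  exact sub_nonpos.2 h1

theorem bump_outside (h : IsTooth f l r u β) {s : I} (hs : s ∉ Ioo l r) : bump f u β s = 0 :=
  sub_eq_zero.2 (h.outside s hs)

theorem bump_top (h : IsTooth f l r u β) : bump f u β u = f u - f β := by
  rw [bump, minBetween_self, minBetween_comm, h.minBetween_foot]

theorem bump_foot (h : IsTooth f l r u β) : bump f u β β = 0 := h.bump_eq_zero le_rfl

theorem treeDist_eq (h : IsTooth f l r u β) : treeDist f u β = f u - f β := by
  rw [treeDist, minBetween_comm, h.minBetween_foot]; ring

end IsTooth

theorem IsComb.exists_isTooth {n : ℕ} {C δ : ℝ} {f : C(I, ℝ)} {a b : I} {t : ℕ → I}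
    (h : IsComb n C δ f a b t) (i : Fin n) :
    ∃ β, IsTooth f (t (2 * i)) (t (2 * i + 2)) (t (2 * i + 1)) β ∧ f β + δ ≤ f (t (2 * i + 1)) := by
  have h1 : t (2 * i) ≤ t (2 * i + 1) := h.mono (by omega)
  have h2 : t (2 * i + 1) ≤ t (2 * i + 2) := h.mono (by omega)
  obtain ⟨β, hβ⟩ := BrownianMap.exists_isTooth f h1 h2
  refine ⟨β, hβ, ?_⟩
  have h3 : minBetween f (t (2 * i)) (t (2 * i + 1)) ≤ f (t (2 * i)) :=
    minBetween_le f left_mem_uIcc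
  have h4 : minBetween f (t (2 * i + 1)) (t (2 * i + 2)) ≤ f (t (2 * i + 2)) :=
    minBetween_le f right_mem_uIcc
  have h5 := h.left i i.2
  have h6 := h.right i i.2
  rw [hβ.foot_eq]
  rcases max_choice (minBetween f (t (2 * i)) (t (2 * i + 1)))
    (minBetween f (t (2 * i + 1)) (t (2 * i + 2))) with h' | h' <;> rw [h'] <;> linarith

/-- A label star from labels which are large on the teeth of a comb and small otherwise. -/
theorem hasLabelStar_of_comb {n : ℕ} {C δ : ℝ} {f z : C(I, ℝ)} {a b : I} {t : ℕ → I}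
    (h : IsComb n C δ f a b t) {β : Fin n → I}
    (hβ : ∀ i : Fin n, IsTooth f (t (2 * i)) (t (2 * i + 2)) (t (2 * i + 1)) (β i))
    (hv : ∀ i : Fin n, f (β i) < f (t (2 * i + 1))) {Y : I → ℝ} {ξ : Fin n → ℝ}
    (hz : ∀ s, z s = Y s + ∑ i : Fin n, bump f (t (2 * i + 1)) (β i) s /
      (f (t (2 * i + 1)) - f (β i)) * ξ i) {r : ℝ} (hr : 0 < r)
    (hY : ∀ s ∈ Icc a b, |Y s - z a| ≤ r) (hξ : ∀ i, ξ i ∈ Icc (202 * r) (204 * r)) :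
    HasLabelStar n f z := by
  have hξ0 (i) : 0 ≤ ξ i := (by positivity : 0 ≤ 202 * r).trans (hξ i).1
  have hYz (s : I) : Y s ≤ z s := by
    rw [hz s, le_add_iff_nonneg_right]
    exact Finset.sum_nonneg fun i _ => mul_nonneg
      (div_nonneg ((hβ i).bump_nonneg s) (sub_nonneg.2 (hv i).le)) (hξ0 i)
  have hmem (i : Fin n) : t (2 * i + 1) ∈ Icc a b := h.mem _
  -- The scale is doubled to turn weak bounds into strict ones: the tips have labels between `z a +
  -- 201 r` and `z a + 205 r`, inside the required window from `200 r` to `206 r`.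
  refine ⟨2 * r, by positivity, a, fun i => t (2 * i + 1), fun i => (hmem i).1,
    fun i s hs => ?_, fun i => ?_, fun i j hij m hm => ?_⟩
  · have := (abs_le.1 (hY s ⟨hs.1, hs.2.trans (hmem i).2⟩)).1
    linarith [hYz s]
  · have hzi : z (t (2 * i + 1)) = Y (t (2 * i + 1)) + ξ i := by
      rw [hz, Finset.sum_eq_single i]
      · rw [(hβ i).bump_top, div_self (sub_ne_zero.2 (hv i).ne'), one_mul]
      · intro j _ hji
        rw [(hβ j).bump_outside, zero_div, zero_mul]
        rintro ⟨h1, h2⟩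
        rcases lt_or_gt_of_ne (Fin.val_ne_of_ne hji) with hlt | hlt
        · exact absurd h2 (not_lt.2 (h.mono (by omega)))
        · exact absurd h1 (not_lt.2 (h.mono (by omega)))
      · simp
    have h1 := abs_le.1 (hY _ (hmem i))
    have h2 := hξ i
    simp only
    constructor <;> linarith [h1.1, h1.2, h2.1, h2.2]
  · by_cases hex : ∃ w ∈ uIcc (t (2 * i + 1)) (t (2 * j + 1)), f w < f m
    · exact .inl hex
    right
    push Not at hex
    wlog hlt : i < j generalizing i j
    · refine this j i hij.symm (by rwa [uIcc_comm]) (by rwa [uIcc_comm]) ?_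
      exact lt_of_le_of_ne (not_lt.1 hlt) hij.symm
    have hlt' : (i : ℕ) < j := hlt
    rw [uIcc_of_le (h.mono (by omega))] at hm hex
    -- At a minimum `m` of `f` between two tips every bump vanishes. A tooth containing `m` has one
    -- full side between the two tips, and that side goes down to the height of its foot, so `f m`
    -- is at most that height.
    have hzm : z m = Y m := by
      rw [hz, add_eq_left]
      refine Finset.sum_eq_zero fun l _ => ?_
      suffices bump f (t (2 * l + 1)) (β l) m = 0 by rw [this, zero_div, zero_mul]
      by_cases hml : m ∈ Ioo (t (2 * l)) (t (2 * l + 2))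
      · refine (hβ l).bump_eq_zero ?_
        have hil : (i : ℕ) ≤ l := by
          by_contra hcon
          exact absurd (hml.2.trans_le (h.mono (by omega))) (not_lt.2 hm.1)
        have hlj : (l : ℕ) ≤ j := by
          by_contra hcon
          exact absurd (lt_of_le_of_lt (h.mono (by omega)) hml.1) (not_lt.2 hm.2)
        rcases hlj.lt_or_eq with hlj | hlj
        · obtain ⟨q, hq, hfq⟩ := (hβ l).exists_right
          exact (hex q ⟨le_trans (h.mono (by omega)) hq.1,
            hq.2.trans (h.mono (by omega))⟩).trans hfq
        · obtain ⟨p, hp, hfp⟩ := (hβ l).exists_left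
          exact (hex p ⟨le_trans (h.mono (by omega)) hp.1,
            hp.2.trans (h.mono (by omega))⟩).trans hfp
      · exact (hβ l).bump_outside hml
    have := (abs_le.1 (hY m ⟨(hmem i).1.trans hm.1, hm.2.trans (hmem j).2⟩)).2
    linarith

theorem coe_mem_uIcc {s t w : I} (hw : w ∈ uIcc s t) : (w : ℝ) ∈ uIcc (s : ℝ) t := by
  rcases le_total s t with h | h
  · rw [uIcc_of_le h] at hw; rw [uIcc_of_le (Subtype.coe_le_coe.2 h)]; exact hw
  · rw [uIcc_of_ge h] at hw; rw [uIcc_of_ge (Subtype.coe_le_coe.2 h)]; exact hw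

/-- The minimum is an affine function of `f s` and the tree distance to `u`; the latter is
continuous by the triangle inequality and continuity of `f`. -/
theorem continuous_minBetween_left (f : C(I, ℝ)) (u : I) :
    Continuous fun s => minBetween f s u := by
  have hd : Continuous fun s => treeDist f s u := by
    rw [continuous_iff_continuousAt]
    intro s
    rw [ContinuousAt, Metric.tendsto_nhds]
    intro ε hε
    obtain ⟨η, hη, hfη⟩ := Metric.continuousAt_iff.1 (f.continuous.continuousAt (x := s)) (ε / 4) (by positivity)
    filter_upwards [Metric.ball_mem_nhds s hη] with s' hs'
    have hclose (w : I) (hw : w ∈ uIcc s s') : |f w - f s| < ε / 4 := by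
      have : dist w s ≤ dist s' s := by
        rw [dist_comm w s, dist_comm s' s]
        exact Real.dist_left_le_of_mem_uIcc (coe_mem_uIcc hw)
      exact hfη (this.trans_lt hs')
    obtain ⟨m, hm, hfm⟩ := exists_eq_minBetween f s s'
    have h1 := abs_lt.1 (hclose m hm)
    have h2 := abs_lt.1 (hclose s' right_mem_uIcc)
    have h3 : treeDist f s s' < ε := by
      rw [treeDist, ← hfm]; linarith [h1.1, h2.2]
    rw [Real.dist_eq, abs_lt]
    have h4 := treeDist_triangle f s s' u
    have h5 := treeDist_triangle f s' s u
    rw [treeDist_comm f s' s] at h5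
    constructor <;> linarith
  have : (fun s => minBetween f s u) = fun s => (f s + f u - treeDist f s u) / 2 := by
    ext s; simp only [treeDist]; ring
  rw [this]
  fun_prop

theorem continuous_bump (f : C(I, ℝ)) (u β : I) : Continuous (bump f u β) :=
  (continuous_minBetween_left f u).sub (continuous_minBetween_left f β)

theorem HasModulusOn.treeDist_le {f : C(I, ℝ)} {C : ℝ} {a b : I} (h : HasModulusOn f C a b)
    {s t : I} (hs : s ∈ Icc a b) (ht : t ∈ Icc a b) {m : ℕ}
    (hst : |(s : ℝ) - t| ≤ (b - a) / 2 ^ m) :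
    treeDist f s t ≤ 2 * C * (chainingRate ^ 4) ^ m := by
  obtain ⟨w, hw, hfw⟩ := exists_eq_minBetween f s t
  have hwab : w ∈ Icc a b := ordConnected_Icc.uIcc_subset hs ht hw
  have hw' := coe_mem_uIcc hw
  have h1 := h m s hs w hwab ((Real.dist_left_le_of_mem_uIcc hw').trans hst)
  have h2 := h m w hwab t ht ((Real.dist_right_le_of_mem_uIcc hw').trans hst)
  have h3 := le_abs_self (f s - f w)
  have h4 := neg_le_abs (f w - f t)
  rw [treeDist, ← hfw]
  linarith

/-! ### Gaussian labels on a fixed tree -/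

/-- `μ` is the law of a continuous centred Gaussian process with covariance `minBetween f`. -/
structure IsLabelLaw (f : C(I, ℝ)) (μ : Measure C(I, ℝ)) : Prop where
  gaussian : IsGaussianProcess (fun (t : I) (z : C(I, ℝ)) => z t) μ
  mean : ∀ t : I, ∫ z : C(I, ℝ), z t ∂μ = 0
  cov : ∀ s t : I, ∫ z : C(I, ℝ), z s * z t ∂μ = minBetween f s t

/-- The linear functionals of the labels of finitely many times. -/
def labelFunctionals : Submodule ℝ (C(I, ℝ) → ℝ) :=
  Submodule.span ℝ (range fun (t : I) (z : C(I, ℝ)) => z t)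

theorem eval_mem_labelFunctionals (t : I) :
    (fun z : C(I, ℝ) => z t) ∈ labelFunctionals := Submodule.subset_span ⟨t, rfl⟩

theorem measurable_eval (t : I) : Measurable fun z : C(I, ℝ) => z t :=
  (by fun_prop : Continuous fun z : C(I, ℝ) => z t).measurable

theorem ae_of_forall_one_sub_le {Ω : Type*} {mΩ : MeasurableSpace Ω} {P : Measure Ω}
    [IsProbabilityMeasure P] {S : Set Ω} (hS : MeasurableSet S)
    (h : ∀ ε : ℝ, 0 < ε → 1 - 2 * ε ≤ P.real S) : ∀ᵐ ω ∂P, ω ∈ S := by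
  have h1 : P.real S = 1 := by
    refine le_antisymm measureReal_le_one (le_of_forall_pos_le_add fun ε hε => ?_)
    linarith [h (ε / 2) (by positivity)]
  exact (prob_compl_eq_zero_iff hS).2 ((ENNReal.toReal_eq_one_iff _).1 h1)

namespace IsLabelLaw

variable {f : C(I, ℝ)} {μ : Measure C(I, ℝ)}

theorem isProbabilityMeasure (h : IsLabelLaw f μ) : IsProbabilityMeasure μ :=
  h.gaussian.isProbabilityMeasure

theorem memLp (h : IsLabelLaw f μ) (t : I) : MemLp (fun z : C(I, ℝ) => z t) 2 μ :=
  (h.gaussian.hasGaussianLaw_eval t).memLp_two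

theorem covariance (h : IsLabelLaw f μ) (s t : I) :
    cov[fun z : C(I, ℝ) => z s, fun z => z t; μ] = minBetween f s t := by
  have := h.isProbabilityMeasure
  rw [covariance_eq_sub (h.memLp s) (h.memLp t), h.mean, zero_mul, sub_zero]
  exact h.cov s t

theorem hasLaw_sub (h : IsLabelLaw f μ) (s t : I) :
    HasLaw (fun z : C(I, ℝ) => z s - z t) (gaussianReal 0 (treeDist f s t).toNNReal) μ := by
  have := h.isProbabilityMeasure
  have hg : HasGaussianLaw (fun z : C(I, ℝ) => z s - z t) μ := h.gaussian.hasGaussianLaw_fun_sub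
  refine ⟨hg.aemeasurable, ?_⟩
  rw [hg.map_eq_gaussianReal]
  congr 1
  · rw [integral_sub ((h.memLp s).integrable one_le_two) ((h.memLp t).integrable one_le_two),
      h.mean, h.mean, sub_zero]
  · rw [← covariance_self hg.aemeasurable, covariance_fun_sub_fun_sub (h.memLp s) (h.memLp t)
      (h.memLp s) (h.memLp t)]
    simp only [h.covariance, minBetween_self, treeDist, minBetween_comm f t s]
    congr 1; ring

theorem gaussian_of_mem (h : IsLabelLaw f μ) {ι : Type*} {Y : ι → C(I, ℝ) → ℝ}
    (hY : ∀ i, Y i ∈ labelFunctionals) : IsGaussianProcess Y μ := by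
  refine IsGaussianProcess.of_isGaussianProcess h.gaussian fun i => ?_
  obtain ⟨c, hc⟩ := Finsupp.mem_span_range_iff_exists_finsupp.1 (hY i)
  refine ⟨c.support, ∑ s : c.support, c s • ContinuousLinearMap.proj s, fun z => ?_⟩
  rw [← hc, Finsupp.sum, Finset.sum_apply, ← Finset.sum_coe_sort]
  simp

/-- Almost surely the labels are well defined on the tree. -/
theorem ae_labelsFactor (h : IsLabelLaw f μ) {H : ℝ} (hH : 0 < H) (hf : HasModulusOn f H 0 1) :
    ∀ᵐ z ∂μ, LabelsFactor f z := by
  have hprob := h.isProbabilityMeasure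
  set θ := chainingRate ^ 4 with hθ
  have hθ0 : 0 < θ := chainingRate_four_pos
  have hmem (m j : ℕ) : ((unitFrac (j, 2 ^ m) : ℝ≥0) : ℝ) ∈ I :=
    ⟨NNReal.coe_nonneg _, by exact_mod_cast min_le_left _ _⟩
  set g : ℕ → ℕ → I := fun m j => ⟨_, hmem m j⟩ with hg
  -- A grid pair of level `m` at small tree distance has labels differing by at least `δ`. The
  -- threshold `4 * H * θ ^ m` is twice the cost of moving one point to the grid.
  set A : ℝ → ℕ → Set C(I, ℝ) := fun δ m => ⋃ p ∈ (Finset.range (2 ^ m + 1) ×ˢ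
    Finset.range (2 ^ m + 1)).filter fun p => treeDist f (g m p.1) (g m p.2) ≤ 4 * H * θ ^ m,
    {z | δ ≤ |z (g m p.1) - z (g m p.2)|} with hA
  have hApr (δ : ℝ) (hδ : 0 < δ) (m : ℕ) :
      μ.real (A δ m) ≤ 8 * (16).factorial * (8 * H / δ ^ 2) ^ 16 * (1 / 4) ^ m := by
    -- The power `q = 16` makes the tail `16 ^ (-m)`, which beats the `4 * 4 ^ m` grid pairs.
    have hone : ∀ p ∈ (Finset.range (2 ^ m + 1) ×ˢ Finset.range (2 ^ m + 1)).filter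
        fun p => treeDist f (g m p.1) (g m p.2) ≤ 4 * H * θ ^ m,
        μ.real {z : C(I, ℝ) | δ ≤ |z (g m p.1) - z (g m p.2)|} ≤
          2 * (16).factorial * (8 * H / δ ^ 2) ^ 16 * (1 / 16) ^ m := by
      intro p hp
      have h1 := (Finset.mem_filter.1 hp).2
      refine (gaussian_tail (h.hasLaw_sub _ _) (V := 4 * H * θ ^ m) ?_ (by positivity) hδ 16).trans
        (le_of_eq ?_)
      · rwa [Real.coe_toNNReal _ (treeDist_nonneg _ _ _)]
      · have h2 : 2 * (4 * H * θ ^ m) / δ ^ 2 = 8 * H / δ ^ 2 * θ ^ m := by ring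
        have h3 : (θ ^ m) ^ 16 = (1 / 16) ^ m := by
          rw [← pow_mul, hθ, ← pow_mul, show 4 * (m * 16) = 16 * (4 * m) by ring, pow_mul,
            chainingRate_pow, pow_mul]
          norm_num
        rw [h2, mul_pow, h3]; ring
    refine (measureReal_biUnion_finset_le _ _).trans ((Finset.sum_le_card_nsmul _ _ _ hone).trans ?_)
    rw [nsmul_eq_mul]
    have hcard : (((Finset.range (2 ^ m + 1) ×ˢ Finset.range (2 ^ m + 1)).filter
        fun p => treeDist f (g m p.1) (g m p.2) ≤ 4 * H * θ ^ m).card : ℝ) ≤ 4 * 4 ^ m := by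
      have h1 := Finset.card_filter_le (Finset.range (2 ^ m + 1) ×ˢ Finset.range (2 ^ m + 1))
        fun p => treeDist f (g m p.1) (g m p.2) ≤ 4 * H * θ ^ m
      rw [Finset.card_product, Finset.card_range] at h1
      have h2 : (2 ^ m + 1) * (2 ^ m + 1) ≤ 4 * 4 ^ m := by
        have h3 : 1 ≤ 2 ^ m := Nat.one_le_two_pow
        have h4 : 4 ^ m = 2 ^ m * 2 ^ m := by rw [← mul_pow]; rfl
        rw [h4]; nlinarith
      exact_mod_cast h1.trans h2
    calc _ ≤ 4 * 4 ^ m * (2 * (16).factorial * (8 * H / δ ^ 2) ^ 16 * (1 / 16) ^ m) :=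
          mul_le_mul_of_nonneg_right hcard (by positivity)
      _ = 8 * (16).factorial * (8 * H / δ ^ 2) ^ 16 * (4 ^ m * (1 / 16) ^ m) := by ring
      _ = _ := by rw [← mul_pow]; norm_num
  -- a violation at level `2 δ` forces `A δ m` for all large `m`
  have hev (δ : ℝ) (hδ : 0 < δ) (z : C(I, ℝ)) {s t : I} (hst : treeDist f s t = 0)
      (hz : 2 * δ ≤ |z s - z t|) : ∃ M, ∀ m ≥ M, z ∈ A δ m := by
    obtain ⟨η, hη, hzη⟩ := Metric.uniformContinuous_iff.1
      (CompactSpace.uniformContinuous_of_continuous z.continuous) (δ / 2) (by positivity)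
    obtain ⟨M, hM⟩ := exists_pow_lt_of_lt_one hη (by norm_num : (1 / 2 : ℝ) < 1)
    refine ⟨M, fun m hm => ?_⟩
    have happ (s : I) : ∃ j ≤ 2 ^ m, |(s : ℝ) - g m j| ≤ 1 / 2 ^ m := by
      have hs0 : 0 ≤ (s : ℝ) * 2 ^ m := mul_nonneg s.2.1 (by positivity)
      have h1 := Nat.floor_le hs0
      have h2 := Nat.lt_floor_add_one ((s : ℝ) * 2 ^ m)
      have h3 : ⌊(s : ℝ) * 2 ^ m⌋₊ ≤ 2 ^ m := by
        have : (⌊(s : ℝ) * 2 ^ m⌋₊ : ℝ) ≤ 2 ^ m :=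
          h1.trans (mul_le_of_le_one_left (by positivity) s.2.2)
        exact_mod_cast this
      refine ⟨_, h3, ?_⟩
      simp only [hg]
      rw [unitFrac_eq h3]
      push_cast
      have h2m : (0 : ℝ) < 2 ^ m := by positivity
      have h4 : (⌊(s : ℝ) * 2 ^ m⌋₊ : ℝ) / 2 ^ m ≤ s := (div_le_iff₀ h2m).2 h1
      rw [abs_of_nonneg (sub_nonneg.2 h4), sub_le_iff_le_add, ← add_div, le_div_iff₀ h2m]
      linarith
    obtain ⟨i, hi, his⟩ := happ s
    obtain ⟨j, hj, hjt⟩ := happ t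
    have hd (s : I) (j : ℕ) (hs : |(s : ℝ) - g m j| ≤ 1 / 2 ^ m) :
        treeDist f s (g m j) ≤ 2 * H * θ ^ m :=
      hf.treeDist_le ⟨unitInterval.nonneg s, unitInterval.le_one s⟩
        ⟨unitInterval.nonneg _, unitInterval.le_one _⟩ (by simpa using hs)
    have hzd (s : I) (j : ℕ) (hs : |(s : ℝ) - g m j| ≤ 1 / 2 ^ m) : |z s - z (g m j)| < δ / 2 := by
      refine hzη (lt_of_le_of_lt ?_ hM)
      refine hs.trans ?_
      rw [← one_div_pow]
      exact pow_le_pow_of_le_one (by norm_num) (by norm_num) hm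
    refine mem_iUnion₂.2 ⟨(i, j), Finset.mem_filter.2 ⟨Finset.mem_product.2
      ⟨Finset.mem_range.2 (by omega), Finset.mem_range.2 (by omega)⟩, ?_⟩, ?_⟩
    · have h1 := treeDist_triangle f (g m i) s (g m j)
      have h2 := treeDist_triangle f s t (g m j)
      have h3 := hd s i his
      have h4 := hd t j hjt
      rw [treeDist_comm] at h3
      simp only
      linarith
    · have h1 := hzd s i his
      have h2 := hzd t j hjt
      have h3 := abs_sub_le (z s) (z (g m i)) (z t)
      have h4 := abs_sub_le (z (g m i)) (z (g m j)) (z t)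
      rw [abs_sub_comm (z (g m j))] at h4
      simp only [mem_ofPred_eq]
      linarith
  have hnull (δ : ℝ) (hδ : 0 < δ) : μ {z | ∃ M, ∀ m ≥ M, z ∈ A δ m} = 0 := by
    rw [ofPred_exists]
    refine measure_iUnion_null fun M => ?_
    rw [← measureReal_eq_zero_iff]
    refine le_antisymm ?_ measureReal_nonneg
    have hlim : Filter.Tendsto (fun m : ℕ => 8 * (16).factorial * (8 * H / δ ^ 2) ^ 16 *
        (1 / 4 : ℝ) ^ m) Filter.atTop (𝓝 (8 * (16).factorial * (8 * H / δ ^ 2) ^ 16 * 0)) :=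
      (tendsto_pow_atTop_nhds_zero_of_lt_one (by norm_num) (by norm_num)).const_mul _
    rw [mul_zero] at hlim
    refine ge_of_tendsto hlim (Filter.eventually_atTop.2 ⟨M, fun m hm => ?_⟩)
    exact (measureReal_mono (fun z (hz : ∀ m ≥ M, z ∈ A δ m) => hz m hm)
      (measure_ne_top _ _)).trans (hApr δ hδ m)
  have hall : ∀ᵐ z ∂μ, ∀ N : ℕ, ¬ ∃ M, ∀ m ≥ M, z ∈ A (1 / ((N : ℝ) + 1) / 2) m :=
    ae_all_iff.2 fun N => measure_eq_zero_iff_ae_notMem.1 (hnull _ (by positivity))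
  filter_upwards [hall] with z hz s t hst
  by_contra hne
  obtain ⟨N, hN⟩ := exists_nat_one_div_lt (abs_pos.2 (sub_ne_zero.2 hne))
  exact hz N (hev _ (by positivity) z hst (by linarith))

end IsLabelLaw

/-- The labels oscillate by the square root of the amplitude of the tree. -/
theorem exists_oscillation_bound {C ε : ℝ} (hC : 0 < C) (hε : 0 < ε) :
    ∃ L : ℝ, 0 < L ∧ ∀ (f : C(I, ℝ)) (μ : Measure C(I, ℝ)) (a b : I) (δ : ℝ), IsLabelLaw f μ →
      a < b → 0 < δ → HasModulusOn f (C * δ) a b →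
      μ.real {z : C(I, ℝ) | ∃ s ∈ Icc a b, L * √δ < |z s - z a|} ≤ ε := by
  have hlim := tendsto_tail_bound (q := 16) (by norm_num)
  obtain ⟨R, hR, hR0⟩ := ((hlim.eventually (ge_mem_nhds hε)).and
    (Filter.eventually_gt_atTop 0)).exists
  have hθ0 : 0 < 1 - chainingRate := sub_pos.2 chainingRate_lt_one
  -- Label increments over cells of level `m` have variance at most `2 C δ * chainingRate ^ (4 *
  -- m)`. Thus `√(2 C δ)` sets the scale and the last factor is the chaining constant; nothing
  -- depends on the tree or the interval.
  refine ⟨R * √(2 * C) * (1 + 2 / (1 - chainingRate)), by positivity,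
    fun f μ a b δ hμ hab hδ hf => ?_⟩
  have hprob := hμ.isProbabilityMeasure
  have hab' : (0 : ℝ) < b - a := sub_pos.2 hab
  have hpt (x : ℝ) (hx : x ∈ Icc (0 : ℝ) 1) : (a : ℝ) + (b - a) * x ∈ Icc (a : ℝ) b :=
    ⟨by nlinarith [hx.1], by nlinarith [hx.2]⟩
  have hI (x : ℝ) (hx : x ∈ Icc (a : ℝ) b) : x ∈ I := ⟨a.2.1.trans hx.1, hx.2.trans b.2.2⟩
  set g : ℝ → I := fun x => projIcc 0 1 zero_le_one (a + (b - a) * x) with hg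
  have hgc : Continuous g := continuous_projIcc.comp (by fun_prop)
  have hgval (x : ℝ) (hx : x ∈ Icc (0 : ℝ) 1) : (g x : ℝ) = a + (b - a) * x := by
    simp only [hg, projIcc_of_mem _ (hI _ (hpt x hx))]
  have hgmem (x : ℝ) (hx : x ∈ Icc (0 : ℝ) 1) : g x ∈ Icc a b := by
    have := hpt x hx
    rw [← hgval x hx] at this
    exact this
  set s := √(2 * C * δ) with hs
  have hs0 : 0 < s := Real.sqrt_pos.2 (by positivity)
  have hfrac (m j : ℕ) (hj : j ≤ 2 ^ m) : ((j : ℕ) : ℝ) / 2 ^ m ∈ Icc (0 : ℝ) 1 :=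
    ⟨by positivity, (div_le_one (by positivity)).2 (by exact_mod_cast hj)⟩
  have hbound := dyadic_increments_bound (P := μ)
    (Y := fun m j z => z (g ((j + 1 : ℕ) / 2 ^ m)) - z (g ((j : ℕ) / 2 ^ m)))
    (x := chainingRate ^ 4) (y := chainingRate) (q := 16) hs0 hR0 chainingRate_four_pos
    chainingRate_pos ?_ ?_
  · refine (measureReal_mono ?_ (by finiteness)).trans (hbound.trans hR)
    rintro z ⟨w, hw, hlt⟩
    by_contra hcon
    simp only [mem_ofPred_eq, not_exists, not_and, not_le] at hcon
    have hx : ((w : ℝ) - a) / (b - a) ∈ Icc (0 : ℝ) 1 := by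
      have h1 : (a : ℝ) ≤ w := hw.1
      have h2 : (w : ℝ) ≤ b := hw.2
      exact ⟨div_nonneg (by linarith) hab'.le, (div_le_one hab').2 (by linarith)⟩
    have h1 := abs_sub_le_of_dyadic (g := fun x => z (g x)) (z.continuous.comp hgc).continuousOn
      (by positivity) chainingRate_pos chainingRate_lt_one
      (fun m j hj => (hcon m j hj).le) hx (t := 0) ⟨le_rfl, zero_le_one⟩ (m := 0)
      (by rw [sub_zero, abs_of_nonneg hx.1]; simpa using hx.2)
    have e1 : g (((w : ℝ) - a) / (b - a)) = w := by
      ext; rw [hgval _ hx, mul_div_cancel₀ _ hab'.ne']; ring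
    have e2 : g 0 = a := by
      ext; rw [hgval _ ⟨le_rfl, zero_le_one⟩]; ring
    simp only [e1, e2, pow_zero, mul_one] at h1
    have e3 : s = √(2 * C) * √δ := by rw [hs, Real.sqrt_mul (by positivity)]
    rw [e3] at h1
    have e4 : R * (√(2 * C) * √δ) * (1 + 2 / (1 - chainingRate)) =
      R * √(2 * C) * (1 + 2 / (1 - chainingRate)) * √δ := by ring
    linarith
  · rw [← pow_mul, ← pow_mul, show 4 * 16 = 2 * 16 + 16 * 2 by norm_num, pow_add,
      pow_mul chainingRate 16 2, chainingRate_pow]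
    ring
  · intro m j hj
    refine ⟨_, hμ.hasLaw_sub _ _, ?_⟩
    rw [Real.coe_toNNReal _ (treeDist_nonneg _ _ _), hs, Real.sq_sqrt (by positivity)]
    have h1 := hfrac m j hj.le
    have h2 := hfrac m (j + 1) hj
    refine (hf.treeDist_le (hgmem _ h2) (hgmem _ h1) (m := m) ?_).trans (le_of_eq (by ring))
    rw [hgval _ h1, hgval _ h2, add_sub_add_left_eq_sub, ← mul_sub, ← sub_div, abs_mul,
      abs_of_pos hab']
    push_cast
    rw [add_sub_cancel_left, abs_of_pos (by positivity), mul_one_div]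

/-! ### Stars in the labels of a combed tree -/

/-- The labels minus their regression on the increments along finitely many teeth. -/
noncomputable def residual {n : ℕ} (f : C(I, ℝ)) (u β : Fin n → I) (s : I) (z : C(I, ℝ)) : ℝ :=
  z s - ∑ i, bump f (u i) (β i) s / (f (u i) - f (β i)) * (z (u i) - z (β i))

theorem sub_mem_labelFunctionals (s t : I) :
    (fun z : C(I, ℝ) => z s - z t) ∈ labelFunctionals :=
  labelFunctionals.sub_mem (eval_mem_labelFunctionals s) (eval_mem_labelFunctionals t)

theorem residual_mem_labelFunctionals {n : ℕ} (f : C(I, ℝ)) (u β : Fin n → I) (s : I) :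
    residual f u β s ∈ labelFunctionals := by
  have : residual f u β s = (fun z : C(I, ℝ) => z s) - ∑ i, (bump f (u i) (β i) s /
      (f (u i) - f (β i))) • fun z : C(I, ℝ) => z (u i) - z (β i) := by
    ext z
    simp [residual]
  rw [this]
  exact labelFunctionals.sub_mem (eval_mem_labelFunctionals s) (labelFunctionals.sum_mem
    fun i _ => labelFunctionals.smul_mem _ (sub_mem_labelFunctionals _ _))

theorem continuous_residual {n : ℕ} (f : C(I, ℝ)) (u β : Fin n → I) (z : C(I, ℝ)) :
    Continuous fun s => residual f u β s z := by
  have := fun i => continuous_bump f (u i) (β i)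
  unfold residual
  fun_prop

theorem measurable_residual {n : ℕ} (f : C(I, ℝ)) (u β : Fin n → I) (s : I) :
    Measurable (residual f u β s) := by
  have : Continuous (residual f u β s) := by
    unfold residual
    fun_prop
  exact this.measurable

/-- No tooth meets the branch of another one. -/
def TeethDisjoint {ι : Type*} (l r u β : ι → I) : Prop :=
  ∀ p q, p ≠ q → u p ∉ Ioo (l q) (r q) ∧ β p ∉ Ioo (l q) (r q)

namespace IsLabelLaw

variable {f : C(I, ℝ)} {μ : Measure C(I, ℝ)}

/-- This identifies `bump` as the regression function of the labels on the increment along a tooth.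
-/
theorem covariance_eval_sub (h : IsLabelLaw f μ) (s u β : I) :
    cov[fun z : C(I, ℝ) => z s, fun z => z u - z β; μ] = bump f u β s := by
  have := h.isProbabilityMeasure
  rw [covariance_fun_sub_right (h.memLp s) (h.memLp u) (h.memLp β), h.covariance, h.covariance,
    bump]

theorem covariance_sub_sub (h : IsLabelLaw f μ) (s t u β : I) :
    cov[fun z : C(I, ℝ) => z s - z t, fun z => z u - z β; μ] = bump f u β s - bump f u β t := by
  have := h.isProbabilityMeasure
  have hL : MemLp (fun z : C(I, ℝ) => z u - z β) 2 μ := (h.memLp u).sub (h.memLp β)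
  rw [covariance_fun_sub_left (h.memLp s) (h.memLp t) hL,
    h.covariance_eval_sub, h.covariance_eval_sub]

section Teeth

variable {ι : Type*} {l r u β : ι → I}

theorem covariance_teeth_of_ne (h : IsLabelLaw f μ)
    (hβ : ∀ p, IsTooth f (l p) (r p) (u p) (β p)) (hd : TeethDisjoint l r u β) {p q : ι}
    (hpq : p ≠ q) :
    cov[fun z : C(I, ℝ) => z (u p) - z (β p), fun z => z (u q) - z (β q); μ] = 0 := by
  rw [h.covariance_sub_sub, (hβ q).bump_outside (hd p q hpq).1,
    (hβ q).bump_outside (hd p q hpq).2, sub_zero]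

/-- Bumps vanish outside their teeth, so increments along different teeth are uncorrelated; being
jointly Gaussian, they are independent. -/
theorem iIndepFun_teeth (h : IsLabelLaw f μ) (hβ : ∀ p, IsTooth f (l p) (r p) (u p) (β p))
    (hd : TeethDisjoint l r u β) :
    iIndepFun (fun p (z : C(I, ℝ)) => z (u p) - z (β p)) μ := by
  have h1 : iIndepFun (fun (p : ι) (z : C(I, ℝ)) (_ : Unit) => z (u p) - z (β p)) μ :=
    IsGaussianProcess.iIndepFun_of_covariance_eq_zero (S := fun _ => Unit)
      (X := fun p _ z => z (u p) - z (β p))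
      (h.gaussian_of_mem fun p => sub_mem_labelFunctionals _ _)
      (fun p _ => ((measurable_eval _).sub (measurable_eval _)).aemeasurable)
      fun p q hpq _ _ => h.covariance_teeth_of_ne hβ hd hpq
  exact h1.comp (fun _ y => y ()) fun _ => measurable_pi_apply _

end Teeth

variable {n : ℕ} {l r u β : Fin n → I}

/-- Only the term of tooth `j` contributes, and the variance along that tooth is `f (u j) - f (β
j)`, exactly the denominator in the regression. -/
theorem covariance_residual (h : IsLabelLaw f μ)
    (hβ : ∀ p, IsTooth f (l p) (r p) (u p) (β p)) (hd : TeethDisjoint l r u β)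
    (hv : ∀ i, f (β i) < f (u i)) (s : I) (j : Fin n) :
    cov[residual f u β s, fun z : C(I, ℝ) => z (u j) - z (β j); μ] = 0 := by
  have := h.isProbabilityMeasure
  have hL (s t : I) : MemLp (fun z : C(I, ℝ) => z s - z t) 2 μ := (h.memLp s).sub (h.memLp t)
  have hL' (i : Fin n) : MemLp (fun z : C(I, ℝ) => bump f (u i) (β i) s / (f (u i) - f (β i)) *
      (z (u i) - z (β i))) 2 μ := (hL _ _).const_mul _
  unfold residual
  rw [covariance_fun_sub_left (h.memLp s) (memLp_finsetSum _ fun i _ => hL' i) (hL _ _),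
    h.covariance_eval_sub, covariance_fun_sum_left hL' (hL _ _), Finset.sum_eq_single j]
  · rw [covariance_const_mul_left, h.covariance_sub_sub, (hβ j).bump_top, (hβ j).bump_foot,
      sub_zero, div_mul_cancel₀ _ (sub_pos.2 (hv j)).ne', sub_self]
  · intro i _ hij
    rw [covariance_const_mul_left, h.covariance_teeth_of_ne hβ hd hij, mul_zero]
  · simp

theorem indepFun_residual (h : IsLabelLaw f μ)
    (hβ : ∀ p, IsTooth f (l p) (r p) (u p) (β p)) (hd : TeethDisjoint l r u β)
    (hv : ∀ i, f (β i) < f (u i)) :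
    IndepFun (fun (z : C(I, ℝ)) i => z (u i) - z (β i)) (fun z s => residual f u β s z) μ := by
  refine (IsGaussianProcess.indepFun_of_covariance_eq_zero (X := residual f u β)
    (Y := fun i (z : C(I, ℝ)) => z (u i) - z (β i)) (h.gaussian_of_mem ?_)
    (fun s => (measurable_residual _ _ _ _).aemeasurable)
    (fun i => ((measurable_eval _).sub (measurable_eval _)).aemeasurable)
    (h.covariance_residual hβ hd hv)).symm
  rintro (s | i)
  · exact residual_mem_labelFunctionals _ _ _ _
  · exact sub_mem_labelFunctionals _ _

/-- Given the increments along the teeth, the residual labels are small with large probability. -/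
theorem measureReal_diff_le (h : IsLabelLaw f μ)
    (hβ : ∀ p, IsTooth f (l p) (r p) (u p) (β p)) (hd : TeethDisjoint l r u β)
    (hv : ∀ i, f (β i) < f (u i)) {a b : I} (hab : a ≤ b) (hl : ∀ i, a ≤ l i) (hr : ∀ i, r i ≤ b)
    {R ε : ℝ} (hosc : μ.real {z | ∃ s ∈ Icc a b, R < |z s - z a|} ≤ ε)
    {S : Set (Fin n → ℝ)} (hS : MeasurableSet S) :
    μ.real ({z | (fun i => z (u i) - z (β i)) ∈ S} \
      {z | ∀ s ∈ Icc a b, |residual f u β s z - z a| ≤ (1 + 2 * n) * R}) ≤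
      ε * μ.real {z | (fun i => z (u i) - z (β i)) ∈ S} := by
  have := h.isProbabilityMeasure
  have hmem (i : Fin n) : u i ∈ Icc a b ∧ β i ∈ Icc a b :=
    ⟨⟨(hl i).trans (hβ i).left_le, (hβ i).le_right.trans (hr i)⟩,
      ⟨(hl i).trans (hβ i).foot_mem.1, (hβ i).foot_mem.2.trans (hr i)⟩⟩
  have hresa (z : C(I, ℝ)) : residual f u β a z = z a := by
    rw [residual, sub_eq_self]
    refine Finset.sum_eq_zero fun i _ => ?_
    rw [(hβ i).bump_outside fun ha => absurd ha.1 (not_lt.2 (hl i)), zero_div, zero_mul]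
  -- A dense sequence clamped into `[a, b]`: by continuity of the residual, countably many times
  -- suffice, which makes the event measurable in the product σ-algebra used for independence.
  set c : ℕ → I := fun m => (TopologicalSpace.denseSeq I m ⊔ a) ⊓ b with hc
  have hcmem (m : ℕ) : c m ∈ Icc a b := ⟨le_inf le_sup_right hab, inf_le_right⟩
  set T : Set (I → ℝ) := {y | ∀ m, |y (c m) - y a| ≤ (1 + 2 * n) * R} with hT
  have hTm : MeasurableSet T := by
    rw [hT, ofPred_forall]
    exact MeasurableSet.iInter fun m => measurableSet_le (by fun_prop) measurable_const
  have hsub : {z | (fun i => z (u i) - z (β i)) ∈ S} \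
      {z | ∀ s ∈ Icc a b, |residual f u β s z - z a| ≤ (1 + 2 * n) * R} ⊆
      (fun (z : C(I, ℝ)) i => z (u i) - z (β i)) ⁻¹' S ∩
        (fun (z : C(I, ℝ)) s => residual f u β s z) ⁻¹' Tᶜ := by
    refine fun z hz => ⟨hz.1, fun hzT => hz.2 fun s hs => ?_⟩
    have hcl : IsClosed {s : I | |residual f u β ((s ⊔ a) ⊓ b) z - z a| ≤ (1 + 2 * n) * R} :=
      isClosed_le (((continuous_residual f u β z).comp (by fun_prop)).sub continuous_const).abs
        continuous_const
    have hall := hcl.closure_subset_iff.2 (range_subset_iff.2 fun m => by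
      have h1 := hzT m
      simp only [hresa] at h1
      exact h1) (TopologicalSpace.denseRange_denseSeq I s)
    simpa only [mem_ofPred_eq, sup_eq_left.2 hs.1, inf_eq_left.2 hs.2] using hall
  -- If the labels oscillate by at most `R`, each of the `n` regression terms is at most `2 * R`,
  -- since the normalised bumps are at most `1`. This gives the factor `1 + 2 * n`.
  have hbad : (fun (z : C(I, ℝ)) s => residual f u β s z) ⁻¹' Tᶜ ⊆
      {z | ∃ s ∈ Icc a b, R < |z s - z a|} := by
    intro z hz
    by_contra hcon
    simp only [mem_ofPred_eq, not_exists, not_and, not_lt] at hcon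
    refine hz fun m => ?_
    simp only [hresa]
    have h1 (i : Fin n) : |bump f (u i) (β i) (c m) / (f (u i) - f (β i)) *
        (z (u i) - z (β i))| ≤ 2 * R := by
      have h2 := hcon _ (hmem i).1
      have h3 := hcon _ (hmem i).2
      have h4 := abs_sub_le (z (u i)) (z a) (z (β i))
      rw [abs_sub_comm (z a)] at h4
      have h5 : 0 < f (u i) - f (β i) := sub_pos.2 (hv i)
      rw [abs_mul, abs_of_nonneg (div_nonneg ((hβ i).bump_nonneg _) h5.le)]
      refine (mul_le_of_le_one_left (abs_nonneg _)
        ((div_le_one h5).2 ((hβ i).bump_le _))).trans ?_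
      linarith
    have h2 := (Finset.abs_sum_le_sum_abs (fun i => bump f (u i) (β i) (c m) /
      (f (u i) - f (β i)) * (z (u i) - z (β i))) Finset.univ).trans
      (Finset.sum_le_card_nsmul _ _ _ fun i _ => h1 i)
    rw [Finset.card_univ, Fintype.card_fin, nsmul_eq_mul] at h2
    have h3 := hcon _ (hcmem m)
    have h4 := abs_le.1 h2
    have h5 := abs_le.1 h3
    rw [residual, abs_le]
    constructor <;> linarith [h4.1, h4.2, h5.1, h5.2]
  refine (measureReal_mono hsub (measure_ne_top _ _)).trans ?_
  have hind := (h.indepFun_residual hβ hd hv).measure_inter_preimage_eq_mul _ _ hS hTm.compl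
  rw [measureReal_def, hind, ENNReal.toReal_mul, mul_comm]
  exact mul_le_mul_of_nonneg_right ((measureReal_mono hbad (measure_ne_top _ _)).trans hosc)
    measureReal_nonneg

/-- The labels of a tree with infinitely many combs almost surely contain a star. -/
theorem ae_hasLabelStar (hμ : IsLabelLaw f μ) (hf : HasCombs n f) :
    ∀ᵐ z ∂μ, HasLabelStar n f z := by
  have := hμ.isProbabilityMeasure
  obtain ⟨C, hC, a, b, δ, t, hcomb, hdisj⟩ := hf
  choose β hβ hβv using fun k i => (hcomb k).exists_isTooth i
  set u : ℕ → Fin n → I := fun k i => t k (2 * i + 1) with hu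
  have hv (k : ℕ) (i : Fin n) : f (β k i) < f (u k i) := by
    linarith [hβv k i, (hcomb k).pos]
  have hv' (k : ℕ) (i : Fin n) : f (u k i) - f (β k i) ≤ C * δ k := by
    have h1 := (hcomb k).mem (2 * i + 1)
    have h2 : β k i ∈ Icc (a k) (b k) := ⟨((hcomb k).mem _).1.trans (hβ k i).foot_mem.1,
      (hβ k i).foot_mem.2.trans ((hcomb k).mem _).2⟩
    have h3 := (hcomb k).modulus 0 _ h1 _ h2 ?_
    · rw [pow_zero, mul_one] at h3
      exact (le_abs_self _).trans h3
    · have e1 : (a k : ℝ) ≤ u k i := h1.1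
      have e2 : (u k i : ℝ) ≤ b k := h1.2
      have e3 : (a k : ℝ) ≤ β k i := h2.1
      have e4 : (β k i : ℝ) ≤ b k := h2.2
      rw [pow_zero, div_one, abs_le]
      constructor <;> linarith
  have hfar (k : ℕ) (i j : Fin n) (hij : i ≠ j) {s : I}
      (hs : s ∈ Icc (t k (2 * i)) (t k (2 * i + 2))) :
      s ∉ Ioo (t k (2 * j)) (t k (2 * j + 2)) := by
    rintro ⟨h1, h2⟩
    rcases lt_or_gt_of_ne (Fin.val_ne_of_ne hij) with hlt | hlt
    · exact absurd (h1.trans_le hs.2) (not_lt.2 ((hcomb k).mono (by omega)))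
    · exact absurd (hs.1.trans_lt h2) (not_lt.2 ((hcomb k).mono (by omega)))
  have hout (k l : ℕ) (i j : Fin n) (hkl : (k, i) ≠ (l, j)) {s : I}
      (hs : s ∈ Icc (t k (2 * i)) (t k (2 * i + 2))) :
      s ∉ Ioo (t l (2 * j)) (t l (2 * j + 2)) := by
    by_cases hk : k = l
    · subst hk
      exact hfar k i j (fun h => hkl (by rw [h])) hs
    · rintro ⟨h1, h2⟩
      have e1 : a k ≤ s := ((hcomb k).mem _).1.trans hs.1
      have e2 : s ≤ b k := hs.2.trans ((hcomb k).mem _).2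
      have e3 : a l < s := ((hcomb l).mem _).1.trans_lt h1
      have e4 : s < b l := h2.trans_le ((hcomb l).mem _).2
      rcases hdisj k l hk with h | h
      · exact absurd (e3.trans_le (e2.trans h)) (lt_irrefl _)
      · exact absurd (e4.trans_le (h.trans e1)) (lt_irrefl _)
  have humem (k : ℕ) (i : Fin n) : u k i ∈ Icc (t k (2 * i)) (t k (2 * i + 2)) :=
    ⟨(hβ k i).left_le, (hβ k i).le_right⟩
  have hind := hμ.iIndepFun_teeth (ι := ℕ × Fin n) (fun p => hβ p.1 p.2) fun p q hpq =>
    ⟨hout p.1 q.1 p.2 q.2 hpq (humem _ _), hout p.1 q.1 p.2 q.2 hpq (hβ _ _).foot_mem⟩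
  have hdk (k : ℕ) : TeethDisjoint (fun i : Fin n => t k (2 * i)) (fun i => t k (2 * i + 2))
      (u k) (β k) := fun p q hpq => ⟨hfar k p q hpq (humem k p), hfar k p q hpq (hβ k p).foot_mem⟩
  have hmeas : MeasurableSet {z | HasLabelStar n f z} :=
    ((isOpen_hasLabelStar n).preimage (f := fun z : C(I, ℝ) => (f, z)) (by fun_prop)).measurableSet
  refine ae_of_forall_one_sub_le hmeas fun ε hε => ?_
  obtain ⟨L, hL, hosc⟩ := exists_oscillation_bound hC hε
  -- The scale of the star in comb `k` is the residual bound at confidence `1 - ε`. It depends on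
  -- `ε`, but the event of containing some star does not.
  set r : ℕ → ℝ := fun k => (1 + 2 * n) * (L * √(δ k)) with hr
  have hδ (k : ℕ) : 0 < √(δ k) := Real.sqrt_pos.2 (hcomb k).pos
  have hr0 (k : ℕ) : 0 < r k := by have := hδ k; positivity
  set S : ℕ → Set ℝ := fun k => Icc (202 * r k) (204 * r k) with hSdef
  set B : ℕ × Fin n → Set C(I, ℝ) := fun p => (fun z => z (u p.1 p.2) - z (β p.1 p.2)) ⁻¹' S p.1
    with hB
  set E : ℕ → Set C(I, ℝ) := fun k => {z | (fun i => z (u k i) - z (β k i)) ∈ univ.pi fun _ => S k}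
    with hE
  have hES (K : Finset ℕ) : μ.real (⋂ k ∈ K, E k) = ∏ k ∈ K, ∏ i, μ.real (B (k, i)) := by
    have h1 := hind.measure_inter_preimage_eq_mul (K ×ˢ Finset.univ)
      (sets := fun p => S p.1) fun _ _ => measurableSet_Icc
    rw [Finset.prod_product] at h1
    have h2 : ⋂ k ∈ K, E k = ⋂ p ∈ K ×ˢ (Finset.univ : Finset (Fin n)),
        (fun z : C(I, ℝ) => z (u p.1 p.2) - z (β p.1 p.2)) ⁻¹' S p.1 := by
      ext z
      simp only [hE, mem_iInter, mem_ofPred_eq, mem_pi, mem_univ, true_imp_iff, mem_preimage,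
        Finset.mem_product, Finset.mem_univ, and_true, Prod.forall]
      exact forall_congr' fun _ => forall_comm
    rw [h2, measureReal_def, h1, ENNReal.toReal_prod]
    simp only [ENNReal.toReal_prod]
    rfl
  have hE1 (k : ℕ) : μ.real (E k) = ∏ i, μ.real (B (k, i)) := by simpa using hES {k}
  -- The variance along a tooth lies between `δ k` and `C * δ k` and the window is a fixed multiple
  -- of `√(δ k)`, so the lower bound is the same for all combs.
  set p₀ := (204 * ((1 + 2 * n) * L) - 202 * ((1 + 2 * n) * L)) * ((√(2 * Real.pi * C))⁻¹ *
    Real.exp (-(204 * ((1 + 2 * n) * L)) ^ 2 / (2 * 1))) with hp₀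
  have hp₀0 : 0 < p₀ := by
    have h1 : 0 < (1 + 2 * n) * L := by positivity
    have h2 : 0 < 204 * ((1 + 2 * n) * L) - 202 * ((1 + 2 * n) * L) := by linarith
    positivity
  have hBp (p : ℕ × Fin n) : p₀ ≤ μ.real (B p) := by
    have h1 := gaussian_window (hμ.hasLaw_sub (u p.1 p.2) (β p.1 p.2)) (hδ p.1) one_pos (c' := C)
      (a := 202 * ((1 + 2 * n) * L)) (b := 204 * ((1 + 2 * n) * L)) ?_ ?_ (by positivity) ?_
    · refine h1.trans (le_of_eq ?_)
      congr 1
      ext z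
      simp only [hB, hSdef, hr, mem_ofPred_eq, mem_preimage, mul_assoc]
    · rw [Real.coe_toNNReal _ (treeDist_nonneg _ _ _), Real.sq_sqrt (hcomb p.1).pos.le,
        (hβ p.1 p.2).treeDist_eq]
      linarith [hβv p.1 p.2]
    · rw [Real.coe_toNNReal _ (treeDist_nonneg _ _ _), Real.sq_sqrt (hcomb p.1).pos.le,
        (hβ p.1 p.2).treeDist_eq]
      exact hv' p.1 p.2
    · have h1 : 0 < (1 + 2 * n) * L := by positivity
      linarith
  have hEm (k : ℕ) : MeasurableSet (E k) :=
    (measurable_pi_lambda _ fun i => (measurable_eval (u k i)).sub (measurable_eval (β k i)))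
      (MeasurableSet.univ_pi fun _ => measurableSet_Icc)
  set G : ℕ → Set C(I, ℝ) := fun k =>
    {z | ∀ s ∈ Icc (a k) (b k), |residual f (u k) (β k) s z - z (a k)| ≤ r k} with hG
  have hGm (k : ℕ) : MeasurableSet (G k) := by
    have hcl : IsClosed (G k) := by
      simp only [hG, ofPred_forall]
      refine isClosed_iInter fun s => isClosed_iInter fun _ => isClosed_le ?_ continuous_const
      unfold residual
      fun_prop
    exact hcl.measurableSet
  refine (one_sub_le_measureReal_iUnion (E := E) (G := G) (pow_pos hp₀0 n)
    (fun k => (hEm k).nullMeasurableSet) (fun k => (hGm k).nullMeasurableSet) (fun k => ?_)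
    (fun k l hkl => ?_) fun k => ?_).trans (measureReal_mono ?_ (measure_ne_top _ _))
  · rw [hE1]
    simpa using Finset.prod_le_prod (s := (Finset.univ : Finset (Fin n))) (fun _ _ => hp₀0.le)
      fun i _ => hBp (k, i)
  · have h1 := hES {k, l}
    rw [Finset.prod_pair hkl, ← hE1, ← hE1] at h1
    simpa using h1
  · exact hμ.measureReal_diff_le (hβ k) (hdk k) (hv k) (hcomb k).lt.le
      (fun i => ((hcomb k).mem _).1) (fun i => ((hcomb k).mem _).2)
      (hosc f μ (a k) (b k) (δ k) hμ (hcomb k).lt (hcomb k).pos (hcomb k).modulus)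
      (MeasurableSet.univ_pi fun _ => measurableSet_Icc)
  · refine iUnion_subset fun k z hz => ?_
    exact hasLabelStar_of_comb (hcomb k) (hβ k) (hv k) (Y := fun s => residual f (u k) (β k) s z)
      (ξ := fun i => z (u k i) - z (β k i)) (fun s => by simp only [residual, hu]; ring) (hr0 k)
      hz.2 fun i => hz.1 i (mem_univ i)

end IsLabelLaw

theorem hasLabelStar_zero (f z : C(I, ℝ)) : HasLabelStar 0 f z :=
  ⟨1, one_pos, 0, Fin.elim0, fun i => i.elim0, fun i => i.elim0, fun i => i.elim0,
    fun i => i.elim0⟩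

/-- All that the labels require of the tree: a global minimum at time `0` for the cactus bound, a
modulus of continuity for labels to be well defined on the tree, and combs for the stars. -/
theorem IsBrownianExcursion.ae_hasModulusOn_and_hasCombs {Ω : Type*} [MeasurableSpace Ω]
    {P : Measure Ω} {e : Ω → C(I, ℝ)} (he : IsBrownianExcursion e P) :
    ∀ᵐ ω ∂P, (∀ u, e ω 0 ≤ e ω u) ∧ (∃ H : ℝ, 0 < H ∧ HasModulusOn (e ω) H 0 1) ∧
      ∀ n, 0 < n → HasCombs n (e ω) := by
  obtain ⟨-, W, hW, heW⟩ := he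
  have hfreq := ae_all_iff.2 fun n : ℕ => ae_all_iff.2 fun hn : 0 < n =>
    (ae_frequently_scaleIncr_mem hW.toIsPreBrownianReal hn).choose_spec.2
  filter_upwards [heW, hW.cont, hW.toIsPreBrownianReal.eval_zero_ae_eq_zero,
    ae_exists_dyadic_bound hW.toIsPreBrownianReal, hfreq] with ω h1 h2 h3 ⟨R, hR, h4⟩ h5
  exact ⟨excursion_ge h2 h1, excursion_hasModulusOn h2 h3 h1 hR h4, fun n hn =>
    excursion_hasCombs h2 h1 (ae_frequently_scaleIncr_mem hW.toIsPreBrownianReal hn).choose_spec.1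
      (h5 n hn)⟩

/-- The Brownian map is almost surely starry. -/
theorem ae_isStarry {Ω : Type*} [MeasurableSpace Ω] {P : Measure Ω} [IsProbabilityMeasure P]
    {e Z : Ω → C(I, ℝ)} (he : IsBrownianExcursion e P) (hZ : IsGaussianLabelling Z e P) :
    ∀ᵐ ω ∂P, IsStarry (MapSpace (e ω) (Z ω)) := by
  obtain ⟨κ, hκ, hcd, hlaw⟩ := hZ
  have hlabel : ∀ᵐ ω ∂P, IsLabelLaw (e ω) (κ (e ω)) := by
    filter_upwards [ae_of_ae_map he.1 hlaw] with ω h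
    exact ⟨h.1, h.2.1, h.2.2⟩
  have hexc := he.ae_hasModulusOn_and_hasCombs
  have hfac : ∀ᵐ ω ∂P, LabelsFactor (e ω) (Z ω) := by
    refine ae_of_hasCondDistrib hcd measurableSet_labelsFactor ?_
    filter_upwards [hlabel, hexc] with ω h1 h2
    obtain ⟨H, hH, hf⟩ := h2.2.1
    exact h1.ae_labelsFactor hH hf
  have hstar : ∀ᵐ ω ∂P, ∀ n, HasLabelStar n (e ω) (Z ω) := by
    refine ae_all_iff.2 fun n => ?_
    rcases n.eq_zero_or_pos with rfl | hn
    · exact .of_forall fun ω => hasLabelStar_zero _ _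
    · refine ae_of_hasCondDistrib hcd (isOpen_hasLabelStar n).measurableSet ?_
      filter_upwards [hlabel, hexc] with ω h1 h2
      exact h1.ae_hasLabelStar (h2.2.2 n hn)
  filter_upwards [hexc, hfac, hstar] with ω h1 h2 h3
  exact isStarry_mapSpace h2 h1.1 h3

end BrownianMap

theorem mainTheorem4 {Ω : Type*} [MeasurableSpace Ω] (P : MeasureTheory.Measure Ω)
    [MeasureTheory.IsProbabilityMeasure P]
    (e Z : Ω → C(unitInterval, ℝ))
    (he : BrownianMap.IsBrownianExcursion e P)
    (hZ : BrownianMap.IsGaussianLabelling Z e P) :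
    ∀ᵐ ω ∂P,
      BrownianMap.IsStarry (BrownianMap.MapSpace (e ω) (Z ω)) ∧
      ∀ α : ℝ, 0 < α → α ≤ 1 →
      ∀ Ψ : ℝ → ℝ, BrownianMap.IsDistortionFunction Ψ →
      ∀ (X : Type*) [MetricSpace X], BrownianMap.IsDoublingSpace X →
        (∀ φ : BrownianMap.MapSpace (e ω) (Z ω) ≃ₜ X,
          ¬ BrownianMap.SatisfiesSnowflakeQuasisymmetry α Ψ φ) ∧
        (∀ φ : BrownianMap.MapSpace (e ω) (Z ω) → X, Topology.IsEmbedding φ →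
          ¬ BrownianMap.SatisfiesSnowflakeQuasisymmetry α Ψ φ) := by
  filter_upwards [BrownianMap.ae_isStarry he hZ] with ω h
  exact ⟨h, fun α hα _ Ψ hΨ X _ hX =>
    ⟨fun φ => h.not_satisfiesSnowflakeQuasisymmetry hX hα hΨ φ.injective,
      fun φ hφ => h.not_satisfiesSnowflakeQuasisymmetry hX hα hΨ hφ.injective⟩⟩
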